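/- There are a randomized streaming algorithm and a constant $C$ such that the following holds for all integers $n\ge 2$ and $U\ge 1$. Call a rational number $U$-rational if it is $0$ or of the form $\pm p/q$ with $p,q\in\{1,\dots,U\}$. Let $A,B\subset\mathbb{R}^2=\mathbb{C}$ be multisets of $n$ points each (counted with multiplicity) whose coordinates are $U$-rational, and let the $2n$ points, each with its label "A" or "B", be given as a stream in arbitrary order. The algorithm knows $n$ and $U$, scans the stream three times from left to right, uses private fair coins, and always halts; for every input and every outcome of the coins its total memory, including the work space of its computations, never exceeds $C\log_2 n\,(\log_2 n+\log_2 U)$ bits. For every input, with probability at least $1-1/n$ the algorithm answers correctly: if there are $\rho,t\in\mathbb{C}$ with $|\rho|=1$ such that $z\mapsto \rho z+t$ maps $A$ onto $B$ with multiplicities (a rotation followed by a translation), then it outputs such a pair $(\rho,t)$, exactly, with rational coordinates; and if there is no such pair, then it outputs $\perp$. Here an algorithm is a single finite program, independent of $n$ and $U$, over finitely many integer registers, with the operations $+,-,\cdot$, integer division and remainder, comparisons, loops and coin flips; each datum is read exactly, its coordinates as fractions in lowest terms; and its memory is the total number of bits in all registers, maximized over all configurations of the computation. -/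

import Mathlib

namespace CongStream

/-! ### The geometric problem -/

/-- `U`-rational numbers: `0` and all `± p / q` with `p, q ∈ {1, …, U}`. -/
def boundedQ (U : ℕ) : Set ℚ :=
  {x | x = 0 ∨ ∃ p ∈ Finset.Icc 1 U, ∃ q ∈ Finset.Icc 1 U,
    x = (p : ℚ) / (q : ℚ) ∨ x = -((p : ℚ) / (q : ℚ))}

/-- A rational point of the plane, given by its two coordinates. -/
abbrev Point : Type := ℚ × ℚ

/-- The point `(x, y)` of the plane as the complex number `x + y i`. -/
noncomputable def Point.toComplex (z : Point) : ℂ := ⟨(z.1 : ℝ), (z.2 : ℝ)⟩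

/-- `A` is congruent to `B` via the rotation `z ↦ ρ z` (where `|ρ| = 1`) and the translation by
`t`: the map `z ↦ ρ z + t` carries `A` to `B` with multiplicities. -/
def CongruentVia (A B : Multiset ℂ) (ρ t : ℂ) : Prop :=
  ‖ρ‖ = 1 ∧ A.map (fun z => ρ * z + t) = B

/-- The two labels of the stream data. -/
inductive Label
  | A
  | B
  deriving DecidableEq

/-- One datum of the stream: a label and a point. -/
abbrev Item : Type := Label × Point

/-- The multiset of points that carry the label `l` in the stream `L`. -/
noncomputable def pointsOf (l : Label) (L : List Item) : Multiset ℂ :=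
  (((L.filter (fun d => d.1 = l)).map (fun d => d.2.toComplex) : List ℂ) : Multiset ℂ)

/-- The streams that present an instance: `n` points labelled `A` and `n` points labelled `B`,
in an arbitrary order, all coordinates being `U`-rational. -/
def IsInstance (n U : ℕ) (L : List Item) : Prop :=
  (L.filter (fun d => d.1 = Label.A)).length = n ∧
  (L.filter (fun d => d.1 = Label.B)).length = n ∧
  ∀ d ∈ L, d.2.1 ∈ boundedQ U ∧ d.2.2 ∈ boundedQ U

/-- Correct answers of congruence identification: a pair `(ρ, t)` that certifies the congruence,
or `none` (that is, `⊥`) if the two multisets are not congruent. -/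
def IsSolution (A B : Multiset ℂ) : Option (Point × Point) → Prop
  | none => ¬ ∃ ρ t : ℂ, CongruentVia A B ρ t
  | some (ρ, t) => CongruentVia A B ρ.toComplex t.toComplex

/-! ### The machine model

A streaming algorithm is a fixed finite program over finitely many integer registers. Everything
that it stores or computes with, between two data of the stream as well as while it treats a datum,
has to be kept in the registers, and its space is the maximum, over all configurations that occur,
of the total number of bits in the registers. Since one elementary operation on numbers of `b` bits
needs `O(b)` bits of additional work space, this is the work space of a Turing machine up to a
constant factor. The stream is read-only and is read from left to right; random bits are fair
coins, which are lost unless they are stored in a register. -/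

/-- The arithmetical operations. -/
inductive Op
  | add
  | sub
  | mul
  | div
  | mod
  | lt
  | eq

/-- The value of an operation; comparisons return `1` or `0`. -/
def Op.eval : Op → ℤ → ℤ → ℤ
  | .add, a, b => a + b
  | .sub, a, b => a - b
  | .mul, a, b => a * b
  | .div, a, b => a / b
  | .mod, a, b => a % b
  | .lt, a, b => if a < b then 1 else 0
  | .eq, a, b => if a = b then 1 else 0

/-- Elementary instructions, over registers named by `ι`. -/
inductive Instr (ι : Type)
  /-- `r := c` -/
  | const (r : ι) (c : ℤ)
  /-- `r := f a b` -/
  | op (f : Op) (r a b : ι)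
  /-- put a fair coin, `0` or `1`, into `r` -/
  | flip (r : ι)
  /-- read the next symbol of the stream: `lab` becomes `1` or `2` for a datum labelled `A` or `B`,
  whose coordinates are then put into `xn / xd` and `yn / yd` in lowest terms; `lab` becomes `0` if
  the end of the current pass (or of the last pass) is met -/
  | read (lab xn xd yn yd : ι)

/-- Programs: sequences of instructions, branching and loops. Tests are of the form `r ≠ 0`. -/
inductive Cmd (ι : Type)
  | instr (i : Instr ι)
  | seq (c d : Cmd ι)
  | ite (r : ι) (c d : Cmd ι)
  | loop (r : ι) (c : Cmd ι)

/-- A configuration: the registers, the rest of the input tape (`none` is the mark at the end of a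
pass), and the coins that are not yet used. -/
structure Config (ι : Type) where
  reg : ι → ℤ
  tape : List (Option Item)
  coins : ℕ → Bool

/-- Number of bits of an integer: its binary length and a sign bit. -/
def bits (a : ℤ) : ℕ := Nat.size a.natAbs + 1

/-- The memory in use in a configuration, in bits. -/
def Config.mem {ι : Type} [Fintype ι] (s : Config ι) : ℕ := ∑ r, bits (s.reg r)

/-- The code of a label. -/
def Label.code : Label → ℤ
  | .A => 1
  | .B => 2

/-- The effect of an elementary instruction. -/
def Instr.step {ι : Type} [DecidableEq ι] : Instr ι → Config ι → Config ι
  | .const r c, s => { s with reg := Function.update s.reg r c }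
  | .op f r a b, s => { s with reg := Function.update s.reg r (f.eval (s.reg a) (s.reg b)) }
  | .flip r, s =>
    { s with
      reg := Function.update s.reg r (if s.coins 0 then 1 else 0)
      coins := fun i => s.coins (i + 1) }
  | .read lab xn xd yn yd, s =>
    match s.tape with
    | [] => { s with reg := Function.update s.reg lab 0 }
    | none :: rest => { s with reg := Function.update s.reg lab 0, tape := rest }
    | some d :: rest =>
      { s with
        reg := Function.update (Function.update (Function.update (Function.update
          (Function.update s.reg xn d.2.1.num) xd (d.2.1.den : ℤ))
          yn d.2.2.num) yd (d.2.2.den : ℤ)) lab d.1.code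
        tape := rest }

/-- `Exec c s s' m`: started in `s`, the command `c` halts in `s'`, and `m` is the maximum of the
memory in use over all configurations of this computation. -/
inductive Exec {ι : Type} [Fintype ι] [DecidableEq ι] :
    Cmd ι → Config ι → Config ι → ℕ → Prop
  | instr (i : Instr ι) (s : Config ι) :
      Exec (.instr i) s (i.step s) (max s.mem (i.step s).mem)
  | seq {c d : Cmd ι} {s s₁ s₂ : Config ι} {m₁ m₂ : ℕ}
      (h₁ : Exec c s s₁ m₁) (h₂ : Exec d s₁ s₂ m₂) : Exec (.seq c d) s s₂ (max m₁ m₂)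
  | ite_true {r : ι} {c d : Cmd ι} {s s' : Config ι} {m : ℕ}
      (h : s.reg r ≠ 0) (h₁ : Exec c s s' m) : Exec (.ite r c d) s s' m
  | ite_false {r : ι} {c d : Cmd ι} {s s' : Config ι} {m : ℕ}
      (h : s.reg r = 0) (h₁ : Exec d s s' m) : Exec (.ite r c d) s s' m
  | loop_done {r : ι} {c : Cmd ι} {s : Config ι}
      (h : s.reg r = 0) : Exec (.loop r c) s s s.mem
  | loop_step {r : ι} {c : Cmd ι} {s s₁ s₂ : Config ι} {m₁ m₂ : ℕ}
      (h : s.reg r ≠ 0) (h₁ : Exec c s s₁ m₁) (h₂ : Exec (.loop r c) s₁ s₂ m₂) :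
      Exec (.loop r c) s s₂ (max m₁ m₂)

/-- A streaming algorithm for congruence identification: a program over finitely many registers,
with the registers that hold the parameters `n` and `U` at the start and those that hold the answer
at the end. -/
structure Algorithm where
  ι : Type
  [fintype : Fintype ι]
  [decEq : DecidableEq ι]
  body : Cmd ι
  regN : ι
  regU : ι
  verdict : ι
  out : Fin 8 → ι

attribute [instance] Algorithm.fintype Algorithm.decEq

/-- The input tape of `k` passes over the stream `L`: `k` copies of `L`, each followed by an end
mark. -/
def passes (k : ℕ) (L : List Item) : List (Option Item) :=
  (List.replicate k (L.map some ++ [none])).flatten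

/-- The initial configuration: `n` and `U` are stored, all other registers are `0`. -/
def Algorithm.init (P : Algorithm) (k n U : ℕ) (L : List Item) (ω : ℕ → Bool) : Config P.ι where
  reg := Function.update (Function.update (fun _ => 0) P.regN (n : ℤ)) P.regU (U : ℤ)
  tape := passes k L
  coins := ω

/-- With `k` passes over `L` and the coins `ω`, the algorithm halts in `s` and uses `m` bits. -/
def Algorithm.Run (P : Algorithm) (k n U : ℕ) (L : List Item) (ω : ℕ → Bool)
    (s : Config P.ι) (m : ℕ) : Prop :=
  Exec P.body (P.init k n U L ω) s m

/-- The integers `a`, `b` represent the rational number `q` as a fraction `a / b`. -/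
def IsFrac (a b : ℤ) (q : ℚ) : Prop := b ≠ 0 ∧ q = (a : ℚ) / (b : ℚ)

/-- The answer that is stored in a final configuration: `⊥` if the verdict is `0`, and if it is `1`,
the pair `(ρ, t)` whose four coordinates are stored as fractions. -/
def Algorithm.Answers (P : Algorithm) (s : Config P.ι) : Option (Point × Point) → Prop
  | none => s.reg P.verdict = 0
  | some (ρ, t) => s.reg P.verdict = 1 ∧
      IsFrac (s.reg (P.out 0)) (s.reg (P.out 1)) ρ.1 ∧
      IsFrac (s.reg (P.out 2)) (s.reg (P.out 3)) ρ.2 ∧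
      IsFrac (s.reg (P.out 4)) (s.reg (P.out 5)) t.1 ∧
      IsFrac (s.reg (P.out 6)) (s.reg (P.out 7)) t.2

/-- With `k` passes over `L` and the coins `ω`, the algorithm halts with a correct answer. -/
def Algorithm.Succeeds (P : Algorithm) (k n U : ℕ) (L : List Item) (ω : ℕ → Bool) : Prop :=
  ∃ (s : Config P.ι) (m : ℕ) (o : Option (Point × Point)),
    P.Run k n U L ω s m ∧ P.Answers s o ∧
      IsSolution (pointsOf Label.A L) (pointsOf Label.B L) o

/-- The law of an infinite sequence of independent fair coins. -/
noncomputable def coinLaw : MeasureTheory.Measure (ℕ → Bool) :=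
  MeasureTheory.Measure.infinitePi fun _ : ℕ => (PMF.uniformOfFintype Bool).toMeasure

end CongStream

/-!
A rotation by `ρ` and a translation that map `A` onto `B` map the centroid of `A` to that of `B`.
With the centred points `a' = n a - ∑ A` and `b' = n b - ∑ B`, a congruence therefore means
`{ρ a'} = {b'}`, and `∏ b' = ρ ^ k ∏ a'` over the `k` nonzero ones. The products are too long to
be stored, so the algorithm calculates modulo a prime `p` of `O(log n + log U)` bits.

*The rotation.* The rotation `ρ` of a congruence is a quotient of differences of points, hence has
numerators and denominator polynomial in `U` (`Cong.red_rotation`). The algorithm searches for any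
rational rotation `(X + Y i) / M` of that size with `(X + Y i) ^ k ∏ a' ≡ M ^ k ∏ b'`. The prime
is chosen such that two rotations with equal `k`-th powers modulo `p` differ only by a quarter
turn. Let `P + Q i` be the numerator of their quotient. Then `p` divides the imaginary part of
`(P + Q i) ^ k`. Over the integers, that imaginary part vanishes only if `P + Q i` lies on one of
the four lines through `0` in the directions `1`, `i`, `1 ± i` (`gaussian_im_pow_eq_zero`, from
unique factorization in `ℤ[i]`), and the diagonals are excluded since `√2` is irrational. So it
suffices that `p` divides none of the nonzero imaginary parts that can occur; their product has
polynomially many digits, so a prime of polynomial size exists (`exists_goodPrime`) and can be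
found by search, which needs only space. Thus four candidates for `ρ` remain (`Cong.exists_turn`).
In a field of characteristic `p` the role of `i` is played by the two square roots of `-1`. The
factors are the centred points whose norm is not zero modulo `p`, and if there are none, then all
points of `A` are equal (`all_eq_of_ctrNorm_eq_zero`) and every rotation will do.

*The translation* that belongs to a candidate is determined by the sums modulo `p`, and is
recovered by a search for a number of small height.

*The test.* In a third pass, each of the four candidates is tested by the fingerprints
`∏ (M r - (X + Y i) a')` and `∏ (M r - M b')` modulo `p`, at one random number `r < 2 ^ b`, where
`2 ^ b ≥ 4 n²`. A congruence always passes. For a pair `(ρ, t)` that is not a congruence, the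
multisets are different modulo `p` as well, because all heights are small against `p`
(`Red.eq_iff`), so that two different polynomials of degree `n` are compared, which agree at no
more than `n` values of `r` (`exists_finset_of_not_cong`). The four candidates are known before
the coins are flipped, hence at most `4 n` values of `r` lead to an error
(`exists_exceptional_values`), and the probability of an error is at most `4 n / 4 n² = 1 / n`.

*The space.* The program is written in a language of integer expressions with bounded iteration,
`Ex`, which is compiled to the machine (`Ex.comp_runs`). Iteration reduces its variable modulo
`m² + 1`, and so every expression `e` has a constant `Ex.wt e` such that all numbers that occur in
its evaluation are at most `K ^ wt e` if the variables are at most `K ≥ 2`. The program consists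
of a fixed number of blocks of such expressions, and its passes and its loop keep the bound on the
variables. All registers are therefore polynomial in `n U`, which amounts to `O(log n + log U)`
bits.
-/

namespace CongStream

/-! ### Expressions -/

/-- Integer expressions over named variables. `iter x N m a b` is the value of `x` after `N` rounds
of `x := b mod (m² + 1)`, started with `x = a`; the reduction keeps its values bounded. -/
inductive Ex (V : Type)
  | var (v : V)
  | lit (c : ℤ)
  | bin (f : Op) (a b : Ex V)
  | iter (x : V) (N m a b : Ex V)

lemma two_le_pow {K : ℤ} (hK : 2 ≤ K) {w : ℕ} (hw : 1 ≤ w) : 2 ≤ K ^ w :=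
  hK.trans (le_self_pow₀ (by linarith) (by omega))

lemma abs_lit_le {K : ℤ} (hK : 2 ≤ K) (c : ℤ) : |c| ≤ K ^ (c.natAbs + 1) := by
  have h1 : (c.natAbs : ℤ) ≤ 2 ^ c.natAbs := by exact_mod_cast Nat.lt_two_pow_self.le
  have h2 : (2 : ℤ) ^ c.natAbs ≤ K ^ c.natAbs := pow_le_pow_left₀ (by norm_num) hK _
  have h3 : K ^ c.natAbs ≤ K ^ (c.natAbs + 1) := pow_le_pow_right₀ (by linarith) (by omega)
  rw [Int.abs_eq_natAbs]; linarith

lemma abs_op_le (f : Op) {a b A B : ℤ} (ha : |a| ≤ A) (hb : |b| ≤ B) (hA : 2 ≤ A) (hB : 2 ≤ B) :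
    |f.eval a b| ≤ A * B := by
  have hA' : A ≤ A * B := by nlinarith
  have hB' : B ≤ A * B := by nlinarith
  have hS : A + B ≤ A * B := by nlinarith
  cases f with
  | add => exact (abs_add_le a b).trans (by linarith)
  | sub => exact (abs_sub a b).trans (by linarith)
  | mul => simp only [Op.eval, abs_mul]; gcongr
  | div => exact (Int.abs_ediv_le_abs a b).trans (by linarith)
  | mod =>
    simp only [Op.eval]
    rcases eq_or_ne b 0 with rfl | h
    · simpa using ha.trans hA'
    · rw [abs_of_nonneg (Int.emod_nonneg a h)]
      have := Int.emod_lt_abs a h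
      linarith
  | lt => simp only [Op.eval]; split_ifs <;> norm_num <;> linarith
  | eq => simp only [Op.eval]; split_ifs <;> norm_num <;> linarith

/-- One round of the loop of `Ex.iter`, with `b` the value of the body as a function of `x`. -/
def iterStep (b : ℤ → ℤ) (m y : ℤ) : ℤ := b y % (m * m + 1)

lemma abs_iterStep_le (b : ℤ → ℤ) {m A : ℤ} (hm : |m| ≤ A) (y : ℤ) :
    |iterStep b m y| ≤ A * A := by
  have h0 : 0 < m * m + 1 := by nlinarith [mul_self_nonneg m]
  unfold iterStep
  rw [abs_of_nonneg (Int.emod_nonneg _ h0.ne')]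
  have := Int.emod_lt_of_pos (b y) h0
  nlinarith [abs_mul_abs_self m, abs_nonneg m]

/-- The variable bound by `Ex.iter` stays bounded, regardless of the number of rounds. -/
lemma abs_iterate_le {K : ℤ} (hK : 2 ≤ K) {wa wm : ℕ} {a m : ℤ} (b : ℤ → ℤ) (ha : |a| ≤ K ^ wa)
    (hm : |m| ≤ K ^ wm) (i : ℕ) : |(iterStep b m)^[i] a| ≤ K ^ (wa + (2 * wm + 1)) := by
  cases i with
  | zero => exact ha.trans (pow_le_pow_right₀ (by linarith) (by omega))
  | succ i =>
    rw [Function.iterate_succ_apply']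
    refine (abs_iterStep_le b hm _).trans ?_
    rw [← pow_add]
    exact pow_le_pow_right₀ (by linarith) (by omega)

namespace Ex

variable {V : Type}

/-- An exponent `w` such that all numbers that occur in the evaluation are at most `K ^ w` in
absolute value if all variables are at most `K`. -/
def wt : Ex V → ℕ
  | var _ => 1
  | lit c => c.natAbs + 1
  | bin _ a b => wt a + wt b
  | iter _ N m a b => wt N + (wt a + (2 * wt m + 1)) * (wt b + 1)

/-- The number of temporary registers that the evaluation needs, apart from the one that receives
the value. -/
def depth : Ex V → ℕ
  | var _ => 0
  | lit _ => 0
  | bin _ a b => depth a + depth b + 1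
  | iter _ N m a b => depth N + depth m + depth a + depth b + 4

lemma wt_pos (e : Ex V) : 1 ≤ e.wt := by
  cases e with
  | var v => simp [wt]
  | lit c => simp [wt]
  | bin f a b => have := wt_pos a; simp only [wt]; omega
  | iter x N m a b => have := wt_pos N; simp only [wt]; omega

variable [DecidableEq V]

/-- The value of an expression; the variable bound by `iter` is local. -/
def eval : Ex V → (V → ℤ) → ℤ
  | var v, σ => σ v
  | lit c, _ => c
  | bin f a b, σ => f.eval (a.eval σ) (b.eval σ)
  | iter x N m a b, σ =>
    (iterStep (fun y => b.eval (Function.update σ x y)) (m.eval σ))^[(N.eval σ).toNat] (a.eval σ)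

lemma abs_eval_le (e : Ex V) : ∀ {σ : V → ℤ} {K : ℤ}, 2 ≤ K → (∀ v, |σ v| ≤ K) →
    |e.eval σ| ≤ K ^ e.wt := by
  induction e with
  | var v => intro σ K hK h; simpa [eval, wt] using h v
  | lit c => intro σ K hK h; exact abs_lit_le hK c
  | bin f a b iha ihb =>
    intro σ K hK h
    simp only [eval, wt, pow_add]
    exact abs_op_le f (iha hK h) (ihb hK h) (two_le_pow hK a.wt_pos) (two_le_pow hK b.wt_pos)
  | iter x N m a b ihN ihm iha ihb =>
    intro σ K hK h
    refine (abs_iterate_le hK _ (iha hK h) (ihm hK h) _).trans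
      (pow_le_pow_right₀ (by linarith) ?_)
    simp only [wt]; nlinarith

end Ex

/-! ### Execution of programs with a memory bound -/

section machine

variable {ι : Type}

/-- All registers are at most `M` in absolute value. -/
def Config.Small (M : ℤ) (s : Config ι) : Prop := ∀ r, |s.reg r| ≤ M

/-- A memory bound for configurations whose registers are at most `M`. -/
def memBound (ι : Type) [Fintype ι] (M : ℤ) : ℕ := Fintype.card ι * bits M

lemma Config.Small.mem_le [Fintype ι] {M : ℤ} {s : Config ι} (h : s.Small M) :
    s.mem ≤ memBound ι M := by
  unfold Config.mem memBound
  rw [← Finset.card_univ, ← smul_eq_mul]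
  refine Finset.sum_le_card_nsmul _ _ _ fun r _ => ?_
  unfold bits
  have := h r
  have h2 : (s.reg r).natAbs ≤ M.natAbs := by
    have := le_abs_self M
    zify; linarith
  have := Nat.size_le_size h2
  omega

variable [DecidableEq ι]

/-- The configuration `s` with `x` in the register `r`. -/
def Config.set (s : Config ι) (r : ι) (x : ℤ) : Config ι :=
  { s with reg := Function.update s.reg r x }

lemma Config.Small.set {M : ℤ} {s : Config ι} (h : s.Small M) (r : ι) {x : ℤ} (hx : |x| ≤ M) :
    (s.set r x).Small M := by
  intro r'
  by_cases h' : r' = r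
  · subst h'; simpa [Config.set] using hx
  · simpa [Config.set, h'] using h r'

@[simp] lemma Config.set_reg_self (s : Config ι) (r : ι) (x : ℤ) : (s.set r x).reg r = x := by
  simp [Config.set]

lemma Config.set_reg_of_ne (s : Config ι) {r r' : ι} (x : ℤ) (h : r' ≠ r) :
    (s.set r x).reg r' = s.reg r' := by
  simp [Config.set, h]

variable [Fintype ι]

/-- The command `c` leads from `s` to `s'` within the memory bound for numbers up to `M`. -/
def Runs (M : ℤ) (c : Cmd ι) (s s' : Config ι) : Prop := ∃ m ≤ memBound ι M, Exec c s s' m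

lemma Runs.seq {M : ℤ} {c d : Cmd ι} {s s₁ s₂ : Config ι} (h₁ : Runs M c s s₁)
    (h₂ : Runs M d s₁ s₂) : Runs M (.seq c d) s s₂ := by
  obtain ⟨m₁, hm₁, h₁⟩ := h₁
  obtain ⟨m₂, hm₂, h₂⟩ := h₂
  exact ⟨_, max_le hm₁ hm₂, .seq h₁ h₂⟩

lemma Runs.loop_done {M : ℤ} {r : ι} {c : Cmd ι} {s : Config ι} (hs : s.Small M)
    (h : s.reg r = 0) : Runs M (.loop r c) s s :=
  ⟨_, hs.mem_le, .loop_done h⟩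

lemma Runs.loop_step {M : ℤ} {r : ι} {c : Cmd ι} {s s₁ s₂ : Config ι} (h : s.reg r ≠ 0)
    (h₁ : Runs M c s s₁) (h₂ : Runs M (.loop r c) s₁ s₂) : Runs M (.loop r c) s s₂ := by
  obtain ⟨m₁, hm₁, h₁⟩ := h₁
  obtain ⟨m₂, hm₂, h₂⟩ := h₂
  exact ⟨_, max_le hm₁ hm₂, .loop_step h h₁ h₂⟩

lemma Runs.instr {M : ℤ} {i : Instr ι} {s : Config ι} (hs : s.Small M) (hs' : (i.step s).Small M) :
    Runs M (.instr i) s (i.step s) :=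
  ⟨_, max_le hs.mem_le hs'.mem_le, .instr i s⟩

lemma Runs.const {M : ℤ} {s : Config ι} (hs : s.Small M) (r : ι) {c : ℤ} (hc : |c| ≤ M) :
    Runs M (.instr (.const r c)) s (s.set r c) :=
  .instr hs (hs.set r hc)

lemma Runs.op {M : ℤ} {s : Config ι} (hs : s.Small M) (f : Op) (r a b : ι)
    (hc : |f.eval (s.reg a) (s.reg b)| ≤ M) :
    Runs M (.instr (.op f r a b)) s (s.set r (f.eval (s.reg a) (s.reg b))) :=
  .instr hs (hs.set r hc)

/-- The command `r := a`, for two different registers. -/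
def Cmd.copy (r a : ι) : Cmd ι := .seq (.instr (.const r 0)) (.instr (.op .add r r a))

lemma Runs.copy {M : ℤ} {s : Config ι} (hs : s.Small M) {r a : ι} (h : a ≠ r) :
    Runs M (Cmd.copy r a) s (s.set r (s.reg a)) := by
  have hM : |(0 : ℤ)| ≤ M := by simpa using (abs_nonneg _).trans (hs r)
  have h1 := Runs.const hs r hM
  have h2 := Runs.op (hs.set r hM) .add r r a (by
    simpa [Op.eval, Config.set_reg_of_ne _ _ h] using hs a)
  have h3 : (s.set r 0).set r (Op.eval .add ((s.set r 0).reg r) ((s.set r 0).reg a))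
      = s.set r (s.reg a) := by
    simp [Op.eval, Config.set, Function.update_of_ne h]
  exact h1.seq (h3 ▸ h2)

end machine

/-! ### Compilation of expressions -/

/-- The registers of a compiled program: one for each variable, and `D + 1` temporary ones. -/
abbrev Reg (V : Type) (D : ℕ) : Type := V ⊕ Fin (D + 1)

/-- The temporary register number `j`, for `j ≤ D`. -/
def tmp {V : Type} {D : ℕ} (j : ℕ) : Reg V D := .inr (Fin.ofNat (D + 1) j)

section compile

variable {V : Type} {D : ℕ}

lemma tmp_ne_tmp {i j : ℕ} (h : i ≠ j) (hi : i ≤ D) (hj : j ≤ D) :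
    (tmp i : Reg V D) ≠ tmp j := by
  intro e
  simp only [tmp, Sum.inr.injEq, Fin.ext_iff, Fin.val_ofNat] at e
  rw [Nat.mod_eq_of_lt (by omega), Nat.mod_eq_of_lt (by omega)] at e
  exact h e

lemma inl_ne_tmp (v : V) (j : ℕ) : (.inl v : Reg V D) ≠ tmp j := by simp [tmp]

lemma tmp_ne_inl (v : V) (j : ℕ) : (tmp j : Reg V D) ≠ .inl v := by simp [tmp]

/-- The command that puts into register `d + 3` whether the counter in register `d` is positive. -/
def counterFlag (V : Type) (D d : ℕ) : Cmd (Reg V D) :=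
  .seq (.instr (.const (tmp (d + 3)) 0)) (.instr (.op .lt (tmp (d + 3)) (tmp (d + 3)) (tmp d)))

/-- The command that puts the value of an expression into the temporary register `d` and keeps the
variables and the temporary registers below `d`. For a loop, the registers from `d` on hold the
number of rounds to go, the modulus, the outer value of the bound variable, and the loop test. -/
def Ex.comp (D : ℕ) : ℕ → Ex V → Cmd (Reg V D)
  | d, .var v => Cmd.copy (tmp d) (.inl v)
  | d, .lit c => .instr (.const (tmp d) c)
  | d, .bin f a b =>
    .seq (Ex.comp D d a) <| .seq (Ex.comp D (d + 1) b) <|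
    .instr (.op f (tmp d) (tmp d) (tmp (d + 1)))
  | d, .iter x N m a b =>
    .seq (Ex.comp D d N) <|
    .seq (Ex.comp D (d + 1) m) <|
    .seq (.instr (.op .mul (tmp (d + 1)) (tmp (d + 1)) (tmp (d + 1)))) <|
    .seq (.instr (.const (tmp (d + 2)) 1)) <|
    .seq (.instr (.op .add (tmp (d + 1)) (tmp (d + 1)) (tmp (d + 2)))) <|
    .seq (Cmd.copy (tmp (d + 2)) (.inl x)) <|
    .seq (Ex.comp D (d + 3) a) <|
    .seq (Cmd.copy (.inl x) (tmp (d + 3))) <|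
    .seq (counterFlag V D d) <|
    .seq (.loop (tmp (d + 3)) <|
      .seq (Ex.comp D (d + 4) b) <|
      .seq (.instr (.op .mod (.inl x) (tmp (d + 4)) (tmp (d + 1)))) <|
      .seq (.instr (.const (tmp (d + 4)) 1)) <|
      .seq (.instr (.op .sub (tmp d) (tmp d) (tmp (d + 4)))) <|
      counterFlag V D d) <|
    .seq (Cmd.copy (tmp d) (.inl x)) <|
    Cmd.copy (.inl x) (tmp (d + 2))

/-- `s'` arises from `s` by an evaluation into the temporary register `d`, with the value `y`. -/
structure Evaluated (M : ℤ) (d : ℕ) (y : ℤ) (s s' : Config (Reg V D)) : Prop where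
  small : s'.Small M
  tape : s'.tape = s.tape
  coins : s'.coins = s.coins
  var : ∀ v, s'.reg (.inl v) = s.reg (.inl v)
  low : ∀ j < d, s'.reg (tmp j) = s.reg (tmp j)
  val : s'.reg (tmp d) = y

variable [DecidableEq V]

lemma Evaluated.of_set {M : ℤ} {d : ℕ} {y : ℤ} {s : Config (Reg V D)} (hd : d ≤ D)
    (hs : s.Small M) (hy : |y| ≤ M) : Evaluated M d y s (s.set (tmp d) y) where
  small := hs.set _ hy
  tape := rfl
  coins := rfl
  var v := s.set_reg_of_ne _ (inl_ne_tmp v d)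
  low j hj := s.set_reg_of_ne _ (tmp_ne_tmp hj.ne (by omega) hd)
  val := s.set_reg_self _ _

variable [Fintype V]

lemma counterFlag_runs {M : ℤ} {d : ℕ} {s : Config (Reg V D)} (hd : d + 3 ≤ D) (hM : 2 ≤ M)
    (hs : s.Small M) :
    Runs M (counterFlag V D d) s (s.set (tmp (d + 3)) (if 0 < s.reg (tmp d) then 1 else 0)) := by
  have h0 : |(0 : ℤ)| ≤ M := by simp; linarith
  have hne : (tmp d : Reg V D) ≠ tmp (d + 3) := tmp_ne_tmp (by omega) (by omega) hd
  have h1 := Runs.const hs (tmp (d + 3)) h0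
  have h2 := Runs.op (hs.set (tmp (d + 3)) h0) .lt (tmp (d + 3)) (tmp (d + 3)) (tmp d) (by
    simp only [Op.eval]; split_ifs <;> simp <;> linarith)
  have h3 : (s.set (tmp (d + 3)) 0).set (tmp (d + 3)) (Op.eval .lt
      ((s.set (tmp (d + 3)) 0).reg (tmp (d + 3))) ((s.set (tmp (d + 3)) 0).reg (tmp d)))
      = s.set (tmp (d + 3)) (if 0 < s.reg (tmp d) then 1 else 0) := by
    simp [Op.eval, Config.set, Function.update_of_ne hne]
  exact h1.seq (h3 ▸ h2)

/-- The loop of a compiled `Ex.iter` before a round: `c` rounds are to go and the bound variable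
is `y`. -/
structure LoopInv (M : ℤ) (d : ℕ) (x : V) (q c y : ℤ) (s s' : Config (Reg V D)) : Prop where
  small : s'.Small M
  tape : s'.tape = s.tape
  coins : s'.coins = s.coins
  var : ∀ v, v ≠ x → s'.reg (.inl v) = s.reg (.inl v)
  low : ∀ j < d, s'.reg (tmp j) = s.reg (tmp j)
  bound : s'.reg (.inl x) = y
  counter : s'.reg (tmp d) = c
  modulus : s'.reg (tmp (d + 1)) = q
  saved : s'.reg (tmp (d + 2)) = s.reg (.inl x)
  flag : s'.reg (tmp (d + 3)) = if 0 < c then 1 else 0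

/-- The loop of a compiled `Ex.iter` runs as many rounds as its counter says. -/
lemma loop_runs {M : ℤ} {d : ℕ} {x : V} {q : ℤ} {body : Cmd (Reg V D)} {f : ℤ → ℤ}
    {s : Config (Reg V D)} {G : ℤ → Prop} (hG : ∀ y, G y → G (f y))
    (hbody : ∀ s' c y, G y → 0 < c → LoopInv M d x q c y s s' →
      ∃ s'', Runs M body s' s'' ∧ LoopInv M d x q (c - 1) (f y) s s'') (i : ℕ) :
    ∀ s' c y, G y → c.toNat = i → LoopInv M d x q c y s s' →
      ∃ s'' c', Runs M (.loop (tmp (d + 3)) body) s' s'' ∧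
        LoopInv M d x q c' (f^[i] y) s s'' := by
  induction i with
  | zero =>
    intro s' c y hy hc h
    exact ⟨s', c, .loop_done h.small (by rw [h.flag, if_neg (by omega)]), h⟩
  | succ i ih =>
    intro s' c y hy hc h
    obtain ⟨s₁, r₁, h₁⟩ := hbody s' c y hy (by omega) h
    obtain ⟨s₂, c', r₂, h₂⟩ := ih s₁ (c - 1) (f y) (hG y hy) (by omega) h₁
    exact ⟨s₂, c', .loop_step (by rw [h.flag, if_pos (by omega)]; simp) r₁ r₂, h₂⟩

lemma Evaluated.binop {M : ℤ} {d : ℕ} {y z : ℤ} {s s₁ s₂ : Config (Reg V D)} (hd : d + 1 ≤ D)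
    (h₁ : Evaluated M d y s s₁) (h₂ : Evaluated M (d + 1) z s₁ s₂) (f : Op)
    (hM : |f.eval y z| ≤ M) :
    ∃ s₃, Runs M (.instr (.op f (tmp d) (tmp d) (tmp (d + 1)))) s₂ s₃ ∧
      Evaluated M d (f.eval y z) s s₃ := by
  have hy : s₂.reg (tmp d) = y := by rw [h₂.low d (by omega), h₁.val]
  have r := Runs.op h₂.small f (tmp d) (tmp d) (tmp (d + 1)) (by rwa [hy, h₂.val])
  rw [hy, h₂.val] at r
  have h₃ := Evaluated.of_set (d := d) (by omega) h₂.small hM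
  exact ⟨_, r, h₃.small, h₂.tape.trans h₁.tape, h₂.coins.trans h₁.coins,
    fun v => by rw [h₃.var, h₂.var, h₁.var],
    fun j hj => by rw [h₃.low j hj, h₂.low j (by omega), h₁.low j hj], h₃.val⟩

/-- A compiled expression is evaluated correctly, within the memory bound. -/
lemma Ex.comp_runs (e : Ex V) : ∀ {d : ℕ} {s : Config (Reg V D)} {K M : ℤ}, d + e.depth ≤ D →
    2 ≤ K → (∀ v, |s.reg (.inl v)| ≤ K) → K ^ e.wt ≤ M → s.Small M →
    ∃ s', Runs M (e.comp D d) s s' ∧ Evaluated M d (e.eval fun v => s.reg (.inl v)) s s' := by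
  induction e with
  | var v =>
    intro d s K M hd hK hv hM hs
    exact ⟨_, Runs.copy hs (inl_ne_tmp v d), .of_set (by omega) hs (hs _)⟩
  | lit c =>
    intro d s K M hd hK hv hM hs
    have hc : |c| ≤ M := (abs_lit_le hK c).trans hM
    exact ⟨_, Runs.const hs _ hc, .of_set (by omega) hs hc⟩
  | bin f a b iha ihb =>
    intro d s K M hd hK hv hM hs
    simp only [depth] at hd
    have hval := (abs_eval_le (bin f a b) hK hv).trans hM
    simp only [wt] at hM
    obtain ⟨s₁, r₁, h₁⟩ := iha (d := d) (by omega) hK hv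
      ((pow_le_pow_right₀ (by linarith) (by omega)).trans hM) hs
    obtain ⟨s₂, r₂, h₂⟩ := ihb (d := d + 1) (s := s₁) (by omega) hK
      (fun v => by rw [h₁.var]; exact hv v)
      ((pow_le_pow_right₀ (by linarith) (by omega)).trans hM) h₁.small
    simp only [h₁.var] at h₂
    obtain ⟨s₃, r₃, h₃⟩ := h₁.binop (by omega) h₂ f hval
    exact ⟨s₃, r₁.seq (r₂.seq r₃), h₃⟩
  | iter x N m a b ihN ihm iha ihb =>
    intro d s K M hd hK hv hM hs
    simp only [depth] at hd
    set σ : V → ℤ := fun v => s.reg (.inl v) with hσ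
    -- `sᵢ` is the configuration after the `i`-th of the commands before the loop
    have hpow : ∀ {w w' : ℕ}, w ≤ w' → K ^ w ≤ K ^ w' :=
      fun h => pow_le_pow_right₀ (by linarith) h
    have hM2 : 2 ≤ M := (two_le_pow hK (wt_pos _)).trans hM
    have hwt : wt (iter x N m a b) = wt N + (wt a + (2 * wt m + 1)) * (wt b + 1) := rfl
    have hw' : wt a + (2 * wt m + 1) ≤ wt (iter x N m a b) := by rw [hwt]; nlinarith
    obtain ⟨s₁, r₁, h₁⟩ := ihN (d := d) (by omega) hK hv
      ((hpow (by rw [hwt]; omega)).trans hM) hs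
    obtain ⟨s₂, r₂, h₂⟩ := ihm (d := d + 1) (s := s₁) (by omega) hK
      (fun v => by rw [h₁.var]; exact hv v) ((hpow (by omega)).trans hM) h₁.small
    simp only [h₁.var] at h₂
    have hmb : |m.eval σ| ≤ K ^ m.wt := abs_eval_le m hK hv
    have hsq : m.eval σ * m.eval σ + 1 ≤ M := by
      refine le_trans ?_ ((hpow hw').trans hM)
      have h3 : K ^ (2 * m.wt + 1) ≤ K ^ (wt a + (2 * wt m + 1)) := hpow (by omega)
      have h4 : K ^ (2 * m.wt + 1) = K ^ m.wt * K ^ m.wt * K := by ring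
      have h5 : m.eval σ * m.eval σ ≤ K ^ m.wt * K ^ m.wt := by
        rw [← abs_mul_abs_self]; gcongr
      have h6 := two_le_pow hK m.wt_pos
      nlinarith
    set q := m.eval σ * m.eval σ + 1 with hq
    have hq0 : 0 < q := by nlinarith [mul_self_nonneg (m.eval σ)]
    have hm2 : s₂.reg (tmp (d + 1)) = m.eval σ := h₂.val
    have r₃ := Runs.op h₂.small .mul (tmp (d + 1)) (tmp (d + 1)) (tmp (d + 1)) (by
      simp only [Op.eval]; rw [hm2, abs_mul_self]; linarith)
    simp only [Op.eval, hm2] at r₃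
    have hs₃ := h₂.small.set (tmp (d + 1)) (x := m.eval σ * m.eval σ) (by
      rw [abs_mul_self]; linarith)
    set s₃ := s₂.set (tmp (d + 1)) (m.eval σ * m.eval σ) with hs₃'
    have hone : |(1 : ℤ)| ≤ M := by simp; linarith
    have r₄ := Runs.const hs₃ (tmp (d + 2)) hone
    have hs₄ := hs₃.set (tmp (d + 2)) hone
    set s₄ := s₃.set (tmp (d + 2)) 1 with hs₄'
    have hne12 : (tmp (d + 1) : Reg V D) ≠ tmp (d + 2) :=
      tmp_ne_tmp (by omega) (by omega) (by omega)
    have e1 : s₄.reg (tmp (d + 1)) = m.eval σ * m.eval σ := by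
      rw [hs₄', Config.set_reg_of_ne _ _ hne12, hs₃', Config.set_reg_self]
    have e2 : s₄.reg (tmp (d + 2)) = 1 := Config.set_reg_self _ _ _
    have hqM : |q| ≤ M := by rwa [abs_of_pos hq0]
    have r₅ := Runs.op hs₄ .add (tmp (d + 1)) (tmp (d + 1)) (tmp (d + 2)) (by
      simp only [Op.eval, e1, e2]; exact hqM)
    simp only [Op.eval, e1, e2] at r₅
    have hs₅ := hs₄.set (tmp (d + 1)) hqM
    rw [← hq] at r₅
    set s₅ := s₄.set (tmp (d + 1)) q with hs₅'
    have r₆ := Runs.copy hs₅ (inl_ne_tmp (D := D) x (d + 2))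
    have var5 : ∀ v, s₅.reg (.inl v) = s.reg (.inl v) := fun v => by
      rw [hs₅', Config.set_reg_of_ne _ _ (inl_ne_tmp _ _), hs₄',
        Config.set_reg_of_ne _ _ (inl_ne_tmp _ _), hs₃',
        Config.set_reg_of_ne _ _ (inl_ne_tmp _ _), h₂.var, h₁.var]
    rw [var5] at r₆
    have hs₆ := hs₅.set (tmp (d + 2)) (hs (.inl x))
    set s₆ := s₅.set (tmp (d + 2)) (s.reg (.inl x)) with hs₆'
    have var6 : ∀ v, s₆.reg (.inl v) = s.reg (.inl v) := fun v => by
      rw [hs₆', Config.set_reg_of_ne _ _ (inl_ne_tmp _ _), var5]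
    have low6 : ∀ j ≤ d, s₆.reg (tmp j) = s₁.reg (tmp j) := fun j hj => by
      rw [hs₆', Config.set_reg_of_ne _ _ (tmp_ne_tmp (by omega) (by omega) (by omega)), hs₅',
        Config.set_reg_of_ne _ _ (tmp_ne_tmp (by omega) (by omega) (by omega)), hs₄',
        Config.set_reg_of_ne _ _ (tmp_ne_tmp (by omega) (by omega) (by omega)), hs₃',
        Config.set_reg_of_ne _ _ (tmp_ne_tmp (by omega) (by omega) (by omega)),
        h₂.low j (by omega)]
    have q6 : s₆.reg (tmp (d + 1)) = q := by
      rw [hs₆', Config.set_reg_of_ne _ _ hne12, hs₅', Config.set_reg_self]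
    have tape6 : s₆.tape = s.tape := h₂.tape.trans h₁.tape
    have coins6 : s₆.coins = s.coins := h₂.coins.trans h₁.coins
    obtain ⟨s₇, r₇, h₇⟩ := iha (d := d + 3) (s := s₆) (by omega) hK
      (fun v => by rw [var6]; exact hv v) ((hpow (by omega)).trans hM) hs₆
    simp only [var6] at h₇
    have r₈ := Runs.copy h₇.small (tmp_ne_inl (D := D) x (d + 3))
    rw [h₇.val] at r₈
    have hab : |a.eval σ| ≤ K ^ a.wt := abs_eval_le a hK hv
    have hs₈ := h₇.small.set (.inl x) (hab.trans ((hpow (by omega)).trans hM))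
    set s₈ := s₇.set (.inl x) (a.eval σ) with hs₈'
    have r₉ := counterFlag_runs (d := d) (by omega) hM2 hs₈
    have hflag : ∀ c : ℤ, |(if 0 < c then 1 else 0 : ℤ)| ≤ M := fun c => by
      split_ifs <;> simp <;> linarith
    have hs₉ := hs₈.set (tmp (d + 3)) (hflag (s₈.reg (tmp d)))
    have c8 : s₈.reg (tmp d) = N.eval σ := by
      rw [hs₈', Config.set_reg_of_ne _ _ (tmp_ne_inl _ _), h₇.low d (by omega), low6 d le_rfl,
        h₁.val]
    rw [c8] at r₉ hs₉
    set s₉ := s₈.set (tmp (d + 3)) (if 0 < N.eval σ then 1 else 0) with hs₉'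
    have low9 : ∀ j < d + 3, s₉.reg (tmp j) = s₆.reg (tmp j) := fun j hj => by
      rw [hs₉', Config.set_reg_of_ne _ _ (tmp_ne_tmp (by omega) (by omega) (by omega)), hs₈',
        Config.set_reg_of_ne _ _ (tmp_ne_inl _ _), h₇.low j hj]
    -- the loop invariant holds at the start and is kept by the body
    have inv9 : LoopInv M d x q (N.eval σ) (a.eval σ) s s₉ :=
      { small := hs₉
        tape := h₇.tape.trans tape6
        coins := h₇.coins.trans coins6
        var := fun v hvx => by
          rw [hs₉', Config.set_reg_of_ne _ _ (inl_ne_tmp _ _), hs₈',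
            Config.set_reg_of_ne _ _ (by simpa using hvx), h₇.var, var6]
        low := fun j hj => by rw [low9 j (by omega), low6 j hj.le, h₁.low j hj]
        bound := by
          rw [hs₉', Config.set_reg_of_ne _ _ (inl_ne_tmp _ _), hs₈', Config.set_reg_self]
        counter := by rw [low9 d (by omega), low6 d le_rfl, h₁.val]
        modulus := by rw [low9 _ (by omega), q6]
        saved := by rw [low9 _ (by omega), hs₆', Config.set_reg_self]
        flag := by rw [hs₉', Config.set_reg_self] }
    set f := iterStep (fun y => b.eval (Function.update σ x y)) (m.eval σ) with hf
    set K' := K ^ (wt a + (2 * wt m + 1)) with hK'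
    have hK'2 : 2 ≤ K' := two_le_pow hK (by omega)
    have hKK' : K ≤ K' := le_self_pow₀ (by linarith) (by omega)
    have hK'M : K' ≤ M := (hpow hw').trans hM
    have hfK : ∀ y, |f y| ≤ K' := fun y => by
      refine (abs_iterStep_le _ hmb y).trans ?_
      rw [← pow_add]; exact hpow (by omega)
    have hbody : ∀ s' c y, |y| ≤ K' → 0 < c → LoopInv M d x q c y s s' →
        ∃ s'', Runs M (.seq (Ex.comp D (d + 4) b) <|
          .seq (.instr (.op .mod (.inl x) (tmp (d + 4)) (tmp (d + 1)))) <|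
          .seq (.instr (.const (tmp (d + 4)) 1)) <|
          .seq (.instr (.op .sub (tmp d) (tmp d) (tmp (d + 4)))) <|
          counterFlag V D d) s' s'' ∧ LoopInv M d x q (c - 1) (f y) s s'' := by
      intro t c y hy hc hI
      have hσt : (fun v => t.reg (.inl v)) = Function.update σ x y := by
        funext v
        by_cases hvx : v = x
        · subst hvx; simp [hI.bound]
        · simp [hvx, hI.var v hvx, hσ]
      obtain ⟨t₁, q₁, g₁⟩ := ihb (d := d + 4) (s := t) (by omega) hK'2
        (fun v => by
          by_cases hvx : v = x
          · subst hvx; rwa [hI.bound]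
          · rw [hI.var v hvx]; exact (hv v).trans hKK')
        (by
          rw [hK', ← pow_mul]
          exact (hpow (by rw [hwt]; nlinarith)).trans hM) hI.small
      rw [hσt] at g₁
      have f1 : f y = b.eval (Function.update σ x y) % q := rfl
      have hfM : |f y| ≤ M := (hfK y).trans hK'M
      have m1 : t₁.reg (tmp (d + 1)) = q := by rw [g₁.low _ (by omega), hI.modulus]
      have q₂ := Runs.op g₁.small .mod (.inl x) (tmp (d + 4)) (tmp (d + 1)) (by
        rw [m1, g₁.val]; exact hfM)
      rw [m1, g₁.val] at q₂
      have k₂ := g₁.small.set (.inl x) hfM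
      simp only [Op.eval, ← f1] at q₂
      set t₂ := t₁.set (.inl x) (f y) with ht₂
      have q₃ := Runs.const k₂ (tmp (d + 4)) hone
      have k₃ := k₂.set (tmp (d + 4)) hone
      set t₃ := t₂.set (tmp (d + 4)) 1 with ht₃
      have low3 : ∀ j < d + 4, t₃.reg (tmp j) = t.reg (tmp j) := fun j hj => by
        rw [ht₃, Config.set_reg_of_ne _ _ (tmp_ne_tmp (by omega) (by omega) (by omega)), ht₂,
          Config.set_reg_of_ne _ _ (tmp_ne_inl _ _), g₁.low j hj]
      have c3 : t₃.reg (tmp d) = c := by rw [low3 d (by omega), hI.counter]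
      have o3 : t₃.reg (tmp (d + 4)) = 1 := Config.set_reg_self _ _ _
      have hcM : |c - 1| ≤ M := by
        have := hI.small (tmp d)
        rw [hI.counter, abs_of_pos hc] at this
        rw [abs_of_nonneg (by omega)]; omega
      have q₄ := Runs.op k₃ .sub (tmp d) (tmp d) (tmp (d + 4)) (by
        simp only [Op.eval, c3, o3]; exact hcM)
      simp only [Op.eval, c3, o3] at q₄
      have k₄ := k₃.set (tmp d) hcM
      set t₄ := t₃.set (tmp d) (c - 1) with ht₄
      have q₅ := counterFlag_runs (d := d) (by omega) hM2 k₄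
      have c4 : t₄.reg (tmp d) = c - 1 := Config.set_reg_self _ _ _
      have k₅ := k₄.set (tmp (d + 3)) (hflag (t₄.reg (tmp d)))
      rw [c4] at q₅ k₅
      set t₅ := t₄.set (tmp (d + 3)) (if 0 < c - 1 then 1 else 0) with ht₅
      have low5 : ∀ j < d + 3, j ≠ d → t₅.reg (tmp j) = t.reg (tmp j) := fun j hj hjd => by
        rw [ht₅, Config.set_reg_of_ne _ _ (tmp_ne_tmp (by omega) (by omega) (by omega)), ht₄,
          Config.set_reg_of_ne _ _ (tmp_ne_tmp (by omega) (by omega) (by omega)),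
          low3 j (by omega)]
      have var5 : ∀ v, t₅.reg (.inl v) = t₂.reg (.inl v) := fun v => by
        rw [ht₅, Config.set_reg_of_ne _ _ (inl_ne_tmp _ _), ht₄,
          Config.set_reg_of_ne _ _ (inl_ne_tmp _ _), ht₃,
          Config.set_reg_of_ne _ _ (inl_ne_tmp _ _)]
      refine ⟨t₅, q₁.seq (q₂.seq (q₃.seq (q₄.seq q₅))), ?_⟩
      exact
        { small := k₅
          tape := g₁.tape.trans hI.tape
          coins := g₁.coins.trans hI.coins
          var := fun v hvx => by
            rw [var5, ht₂, Config.set_reg_of_ne _ _ (by simpa using hvx), g₁.var, hI.var v hvx]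
          low := fun j hj => by rw [low5 j (by omega) (by omega), hI.low j hj]
          bound := by rw [var5, ht₂, Config.set_reg_self]
          counter := by
            rw [ht₅, Config.set_reg_of_ne _ _ (tmp_ne_tmp (by omega) (by omega) (by omega)), c4]
          modulus := by rw [low5 _ (by omega) (by omega), hI.modulus]
          saved := by rw [low5 _ (by omega) (by omega), hI.saved]
          flag := by rw [ht₅, Config.set_reg_self] }
    obtain ⟨s₁₀, c', r₁₀, h₁₀⟩ := loop_runs (G := fun y => |y| ≤ K') (fun y _ => hfK y) hbody
      (N.eval σ).toNat s₉ (N.eval σ) (a.eval σ) (hab.trans (hpow (by omega))) rfl inv9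
    -- the value is moved to its register and the outer value of the bound variable is restored
    have hres : (iter x N m a b).eval σ = f^[(N.eval σ).toNat] (a.eval σ) := rfl
    set y := f^[(N.eval σ).toNat] (a.eval σ) with hy
    have r₁₁ := Runs.copy h₁₀.small (inl_ne_tmp (D := D) x d)
    rw [h₁₀.bound] at r₁₁
    have hyM : |y| ≤ M := by rw [← h₁₀.bound]; exact h₁₀.small _
    have hs₁₁ := h₁₀.small.set (tmp d) hyM
    set s₁₁ := s₁₀.set (tmp d) y with hs₁₁'
    have r₁₂ := Runs.copy hs₁₁ (tmp_ne_inl (D := D) x (d + 2))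
    have sv : s₁₁.reg (tmp (d + 2)) = s.reg (.inl x) := by
      rw [hs₁₁', Config.set_reg_of_ne _ _ (tmp_ne_tmp (by omega) (by omega) (by omega)),
        h₁₀.saved]
    rw [sv] at r₁₂
    have hs₁₂ := hs₁₁.set (.inl x) (hs (.inl x))
    refine ⟨_, r₁.seq <| r₂.seq <| r₃.seq <| r₄.seq <| r₅.seq <| r₆.seq <| r₇.seq <| r₈.seq <|
      r₉.seq <| r₁₀.seq <| r₁₁.seq r₁₂, ?_⟩
    rw [hres]
    exact
      { small := hs₁₂
        tape := h₁₀.tape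
        coins := h₁₀.coins
        var := fun v => by
          by_cases hvx : v = x
          · subst hvx; rw [Config.set_reg_self]
          · rw [Config.set_reg_of_ne _ _ (by simpa using hvx), hs₁₁',
              Config.set_reg_of_ne _ _ (inl_ne_tmp _ _), h₁₀.var v hvx]
        low := fun j hj => by
          rw [Config.set_reg_of_ne _ _ (tmp_ne_inl _ _), hs₁₁',
            Config.set_reg_of_ne _ _ (tmp_ne_tmp (by omega) (by omega) (by omega)), h₁₀.low j hj]
        val := by rw [Config.set_reg_of_ne _ _ (tmp_ne_inl _ _), hs₁₁', Config.set_reg_self] }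

end compile

/-! ### Blocks of parallel assignments -/

section block

variable {V : Type} {D : ℕ} [DecidableEq V] [Fintype V]

/-- The evaluation of the expressions for the variables of a list into consecutive temporary
registers from `d` on, followed by the assignment of the values to these variables. -/
def assignList (D : ℕ) (f : V → Ex V) : ℕ → List V → Cmd (Reg V D)
  | d, [] => .instr (.const (tmp d) 0)
  | d, v :: l => .seq ((f v).comp D d) (.seq (assignList D f (d + 1) l)
      (Cmd.copy (.inl v) (tmp d)))

/-- The number of temporary registers needed for `assignList`. -/
def depthList (f : V → Ex V) (l : List V) : ℕ := (l.map fun v => (f v).depth + 1).sum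

lemma assignList_runs {M K : ℤ} (f : V → Ex V) (l : List V) (hl : l.Nodup) (hK : 2 ≤ K)
    (hM : ∀ v, K ^ (f v).wt ≤ M) : ∀ {d : ℕ} {s : Config (Reg V D)}, d + depthList f l ≤ D →
    (∀ v, |s.reg (.inl v)| ≤ K) → s.Small M → 0 ≤ M →
    ∃ s', Runs M (assignList D f d l) s s' ∧ s'.Small M ∧ s'.tape = s.tape ∧
      s'.coins = s.coins ∧ (∀ j < d, s'.reg (tmp j) = s.reg (tmp j)) ∧
      ∀ v, s'.reg (.inl v) =
        if v ∈ l then (f v).eval (fun w => s.reg (.inl w)) else s.reg (.inl v) := by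
  induction l with
  | nil =>
    intro d s hd hv hs h0
    have hz : |(0 : ℤ)| ≤ M := by simpa using h0
    refine ⟨_, Runs.const hs (tmp d) hz, hs.set _ hz, rfl, rfl, fun j hj => ?_, fun v => ?_⟩
    · exact s.set_reg_of_ne _ (tmp_ne_tmp hj.ne (by simp [depthList] at hd; omega)
        (by simp [depthList] at hd; omega))
    · simp [s.set_reg_of_ne _ (inl_ne_tmp v d)]
  | cons v l ih =>
    intro d s hd hv hs h0
    simp only [depthList, List.map_cons, List.sum_cons] at hd
    obtain ⟨hvl, hl⟩ := List.nodup_cons.1 hl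
    obtain ⟨s₁, r₁, h₁⟩ := (f v).comp_runs (d := d) (by omega) hK hv (hM v) hs
    obtain ⟨s₂, r₂, k₂, t₂, c₂, low₂, v₂⟩ := ih hl (d := d + 1) (s := s₁)
      (by simp only [depthList]; omega) (fun w => by rw [h₁.var]; exact hv w) h₁.small h0
    have r₃ := Runs.copy k₂ (tmp_ne_inl (D := D) v d)
    have e₃ : s₂.reg (tmp d) = (f v).eval (fun w => s.reg (.inl w)) := by
      rw [low₂ d (by omega), h₁.val]
    refine ⟨_, r₁.seq (r₂.seq r₃), k₂.set _ (k₂ _), t₂.trans h₁.tape, c₂.trans h₁.coins,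
      fun j hj => ?_, fun w => ?_⟩
    · rw [Config.set_reg_of_ne _ _ (tmp_ne_inl _ _), low₂ j (by omega), h₁.low j hj]
    · by_cases hw : w = v
      · subst hw; simp [e₃]
      · rw [Config.set_reg_of_ne _ _ (by simpa using hw), v₂]
        simp [hw, h₁.var]

/-- The parallel assignment `v := f v`, for all variables `v`. -/
noncomputable def block (D : ℕ) (f : V → Ex V) : Cmd (Reg V D) :=
  assignList D f 0 Finset.univ.toList

/-- The number of temporary registers needed for `block`. -/
noncomputable def depthBlock (f : V → Ex V) : ℕ := depthList f Finset.univ.toList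

/-- The effect of a parallel assignment on the variables. -/
def blockVal (f : V → Ex V) (σ : V → ℤ) : V → ℤ := fun v => (f v).eval σ

/-- The exponent that bounds the values in a parallel assignment; see `Ex.wt`. -/
def blockWt (f : V → Ex V) : ℕ := ∑ v, (f v).wt

/-- The configuration `s` of a compiled program represents the abstract configuration `a`, which
has the variables as its only registers. -/
structure Represents (M : ℤ) (s : Config (Reg V D)) (a : Config V) : Prop where
  small : s.Small M
  var : ∀ v, s.reg (.inl v) = a.reg v
  tape : s.tape = a.tape
  coins : s.coins = a.coins

/-- The command `c` leads from the abstract configuration `a` to `a'`, within the memory bound for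
numbers up to `M`. -/
def Does (M : ℤ) (c : Cmd (Reg V D)) (a a' : Config V) : Prop :=
  ∀ s, Represents M s a → ∃ s', Runs M c s s' ∧ Represents M s' a'

lemma Does.seq {M : ℤ} {c d : Cmd (Reg V D)} {a a₁ a₂ : Config V} (h₁ : Does M c a a₁)
    (h₂ : Does M d a₁ a₂) : Does M (.seq c d) a a₂ := by
  intro s hs
  obtain ⟨s₁, r₁, k₁⟩ := h₁ s hs
  obtain ⟨s₂, r₂, k₂⟩ := h₂ s₁ k₁
  exact ⟨s₂, r₁.seq r₂, k₂⟩

lemma Does.loop_done {M : ℤ} {v : V} {c : Cmd (Reg V D)} {a : Config V} (h : a.reg v = 0) :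
    Does M (.loop (.inl v) c) a a :=
  fun s hs => ⟨s, .loop_done hs.small (by rw [hs.var, h]), hs⟩

lemma Does.loop_step {M : ℤ} {v : V} {c : Cmd (Reg V D)} {a a₁ a₂ : Config V} (h : a.reg v ≠ 0)
    (h₁ : Does M c a a₁) (h₂ : Does M (.loop (.inl v) c) a₁ a₂) :
    Does M (.loop (.inl v) c) a a₂ := by
  intro s hs
  obtain ⟨s₁, r₁, k₁⟩ := h₁ s hs
  obtain ⟨s₂, r₂, k₂⟩ := h₂ s₁ k₁
  exact ⟨s₂, .loop_step (by rwa [hs.var]) r₁ r₂, k₂⟩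

/-- All variables are at most `K` in absolute value. -/
def Bdd (K : ℤ) (σ : V → ℤ) : Prop := ∀ v, |σ v| ≤ K

lemma le_blockWt {W : Type} [Fintype W] (f : W → Ex W) (v : W) : (f v).wt ≤ blockWt f :=
  Finset.single_le_sum (f := fun v => (f v).wt) (fun _ _ => Nat.zero_le _) (Finset.mem_univ v)

lemma Bdd.blockVal {K : ℤ} (hK : 2 ≤ K) {σ : V → ℤ} (h : Bdd K σ) (f : V → Ex V) :
    Bdd (K ^ blockWt f) (blockVal f σ) := fun v =>
  (Ex.abs_eval_le (f v) hK h).trans (pow_le_pow_right₀ (by linarith) (le_blockWt f v))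

lemma does_block {M K : ℤ} {f : V → Ex V} {a : Config V} (hK : 2 ≤ K) (ha : Bdd K a.reg)
    (hM : K ^ blockWt f ≤ M) (hD : depthBlock f ≤ D) :
    Does M (block D f) a { a with reg := blockVal f a.reg } := by
  intro s hs
  have h0 : 0 ≤ M := (pow_nonneg (by linarith) _).trans hM
  obtain ⟨s', r, k, t, c, -, hv⟩ := assignList_runs (M := M) (K := K) (D := D) f
    Finset.univ.toList (Finset.nodup_toList _) hK
    (fun v => (pow_le_pow_right₀ (by linarith) (le_blockWt f v)).trans hM) (d := 0) (s := s)
    (by simpa [depthBlock] using hD) (fun v => by rw [hs.var]; exact ha v) hs.small h0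
  refine ⟨s', r, k, fun v => ?_, t.trans hs.tape, c.trans hs.coins⟩
  rw [hv]
  simp [blockVal, hs.var]

lemma does_flip {M : ℤ} (hM : 1 ≤ M) (v : V) (a : Config V) :
    Does M (.instr (.flip (.inl v)) : Cmd (Reg V D)) a ((Instr.flip v).step a) := by
  intro s hs
  have hsm : ((Instr.flip (.inl v : Reg V D)).step s).Small M := by
    intro r
    by_cases h : r = .inl v
    · subst h
      simp only [Instr.step, Function.update_self]
      split_ifs <;> simp <;> linarith
    · simpa [Instr.step, Function.update_of_ne h] using hs.small r
  refine ⟨_, Runs.instr hs.small hsm, hsm, fun w => ?_, hs.tape, ?_⟩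
  · by_cases h : w = v
    · subst h; simp [Instr.step, hs.coins]
    · simp [Instr.step, h, hs.var]
  · simp [Instr.step, hs.coins]

/-- The coordinates of a datum are fractions of numbers up to `K`. -/
def Item.Bdd (K : ℤ) (d : Item) : Prop :=
  |d.2.1.num| ≤ K ∧ (d.2.1.den : ℤ) ≤ K ∧ |d.2.2.num| ≤ K ∧ (d.2.2.den : ℤ) ≤ K

/-- The variables after the datum `d` was read. -/
def load (lab xn xd yn yd : V) (d : Item) (σ : V → ℤ) : V → ℤ :=
  Function.update (Function.update (Function.update (Function.update
    (Function.update σ xn d.2.1.num) xd (d.2.1.den : ℤ)) yn d.2.2.num) yd (d.2.2.den : ℤ))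
    lab d.1.code

lemma update_bdd {W : Type} [DecidableEq W] {K : ℤ} {σ : W → ℤ} (h : ∀ v, |σ v| ≤ K) (w : W)
    {x : ℤ} (hx : |x| ≤ K) : ∀ v, |Function.update σ w x v| ≤ K := by
  intro v
  by_cases hv : v = w
  · subst hv; simpa using hx
  · simpa [hv] using h v

lemma load_bdd {W : Type} [DecidableEq W] {K : ℤ} {σ : W → ℤ} (h : ∀ v, |σ v| ≤ K) {d : Item}
    (hd : d.Bdd K) (hK : 2 ≤ K) (lab xn xd yn yd : W) :
    ∀ v, |load lab xn xd yn yd d σ v| ≤ K := by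
  unfold load
  obtain ⟨h1, h2, h3, h4⟩ := hd
  refine update_bdd (update_bdd (update_bdd (update_bdd (update_bdd h _ h1) _ ?_) _ h3) _ ?_) _ ?_
  · simpa using h2
  · simpa using h4
  · cases d.1 <;> simp [Label.code] <;> linarith

lemma update_inl {W : Type} [DecidableEq W] {σ : W → ℤ} {τ : Reg W D → ℤ}
    (h : ∀ v, τ (.inl v) = σ v) (w : W) (x : ℤ) :
    ∀ v, Function.update τ (.inl w) x (.inl v) = Function.update σ w x v := by
  intro v
  by_cases hv : v = w
  · subst hv; simp
  · simp [hv, h]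

lemma does_read_some {M : ℤ} {d : Item} {t : List (Option Item)} {a : Config V}
    (lab xn xd yn yd : V) (hM : 2 ≤ M) (hd : d.Bdd M) (ht : a.tape = some d :: t) :
    Does M (.instr (.read (.inl lab) (.inl xn) (.inl xd) (.inl yn) (.inl yd)) : Cmd (Reg V D)) a
      { a with reg := load lab xn xd yn yd d a.reg, tape := t } := by
  intro s hs
  have e : (Instr.read (.inl lab) (.inl xn) (.inl xd) (.inl yn) (.inl yd : Reg V D)).step s =
      { s with reg := load (.inl lab) (.inl xn) (.inl xd) (.inl yn) (.inl yd) d s.reg,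
               tape := t } := by
    simp only [Instr.step, hs.tape, ht]; rfl
  have hsm : ((Instr.read (.inl lab) (.inl xn) (.inl xd) (.inl yn)
      (.inl yd : Reg V D)).step s).Small M := by
    rw [e]; exact load_bdd hs.small hd hM _ _ _ _ _
  refine ⟨_, Runs.instr hs.small hsm, hsm, ?_, ?_, ?_⟩
  · rw [e]
    exact update_inl (update_inl (update_inl (update_inl (update_inl hs.var _ _) _ _) _ _) _ _) _ _
  · rw [e]
  · rw [e]; exact hs.coins

lemma does_read_none {M : ℤ} {t : List (Option Item)} {a : Config V} (lab xn xd yn yd : V)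
    (hM : 0 ≤ M) (ht : a.tape = none :: t) :
    Does M (.instr (.read (.inl lab) (.inl xn) (.inl xd) (.inl yn) (.inl yd)) : Cmd (Reg V D)) a
      { a with reg := Function.update a.reg lab 0, tape := t } := by
  intro s hs
  have e : (Instr.read (.inl lab) (.inl xn) (.inl xd) (.inl yn) (.inl yd : Reg V D)).step s =
      { s with reg := Function.update s.reg (.inl lab) 0, tape := t } := by
    simp only [Instr.step, hs.tape, ht]
  have hsm : ((Instr.read (.inl lab) (.inl xn) (.inl xd) (.inl yn)
      (.inl yd : Reg V D)).step s).Small M := by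
    rw [e]; exact update_bdd hs.small _ (by simpa using hM)
  refine ⟨_, Runs.instr hs.small hsm, hsm, ?_, ?_, ?_⟩
  · rw [e]; exact update_inl hs.var _ _
  · rw [e]
  · rw [e]; exact hs.coins

/-! ### Passes over the stream -/

/-- One pass over the stream, with the parallel assignment `f` executed for each datum. -/
noncomputable def pass (D : ℕ) (lab xn xd yn yd : V) (f : V → Ex V) : Cmd (Reg V D) :=
  .seq (.instr (.read (.inl lab) (.inl xn) (.inl xd) (.inl yn) (.inl yd))) <|
  .loop (.inl lab) <| .seq (block D f) <|
  .instr (.read (.inl lab) (.inl xn) (.inl xd) (.inl yn) (.inl yd))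

/-- The effect of a pass on the variables. -/
def passVal (lab xn xd yn yd : V) (f : V → Ex V) : List Item → (V → ℤ) → V → ℤ
  | [], σ => Function.update σ lab 0
  | d :: L, σ => passVal lab xn xd yn yd f L (blockVal f (load lab xn xd yn yd d σ))

/-- A pass has its expected effect if an invariant `I` of the variables bounds them. -/
lemma does_pass {M K : ℤ} {f : V → Ex V} (lab xn xd yn yd : V) (hK : 2 ≤ K)
    (hM : K ^ blockWt f ≤ M) (hKM : K ≤ M) (hD : depthBlock f ≤ D) (I : (V → ℤ) → Prop)
    (hI : ∀ σ, I σ → Bdd K σ) {L : List Item} (hL : ∀ d ∈ L, d.Bdd K)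
    (hf : ∀ d ∈ L, ∀ σ, I σ → I (blockVal f (load lab xn xd yn yd d σ)))
    {t : List (Option Item)} {a : Config V} (ha : I a.reg)
    (ht : a.tape = L.map some ++ none :: t) :
    Does M (pass D lab xn xd yn yd f) a
      { a with reg := passVal lab xn xd yn yd f L a.reg, tape := t } := by
  -- the statement for the loop, after a first datum was read
  have key : ∀ (L : List Item), (∀ d ∈ L, d.Bdd K) →
      (∀ d ∈ L, ∀ σ, I σ → I (blockVal f (load lab xn xd yn yd d σ))) → ∀ (a : Config V),
      I a.reg → a.tape = L.map some ++ none :: t → ∃ a',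
      Does M (.instr (.read (.inl lab) (.inl xn) (.inl xd) (.inl yn) (.inl yd)) : Cmd (Reg V D))
        a a' ∧ Does M (.loop (.inl lab) <| .seq (block D f) <|
          .instr (.read (.inl lab) (.inl xn) (.inl xd) (.inl yn) (.inl yd)) : Cmd (Reg V D)) a'
          { a with reg := passVal lab xn xd yn yd f L a.reg, tape := t } := by
    intro L
    induction L with
    | nil =>
      intro hL hf a ha ht
      refine ⟨_, does_read_none lab xn xd yn yd (by linarith) ht, ?_⟩
      exact Does.loop_done (by simp)
    | cons d L ih =>
      intro hL hf a ha ht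
      have hd : d.Bdd K := hL d (by simp)
      have hd' : d.Bdd M := ⟨hd.1.trans hKM, hd.2.1.trans hKM, hd.2.2.1.trans hKM,
        hd.2.2.2.trans hKM⟩
      refine ⟨_, does_read_some lab xn xd yn yd (by linarith) hd' ht, ?_⟩
      have hb : Bdd K (load lab xn xd yn yd d a.reg) := load_bdd (hI _ ha) hd hK _ _ _ _ _
      obtain ⟨a₁, g₁, g₂⟩ := ih (fun e he => hL e (by simp [he])) (fun e he => hf e (by simp [he]))
        { a with
          reg := blockVal f (load lab xn xd yn yd d a.reg), tape := L.map some ++ none :: t }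
        (hf d (by simp) _ ha) rfl
      refine Does.loop_step ?_ ((does_block hK hb hM hD).seq g₁) g₂
      simp only [load, Function.update_self]
      cases d.1 <;> simp [Label.code]
  obtain ⟨a', h₁, h₂⟩ := key L hL hf a ha ht
  exact h₁.seq h₂

end block

/-! ### Gaussian integers with a real power -/

/-- If a power of a Gaussian integer `P + Q i` is real, then `P + Q i` lies on one of the four lines
through `0` spanned by `1`, `i`, `1 ± i`: the conjugate of `P + Q i` divides it, so that their
quotient is a unit. -/
lemma gaussian_im_pow_eq_zero {P Q : ℤ} {k : ℕ} (hk : k ≠ 0)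
    (h : ((⟨P, Q⟩ : GaussianInt) ^ k).im = 0) : P * Q * (P ^ 2 - Q ^ 2) = 0 := by
  set w : GaussianInt := ⟨P, Q⟩ with hw
  have h1 : star w ^ k = w ^ k := by
    rw [← star_pow]
    exact Zsqrtd.ext (Zsqrtd.re_star _) (by rw [Zsqrtd.im_star, h, neg_zero])
  obtain ⟨e, he⟩ := (IsIntegrallyClosed.pow_dvd_pow_iff hk).1
    (Dvd.intro_left 1 (by rw [one_mul, h1]) : w ^ k ∣ star w ^ k)
  have hre := congrArg Zsqrtd.re he
  have him := congrArg Zsqrtd.im he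
  simp only [hw, Zsqrtd.re_star, Zsqrtd.im_star, Zsqrtd.re_mul, Zsqrtd.im_mul] at hre him
  -- the quotient `e` has norm `1`
  obtain ⟨a, b⟩ := e
  simp only at hre him
  by_cases h0 : P ^ 2 + Q ^ 2 = 0
  · have : P = 0 := by nlinarith [sq_nonneg P, sq_nonneg Q]
    simp [this]
  have hn : (P ^ 2 + Q ^ 2) * (a ^ 2 + b ^ 2 - 1) = 0 := by
    have e1 : P = P * a - Q * b := by linarith
    have e2 : -Q = P * b + Q * a := by linarith
    have : P ^ 2 + (-Q) ^ 2 = (P * a - Q * b) ^ 2 + (P * b + Q * a) ^ 2 := by rw [← e1, ← e2]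
    linarith
  have hab : a ^ 2 + b ^ 2 = 1 := by
    rcases mul_eq_zero.1 hn with h | h
    · exact absurd h h0
    · linarith
  have ha : a = 0 ∨ b = 0 := by
    by_contra hc
    push Not at hc
    have := Int.one_le_abs hc.1
    have := Int.one_le_abs hc.2
    nlinarith [sq_abs a, sq_abs b]
  rcases ha with rfl | rfl
  · have hb : P = -Q * b := by linarith
    have : P ^ 2 = Q ^ 2 := by rw [hb]; nlinarith
    rw [this]; ring
  · have : P ^ 2 * (a ^ 2 - a) = 0 := by
      have e1 : P * (a - 1) = 0 := by linarith
      have : P * (a * (P * (a - 1))) = 0 := by rw [e1]; ring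
      linarith
    rcases (by nlinarith : (a - 1) * (a + 1) = 0) |> mul_eq_zero.1 with h | h
    · have : a = 1 := by linarith
      subst this
      have : Q = 0 := by linarith
      simp [this]
    · have : a = -1 := by linarith
      subst this
      have : P = 0 := by linarith
      simp [this]

lemma abs_im_pow_le {P Q : ℤ} {H k n : ℕ} (hH : 1 ≤ H) (hP : |P| ≤ H) (hQ : |Q| ≤ H) (hk : k ≤ n) :
    ((⟨P, Q⟩ : GaussianInt) ^ k).im.natAbs ≤ (2 * H ^ 2) ^ n := by
  set w : GaussianInt := ⟨P, Q⟩ with hw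
  have h1 : (w ^ k).norm = w.norm ^ k := map_pow Zsqrtd.normMonoidHom w k
  have h2 : w.norm = P ^ 2 + Q ^ 2 := by simp [hw, Zsqrtd.norm]; ring
  have hP2 : P ^ 2 ≤ H ^ 2 := sq_le_sq' (by linarith [neg_abs_le P]) (by linarith [le_abs_self P])
  have hQ2 : Q ^ 2 ≤ H ^ 2 := sq_le_sq' (by linarith [neg_abs_le Q]) (by linarith [le_abs_self Q])
  have h3 : (w ^ k).norm = (w ^ k).re ^ 2 + (w ^ k).im ^ 2 := by simp [Zsqrtd.norm]; ring
  have hH2 : (1 : ℤ) ≤ 2 * H ^ 2 := by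
    have : (1 : ℤ) ≤ H := by exact_mod_cast hH
    nlinarith
  have h4 : (w ^ k).im ^ 2 ≤ ((2 : ℤ) * H ^ 2) ^ n := by
    calc (w ^ k).im ^ 2 ≤ w.norm ^ k := by rw [← h1, h3]; nlinarith [sq_nonneg (w ^ k).re]
      _ ≤ (2 * (H : ℤ) ^ 2) ^ k := by rw [h2]; gcongr; linarith
      _ ≤ (2 * (H : ℤ) ^ 2) ^ n := pow_le_pow_right₀ hH2 hk
  have h5 : ((w ^ k).im.natAbs : ℤ) ≤ (w ^ k).im ^ 2 := by
    rw [← Int.natAbs_sq]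
    have : (w ^ k).im.natAbs ≤ (w ^ k).im.natAbs ^ 2 := Nat.le_self_pow (by norm_num) _
    exact_mod_cast this
  exact_mod_cast h5.trans h4

/-! ### Moduli -/

/-- The primes modulo which no point of height at most `H` outside the four lines of
`gaussian_im_pow_eq_zero` acquires a real power with exponent at most `n`. -/
structure GoodPrime (n H p : ℕ) : Prop where
  prime : p.Prime
  not_dvd : ∀ P Q : ℤ, |P| ≤ H → |Q| ≤ H → P * Q * (P ^ 2 - Q ^ 2) ≠ 0 → ∀ k : ℕ, 1 ≤ k → k ≤ n →
    ¬ (p : ℤ) ∣ ((⟨P, Q⟩ : GaussianInt) ^ k).im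

/-- There are many primes: a number `N ≠ 0` that has all primes between `L` and `8 Y²` as divisors,
where `L ≤ Y`, cannot be too small. This follows from `2 ^ m ≤ (m + 1) m ^ π(m)`. -/
lemma exists_prime_not_dvd {L y N : ℕ} (hN : N ≠ 0) (hNy : N ≤ 2 ^ y) :
    ∃ p, p.Prime ∧ L < p ∧ p ≤ 8 * (L + y + 1) ^ 2 ∧ ¬ p ∣ N := by
  by_contra hc
  push Not at hc
  set Y := L + y + 1 with hY
  set m := 8 * Y ^ 2 with hm
  have hm1 : 1 ≤ m := by nlinarith
  have hsub : Nat.primesLE m ⊆ Finset.range (L + 1) ∪ N.primeFactors := by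
    intro p hp
    rw [Nat.mem_primesLE] at hp
    rw [Finset.mem_union, Finset.mem_range]
    by_cases h : p ≤ L
    · left; omega
    · right
      exact Nat.mem_primeFactors.2 ⟨hp.2, hc p hp.2 (by omega) hp.1, hN⟩
  have hfac : 2 ^ N.primeFactors.card ≤ N := by
    calc 2 ^ N.primeFactors.card = ∏ _p ∈ N.primeFactors, 2 := by simp
      _ ≤ ∏ p ∈ N.primeFactors, p :=
        Finset.prod_le_prod' fun p hp => (Nat.prime_of_mem_primeFactors hp).two_le
      _ ≤ N := Nat.le_of_dvd (Nat.pos_of_ne_zero hN) (Nat.prod_primeFactors_dvd N)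
  have hcard : N.primeFactors.card ≤ y :=
    (Nat.pow_le_pow_iff_right (by norm_num : 1 < 2)).1 (hfac.trans hNy)
  have hπ : (Nat.primesLE m).card ≤ Y := by
    refine (Finset.card_le_card hsub).trans ((Finset.card_union_le _ _).trans ?_)
    simp; omega
  have hl : Nat.lcmUpto m ≤ m ^ Y := by
    rw [Nat.lcmUpto_eq_prod_pow_log]
    calc ∏ p ∈ Nat.primesLE m, p ^ p.log m ≤ ∏ _p ∈ Nat.primesLE m, m :=
          Finset.prod_le_prod' fun p _ => Nat.pow_log_le_self p (by omega)
      _ = m ^ (Nat.primesLE m).card := by simp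
      _ ≤ m ^ Y := Nat.pow_le_pow_right (by omega) hπ
  have h2 := Chebyshev.two_pow_le_mul_lcmUpto m
  have hYm : m + 1 ≤ 2 ^ (2 * Y + 3) := by
    have h1 : Y + 1 ≤ 2 ^ Y := Nat.lt_two_pow_self
    have : 2 ^ (2 * Y + 3) = 8 * (2 ^ Y) ^ 2 := by ring
    rw [this, hm]
    nlinarith [Nat.pow_le_pow_left h1 2]
  have h3 : 2 ^ m ≤ 2 ^ ((2 * Y + 3) * (Y + 1)) := by
    calc 2 ^ m ≤ (m + 1) * Nat.lcmUpto m := h2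
      _ ≤ (m + 1) * (m + 1) ^ Y := by
        gcongr
        exact hl.trans (Nat.pow_le_pow_left (by omega) _)
      _ = (m + 1) ^ (Y + 1) := by ring
      _ ≤ (2 ^ (2 * Y + 3)) ^ (Y + 1) := Nat.pow_le_pow_left hYm _
      _ = _ := by rw [← pow_mul]
  have h4 := (Nat.pow_le_pow_iff_right (by norm_num : 1 < 2)).1 h3
  have hY1 : 1 ≤ Y := by omega
  rcases hY1.eq_or_lt with h5 | h5
  · -- here `m = 8`, and the primes up to `8` are too many
    have : (Nat.primesLE 8).card = 4 := by decide
    have hm8 : m = 8 := by rw [hm, ← h5]; norm_num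
    rw [hm8] at hπ
    omega
  · nlinarith

/-- The bound below which there is a good prime above `L`. -/
def primeBound (n H L : ℕ) : ℕ := 8 * (L + 2 * H ^ 2 * n ^ 2 * (2 * H + 1) ^ 2 + 1) ^ 2

lemma exists_goodPrime (n L : ℕ) {H : ℕ} (hH : 1 ≤ H) :
    ∃ p, GoodPrime n H p ∧ L < p ∧ p ≤ primeBound n H L := by
  -- the product of all imaginary parts that a good prime must not divide
  set g : ℕ × ℤ × ℤ → ℕ := fun t =>
    if ((⟨t.2.1, t.2.2⟩ : GaussianInt) ^ t.1).im = 0 then 1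
    else ((⟨t.2.1, t.2.2⟩ : GaussianInt) ^ t.1).im.natAbs with hg
  set S : Finset (ℕ × ℤ × ℤ) := Finset.Icc 1 n ×ˢ Finset.Icc (-(H : ℤ)) H ×ˢ Finset.Icc (-(H : ℤ)) H
    with hS
  have hpos : ∀ t, g t ≠ 0 := by
    intro t
    simp only [hg]
    split_ifs with h
    · simp
    · simpa using h
  have hle : ∀ t ∈ S, g t ≤ (2 * H ^ 2) ^ n := by
    rintro ⟨k, P, Q⟩ ht
    simp only [hS, Finset.mem_product, Finset.mem_Icc] at ht
    simp only [hg]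
    split_ifs with h
    · exact Nat.one_le_pow _ _ (by positivity)
    · exact abs_im_pow_le hH (abs_le.2 ht.2.1) (abs_le.2 ht.2.2) ht.1.2
  have hcard : S.card = n * (2 * H + 1) ^ 2 := by
    simp only [hS, Finset.card_product, Int.card_Icc, Nat.card_Icc]
    have : ((H : ℤ) + 1 - -(H : ℤ)).toNat = 2 * H + 1 := by omega
    rw [this, Nat.add_sub_cancel]; ring
  have hN : ∏ t ∈ S, g t ≤ 2 ^ (2 * H ^ 2 * n ^ 2 * (2 * H + 1) ^ 2) := by
    calc ∏ t ∈ S, g t ≤ ∏ _t ∈ S, (2 * H ^ 2) ^ n := Finset.prod_le_prod' hle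
      _ = (2 * H ^ 2) ^ (n * S.card) := by simp [pow_mul]
      _ ≤ (2 ^ (2 * H ^ 2)) ^ (n * S.card) := Nat.pow_le_pow_left Nat.lt_two_pow_self.le _
      _ = _ := by rw [hcard, ← pow_mul]; ring_nf
  obtain ⟨p, hp, hL, hpb, hnd⟩ := exists_prime_not_dvd (L := L)
    (Finset.prod_ne_zero_iff.2 fun t _ => hpos t) hN
  refine ⟨p, ⟨hp, fun P Q hP hQ hPQ k hk hkn hdvd => hnd ?_⟩, hL, hpb⟩
  have hmem : ((k, P, Q) : ℕ × ℤ × ℤ) ∈ S := by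
    simp only [hS, Finset.mem_product, Finset.mem_Icc]
    exact ⟨⟨hk, hkn⟩, abs_le.1 hP, abs_le.1 hQ⟩
  refine dvd_trans ?_ (Finset.dvd_prod_of_mem g hmem)
  simp only [hg]
  rw [if_neg fun h => hPQ (gaussian_im_pow_eq_zero (by omega) h)]
  exact Int.natCast_dvd.1 hdvd

open Complex (I)

/-! ### Reduction of complex numbers of small height -/

section reduction

variable {F : Type} [Field F] {p : ℕ} [CharP F p]

lemma intCast_ne_zero_of_lt {a : ℤ} (h0 : 0 < a) (h : a < p) : (a : F) ≠ 0 := by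
  rw [Ne, CharP.intCast_eq_zero_iff F p]
  intro hd
  exact absurd (Int.le_of_dvd h0 hd) (by omega)

/-- The complex number `z` has the form `(u + v i) / D` with integers of size at most `H`, and
`f` is its reduction: a function of the square root `ι` of `-1` in `F` that replaces `i`. -/
def Red (H : ℤ) (z : ℂ) (f : F → F) : Prop :=
  ∃ D u v : ℤ, 0 < D ∧ D ≤ H ∧ |u| ≤ H ∧ |v| ≤ H ∧ z = (u + v * I) / D ∧
    ∀ ι : F, ι * ι = -1 → f ι = (u + v * ι) / D

lemma Red.mono {H H' : ℤ} {z : ℂ} {f : F → F} (h : Red H z f) (hH : H ≤ H') : Red H' z f := by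
  obtain ⟨D, u, v, h0, h1, h2, h3, h4⟩ := h
  exact ⟨D, u, v, h0, h1.trans hH, h2.trans hH, h3.trans hH, h4⟩

lemma Red.mul {H H' : ℤ} {z w : ℂ} {f g : F → F} (h : Red H z f) (h' : Red H' w g) :
    Red (2 * H * H') (z * w) (f * g) := by
  obtain ⟨D, u, v, h0, h1, h2, h3, rfl, h5⟩ := h
  obtain ⟨D', u', v', h0', h1', h2', h3', rfl, h5'⟩ := h'
  have a1 : |u * u'| ≤ H * H' := by rw [abs_mul]; gcongr; linarith
  have a2 : |v * v'| ≤ H * H' := by rw [abs_mul]; gcongr; linarith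
  have a3 : |u * v'| ≤ H * H' := by rw [abs_mul]; gcongr; linarith
  have a4 : |v * u'| ≤ H * H' := by rw [abs_mul]; gcongr; linarith
  refine ⟨D * D', u * u' - v * v', u * v' + v * u', by positivity, by nlinarith, ?_, ?_, ?_, ?_⟩
  · exact (abs_sub _ _).trans (by linarith)
  · exact (abs_add_le _ _).trans (by linarith)
  · push_cast
    rw [div_mul_div_comm]
    congr 1
    linear_combination (v * v' : ℂ) * Complex.I_mul_I
  · intro ι hι
    simp only [Pi.mul_apply]
    rw [h5 ι hι, h5' ι hι, div_mul_div_comm]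
    push_cast
    congr 1
    linear_combination (v * v' : F) * hι

lemma Red.neg {H : ℤ} {z : ℂ} {f : F → F} (h : Red H z f) : Red H (-z) (-f) := by
  obtain ⟨D, u, v, h0, h1, h2, h3, rfl, h5⟩ := h
  refine ⟨D, -u, -v, h0, h1, by rwa [abs_neg], by rwa [abs_neg], ?_, ?_⟩
  · push_cast; ring
  · intro ι hι
    simp only [Pi.neg_apply]
    rw [h5 ι hι]; push_cast; ring

lemma Red.add {H H' : ℤ} {z w : ℂ} {f g : F → F} (h : Red H z f) (h' : Red H' w g)
    (hp : H < p) (hp' : H' < p) : Red (2 * H * H') (z + w) (f + g) := by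
  obtain ⟨D, u, v, h0, h1, h2, h3, rfl, h5⟩ := h
  obtain ⟨D', u', v', h0', h1', h2', h3', rfl, h5'⟩ := h'
  have a1 : |u * D'| ≤ H * H' := by rw [abs_mul, abs_of_pos h0']; gcongr; linarith
  have a2 : |v * D'| ≤ H * H' := by rw [abs_mul, abs_of_pos h0']; gcongr; linarith
  have a3 : |u' * D| ≤ H * H' := by
    rw [abs_mul, abs_of_pos h0, mul_comm H]; gcongr; linarith
  have a4 : |v' * D| ≤ H * H' := by
    rw [abs_mul, abs_of_pos h0, mul_comm H]; gcongr; linarith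
  have hD : (D : F) ≠ 0 := intCast_ne_zero_of_lt (p := p) h0 (by linarith)
  have hD' : (D' : F) ≠ 0 := intCast_ne_zero_of_lt (p := p) h0' (by linarith)
  refine ⟨D * D', u * D' + u' * D, v * D' + v' * D, by positivity, by nlinarith, ?_, ?_, ?_, ?_⟩
  · exact (abs_add_le _ _).trans (by linarith)
  · exact (abs_add_le _ _).trans (by linarith)
  · have c : (D : ℂ) ≠ 0 := by exact_mod_cast h0.ne'
    have c' : (D' : ℂ) ≠ 0 := by exact_mod_cast h0'.ne'
    push_cast
    field_simp
    ring
  · intro ι hι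
    simp only [Pi.add_apply]
    rw [h5 ι hι, h5' ι hι]
    push_cast
    field_simp
    ring

lemma Red.sub {H H' : ℤ} {z w : ℂ} {f g : F → F} (h : Red H z f) (h' : Red H' w g)
    (hp : H < p) (hp' : H' < p) : Red (2 * H * H') (z - w) (f - g) := by
  rw [sub_eq_add_neg, sub_eq_add_neg]
  exact h.add h'.neg hp hp'

lemma Red.inv {H : ℤ} {z : ℂ} {f : F → F} (h : Red H z f) (hz : z ≠ 0) (hp : 2 * H ^ 2 < p) :
    Red (2 * H ^ 2) z⁻¹ f⁻¹ := by
  obtain ⟨D, u, v, h0, h1, h2, h3, rfl, h5⟩ := h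
  have hu : u ^ 2 ≤ H ^ 2 := sq_le_sq' (by linarith [neg_abs_le u]) (by linarith [le_abs_self u])
  have hv : v ^ 2 ≤ H ^ 2 := sq_le_sq' (by linarith [neg_abs_le v]) (by linarith [le_abs_self v])
  have hn : 0 < u ^ 2 + v ^ 2 := by
    rcases eq_or_ne u 0 with rfl | hu0
    · rcases eq_or_ne v 0 with rfl | hv0
      · simp at hz
      · positivity
    · positivity
  have hc : (D : ℂ) ≠ 0 := by exact_mod_cast h0.ne'
  have hnc : (u ^ 2 + v ^ 2 : ℂ) ≠ 0 := by exact_mod_cast hn.ne'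
  have e1 : (u + v * I : ℂ) * (u - v * I) = u ^ 2 + v ^ 2 := by
    linear_combination (-(v * v) : ℂ) * Complex.I_mul_I
  have hw : (u + v * I : ℂ) ≠ 0 := left_ne_zero_of_mul (e1 ▸ hnc)
  have a1 : |D * u| ≤ 2 * H ^ 2 := by
    have : |D * u| ≤ H * H := by rw [abs_mul, abs_of_pos h0]; gcongr; linarith
    nlinarith
  have a2 : |-(D * v)| ≤ 2 * H ^ 2 := by
    have : |D * v| ≤ H * H := by rw [abs_mul, abs_of_pos h0]; gcongr; linarith
    rw [abs_neg]
    nlinarith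
  refine ⟨u ^ 2 + v ^ 2, D * u, -(D * v), hn, by linarith, a1, a2, ?_, ?_⟩
  · push_cast
    rw [inv_div, div_eq_div_iff hw hnc, ← e1]
    ring
  · intro ι hι
    have hnF : ((u ^ 2 + v ^ 2 : ℤ) : F) ≠ 0 := intCast_ne_zero_of_lt (p := p) hn (by linarith)
    push_cast at hnF
    have e2 : (u + v * ι : F) * (u - v * ι) = u ^ 2 + v ^ 2 := by
      linear_combination (-(v * v) : F) * hι
    have hw' : (u + v * ι : F) ≠ 0 := left_ne_zero_of_mul (e2 ▸ hnF)
    simp only [Pi.inv_apply]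
    rw [h5 ι hι, inv_div]
    push_cast
    rw [div_eq_div_iff hw' hnF, ← e2]
    ring

/-- Reduction is injective on numbers of small height: a vanishing difference yields a sum of two
squares that is smaller than `p` and divisible by `p`. -/
lemma Red.eq_iff {H : ℤ} {z w : ℂ} {f g : F → F} (h : Red H z f) (h' : Red H w g)
    (hp : 8 * H ^ 4 < p) {ι : F} (hι : ι * ι = -1) : z = w ↔ f ι = g ι := by
  obtain ⟨D, u, v, h0, h1, h2, h3, rfl, h5⟩ := h
  obtain ⟨D', u', v', h0', h1', h2', h3', rfl, h5'⟩ := h'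
  have hH1 : 1 ≤ H := by omega
  have hHp : H < p := by
    have : H ≤ H ^ 4 := le_self_pow₀ hH1 (by norm_num)
    linarith
  have hD : (D : F) ≠ 0 := intCast_ne_zero_of_lt (p := p) h0 (by linarith)
  have hD' : (D' : F) ≠ 0 := intCast_ne_zero_of_lt (p := p) h0' (by linarith)
  have c : (D : ℂ) ≠ 0 := by exact_mod_cast h0.ne'
  have c' : (D' : ℂ) ≠ 0 := by exact_mod_cast h0'.ne'
  set s := u * D' - u' * D with hs
  set t := v * D' - v' * D with ht
  have bs : |s| ≤ 2 * H ^ 2 := by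
    have a1 : |u * D'| ≤ H * H := by rw [abs_mul, abs_of_pos h0']; gcongr
    have a3 : |u' * D| ≤ H * H := by rw [abs_mul, abs_of_pos h0]; gcongr
    exact (abs_sub _ _).trans (by nlinarith)
  have bt : |t| ≤ 2 * H ^ 2 := by
    have a1 : |v * D'| ≤ H * H := by rw [abs_mul, abs_of_pos h0']; gcongr
    have a3 : |v' * D| ≤ H * H := by rw [abs_mul, abs_of_pos h0]; gcongr
    exact (abs_sub _ _).trans (by nlinarith)
  have hz : (u + v * I : ℂ) / D = (u' + v' * I) / D' ↔ s = 0 ∧ t = 0 := by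
    rw [div_eq_div_iff c c', Complex.ext_iff]
    simp only [Complex.mul_re, Complex.add_re, Complex.intCast_re, Complex.I_re, mul_zero,
      Complex.intCast_im, Complex.I_im, mul_one, sub_self, add_zero, Complex.add_im,
      Complex.mul_im, zero_add, sub_zero]
    rw [hs, ht, sub_eq_zero, sub_eq_zero]
    norm_cast
  have hf : f ι = g ι ↔ (s : F) + t * ι = 0 := by
    rw [h5 ι hι, h5' ι hι, div_eq_div_iff hD hD', hs, ht, ← sub_eq_zero]
    push_cast
    constructor <;> intro h <;> linear_combination h
  rw [hz, hf]
  constructor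
  · rintro ⟨h1, h2⟩; simp [h1, h2]
  · intro h
    have hsum : ((s ^ 2 + t ^ 2 : ℤ) : F) = 0 := by
      push_cast
      linear_combination (s - t * ι) * h + (t ^ 2 : F) * hι
    rw [CharP.intCast_eq_zero_iff F p] at hsum
    have hlt : s ^ 2 + t ^ 2 < p := by
      have : s ^ 2 ≤ (2 * H ^ 2) ^ 2 := by rw [← sq_abs]; gcongr
      have : t ^ 2 ≤ (2 * H ^ 2) ^ 2 := by rw [← sq_abs t]; gcongr
      nlinarith
    have h0 := Int.eq_zero_of_dvd_of_nonneg_of_lt (by positivity) hlt hsum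
    exact ⟨by nlinarith [sq_nonneg s, sq_nonneg t], by nlinarith [sq_nonneg s, sq_nonneg t]⟩

/-- The reduction of the point of a datum. -/
def Item.red (d : Item) (ι : F) : F :=
  (d.2.1.num : F) / (d.2.1.den : F) + (d.2.2.num : F) / (d.2.2.den : F) * ι

lemma Item.Bdd.red {U : ℤ} {d : Item} (hd : d.Bdd U) (hp : U < p) :
    Red (U ^ 2) d.2.toComplex (d.red : F → F) := by
  obtain ⟨h1, h2, h3, h4⟩ := hd
  have k1 : (0 : ℤ) < d.2.1.den := by exact_mod_cast d.2.1.den_pos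
  have k2 : (0 : ℤ) < d.2.2.den := by exact_mod_cast d.2.2.den_pos
  have f1 : ((d.2.1.den : ℤ) : F) ≠ 0 := intCast_ne_zero_of_lt (p := p) k1 (by linarith)
  have f2 : ((d.2.2.den : ℤ) : F) ≠ 0 := intCast_ne_zero_of_lt (p := p) k2 (by linarith)
  refine ⟨d.2.1.den * d.2.2.den, d.2.1.num * d.2.2.den, d.2.2.num * d.2.1.den, by positivity,
    by nlinarith, ?_, ?_, ?_, ?_⟩
  · rw [abs_mul, sq, abs_of_pos k2]; gcongr; linarith
  · rw [abs_mul, sq, abs_of_pos k1]; gcongr; linarith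
  · have c1 : (d.2.1.den : ℂ) ≠ 0 := by exact_mod_cast k1.ne'
    have c2 : (d.2.2.den : ℂ) ≠ 0 := by exact_mod_cast k2.ne'
    have e : d.2.toComplex = ((d.2.1 : ℚ) : ℂ) + ((d.2.2 : ℚ) : ℂ) * I := by
      apply Complex.ext <;> simp [Point.toComplex]
    rw [e, Rat.cast_def, Rat.cast_def]
    push_cast
    field_simp
  · intro ι hι
    push_cast at f1 f2 ⊢
    simp only [Item.red]
    field_simp

end reduction

/-! ### Rotations with equal powers -/

/-- The parts of a power in `ℤ[i]` reduce to the parts of the power in `F`. -/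
lemma gaussian_pow_cast {F : Type} [Field F] {ι : F} (hι : ι * ι = -1) (P Q : ℤ) (k : ℕ) :
    (((⟨P, Q⟩ : GaussianInt) ^ k).re : F) + ((⟨P, Q⟩ : GaussianInt) ^ k).im * ι
      = (P + Q * ι) ^ k := by
  induction k with
  | zero => simp
  | succ k ih =>
    rw [pow_succ, pow_succ, ← ih, Zsqrtd.re_mul, Zsqrtd.im_mul]
    push_cast
    linear_combination (-(((⟨P, Q⟩ : GaussianInt) ^ k).im * Q : F)) * hι

lemma two_mul_sq_ne_sq {P m : ℤ} (hm : m ≠ 0) : 2 * P ^ 2 ≠ m ^ 2 := by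
  intro h
  have hP : P ≠ 0 := by rintro rfl; exact hm (by nlinarith)
  refine irrational_sqrt_two ⟨|(m : ℚ) / P|, ?_⟩
  have h' : (2 : ℝ) = ((m : ℝ) / P) ^ 2 := by
    have : (P : ℝ) ≠ 0 := by exact_mod_cast hP
    field_simp
    exact_mod_cast h
  rw [h', Real.sqrt_sq_eq_abs]
  push_cast
  rfl

/-- Modulo a good prime, the power `ρ ^ k` determines a rational rotation `ρ` of small height up to
a quarter turn. -/
lemma rotation_eq_of_pow_eq {F : Type} [Field F] {p n H : ℕ} [CharP F p] (hp : GoodPrime n H p)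
    (hp2 : 2 < p) {ι : F} (hι : ι * ι = -1) {X Y M X' Y' M' : ℤ} {h k : ℕ} (hh : 2 * h ^ 2 ≤ H)
    (hk : 1 ≤ k) (hkn : k ≤ n) (hM0 : 0 < M) (hM0' : 0 < M') (hMp : M < p) (hMp' : M' < p)
    (hX : |X| ≤ h) (hY : |Y| ≤ h) (hX' : |X'| ≤ h) (hY' : |Y'| ≤ h)
    (hn : X ^ 2 + Y ^ 2 = M ^ 2) (hn' : X' ^ 2 + Y' ^ 2 = M' ^ 2)
    (hpow : ((X + Y * ι) / M) ^ k = ((X' + Y' * ι) / M') ^ k) :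
    ∃ j : Fin 4, ((X' + Y' * I) / M' : ℂ) = I ^ (j : ℕ) * ((X + Y * I) / M) := by
  set P := X' * X + Y' * Y with hP
  set Q := Y' * X - X' * Y with hQ
  have hPQ : P ^ 2 + Q ^ 2 = (M * M') ^ 2 := by
    rw [mul_pow, ← hn, ← hn', hP, hQ]; ring
  have hM : (M : F) ≠ 0 := intCast_ne_zero_of_lt (p := p) hM0 hMp
  have hM' : (M' : F) ≠ 0 := intCast_ne_zero_of_lt (p := p) hM0' hMp'
  have hnF : (X : F) ^ 2 + Y ^ 2 = M ^ 2 := by exact_mod_cast congrArg (Int.cast : ℤ → F) hn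
  have hPQF : (P : F) ^ 2 + Q ^ 2 = (M * M') ^ 2 := by
    exact_mod_cast congrArg (Int.cast : ℤ → F) hPQ
  have e1 : (P + Q * ι : F) = (X' + Y' * ι) * (X - Y * ι) := by
    rw [hP, hQ]; push_cast; linear_combination (Y' * Y : F) * hι
  have e2 : (X + Y * ι : F) * (X - Y * ι) = M ^ 2 := by
    rw [← hnF]; linear_combination (-(Y * Y) : F) * hι
  have e3 : (P + Q * ι : F) ^ k = (M * M') ^ k := by
    have h1 : (X' + Y' * ι : F) ^ k = ((X + Y * ι) / M) ^ k * M' ^ k := by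
      rw [hpow, ← mul_pow, div_mul_cancel₀ _ hM']
    rw [e1, mul_pow, h1, ← mul_pow, ← mul_pow]
    congr 1
    field_simp
    linear_combination e2
  have e4 : (P + Q * ι : F) * (P - Q * ι) = (M * M') ^ 2 := by
    rw [← hPQF]; linear_combination (-(Q * Q) : F) * hι
  have hMM : (M * M' : F) ^ k ≠ 0 := pow_ne_zero _ (mul_ne_zero hM hM')
  have e5 : (P + Q * (-ι) : F) ^ k = (M * M') ^ k := by
    apply mul_left_cancel₀ hMM
    calc (M * M' : F) ^ k * (P + Q * (-ι)) ^ k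
        = ((P + Q * ι) * (P - Q * ι)) ^ k := by rw [← e3, ← mul_pow]; ring
      _ = _ := by rw [e4]; ring
  have e6 := gaussian_pow_cast hι P Q k
  have e7 := gaussian_pow_cast (ι := -ι) (by rw [neg_mul_neg, hι]) P Q k
  set g := ((⟨P, Q⟩ : GaussianInt) ^ k).im with hg
  have hdvd : (p : ℤ) ∣ g := by
    rw [← CharP.intCast_eq_zero_iff F p]
    have h2 : ((2 : ℤ) : F) ≠ 0 := intCast_ne_zero_of_lt (p := p) (by norm_num)
      (by exact_mod_cast hp2)
    have hι0 : ι ≠ 0 := by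
      rintro rfl
      simp at hι
    have h3 : ((2 : ℤ) : F) * (g * ι) = 0 := by
      push_cast
      linear_combination e6 - e7 + e3 - e5
    exact (mul_eq_zero.1 ((mul_eq_zero.1 h3).resolve_left h2)).resolve_right hι0
  have hprod : ∀ {a b c d : ℤ}, |a| ≤ h → |b| ≤ h → |c| ≤ h → |d| ≤ h → |a * b| + |c * d| ≤ H := by
    intro a b c d ha hb hc hd
    have h1 : |a * b| ≤ h * h := by rw [abs_mul]; gcongr
    have h2 : |c * d| ≤ h * h := by rw [abs_mul]; gcongr
    have : (2 * (h : ℤ) ^ 2) ≤ H := by exact_mod_cast hh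
    nlinarith
  have hz : P * Q * (P ^ 2 - Q ^ 2) = 0 := by
    by_contra hne
    exact hp.not_dvd P Q ((abs_add_le _ _).trans (hprod hX' hX hY' hY))
      ((abs_sub _ _).trans (hprod hY' hX hX' hY)) hne k hk hkn hdvd
  have hm : M * M' ≠ 0 := by positivity
  have c1 : (M : ℂ) ≠ 0 := by exact_mod_cast hM0.ne'
  have c1' : (M' : ℂ) ≠ 0 := by exact_mod_cast hM0'.ne'
  have c2 : (X + Y * I : ℂ) * (X - Y * I) = M ^ 2 := by
    have : (X : ℂ) ^ 2 + Y ^ 2 = M ^ 2 := by exact_mod_cast congrArg (Int.cast : ℤ → ℂ) hn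
    rw [← this]; linear_combination (-(Y * Y) : ℂ) * Complex.I_mul_I
  have c3 : (P + Q * I : ℂ) = (X' + Y' * I) * (X - Y * I) := by
    rw [hP, hQ]; push_cast; linear_combination (Y' * Y : ℂ) * Complex.I_mul_I
  -- the quotient of the two rotations
  have key : ∀ u : ℂ, (P + Q * I : ℂ) = u * (M * M') →
      ((X' + Y' * I) / M' : ℂ) = u * ((X + Y * I) / M) := by
    intro u hu
    have : (X' + Y' * I : ℂ) * M ^ 2 = u * (M * M') * (X + Y * I) := by
      rw [← hu, c3, ← c2]; ring
    field_simp
    apply mul_left_cancel₀ c1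
    linear_combination this
  have hPQ' : ∀ x : ℤ, x ^ 2 = (M * M') ^ 2 → x = M * M' ∨ x = -(M * M') :=
    fun x hx => sq_eq_sq_iff_eq_or_eq_neg.1 hx
  rcases mul_eq_zero.1 hz with h | h
  · rcases mul_eq_zero.1 h with h | h
    · rcases hPQ' Q (by rw [← hPQ, h]; ring) with hq | hq
      · refine ⟨1, key _ ?_⟩
        rw [h, hq]; push_cast; simp; ring
      · refine ⟨3, key _ ?_⟩
        rw [h, hq]
        have : I ^ ((3 : Fin 4) : ℕ) = -I := Complex.I_pow_three
        rw [this]; push_cast; ring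
    · rcases hPQ' P (by rw [← hPQ, h]; ring) with hq | hq
      · refine ⟨0, key _ ?_⟩
        rw [h, hq]; push_cast; simp
      · refine ⟨2, key _ ?_⟩
        rw [h, hq]
        have : I ^ ((2 : Fin 4) : ℕ) = -1 := Complex.I_sq
        rw [this]; push_cast; ring
  · exact absurd (by linarith) (two_mul_sq_ne_sq (P := P) hm)

/-! ### Congruence modulo `p` -/

section congruence

variable {F : Type} [Field F]

/-- The sum of the reductions of the points. -/
def sumRed (T : List Item) (ι : F) : F := (T.map fun d => d.red ι).sum

/-- The reduction of `n` times the difference of a point and the centroid of the `n` points `T`. -/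
def ctr (n : ℕ) (T : List Item) (d : Item) (ι : F) : F := n * d.red ι - sumRed T ι

/-- The squared norm of `ctr`, which is invariant under rotations. -/
def ctrNorm (n : ℕ) (T : List Item) (d : Item) (ι : F) : F := ctr n T d ι * ctr n T d (-ι)

open Classical in
/-- The product of the centred points whose norm is not zero. -/
noncomputable def prodCtr (n : ℕ) (T : List Item) (ι : F) : F :=
  (T.map fun d => if ctrNorm n T d ι = 0 then 1 else ctr n T d ι).prod

open Classical in
/-- The number of the centred points whose norm is not zero. -/
noncomputable def numCtr (n : ℕ) (T : List Item) (ι : F) : ℕ :=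
  (T.map fun d => if ctrNorm n T d ι = 0 then 0 else 1).sum

lemma prodCtr_ne_zero (n : ℕ) (T : List Item) (ι : F) : prodCtr n T ι ≠ 0 := by
  classical
  unfold prodCtr
  refine List.prod_ne_zero fun h0 => ?_
  obtain ⟨d, -, hd⟩ := List.mem_map.1 h0
  split_ifs at hd with h
  · exact one_ne_zero hd
  · exact left_ne_zero_of_mul h hd

lemma numCtr_le (n : ℕ) (T : List Item) (ι : F) : numCtr n T ι ≤ T.length := by
  classical
  have h := List.sum_le_card_nsmul (T.map fun d => if ctrNorm n T d ι = 0 then 0 else 1) 1 (by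
    intro x hx
    obtain ⟨d, -, rfl⟩ := List.mem_map.1 hx
    split_ifs <;> simp)
  simpa [numCtr] using h

/-- The reductions of the points of `B` arise from those of `A` by `z ↦ r z + τ`. -/
def RelRed (A B : List Item) (r τ : F → F) : Prop :=
  Multiset.Rel (fun a b => ∀ ι : F, ι * ι = -1 → b.red ι = r ι * a.red ι + τ ι)
    (A : Multiset Item) (B : Multiset Item)

/-- If two functions agree on related data, then their multisets of values agree. -/
lemma RelRed.map_eq {A B : List Item} {r τ : F → F} (h : RelRed A B r τ) {β : Type}
    {f g : Item → β}
    (hfg : ∀ a b, (∀ ι : F, ι * ι = -1 → b.red ι = r ι * a.red ι + τ ι) → f a = g b) :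
    (A : Multiset Item).map f = (B : Multiset Item).map g := by
  rw [← Multiset.rel_eq, Multiset.rel_map]
  exact h.mono fun a _ b _ => hfg a b

lemma RelRed.sum_eq {A B : List Item} {r τ : F → F} (h : RelRed A B r τ) {ι : F}
    (hι : ι * ι = -1) : sumRed B ι = r ι * sumRed A ι + A.length * τ ι := by
  have h1 := congrArg Multiset.sum (h.map_eq (f := fun a => r ι * a.red ι + τ ι)
    (g := fun b => b.red ι) fun a b hab => (hab ι hι).symm)
  simp only [Multiset.map_coe, Multiset.sum_coe] at h1
  rw [sumRed, ← h1, List.sum_map_add, List.sum_map_mul_left, sumRed]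
  simp

lemma RelRed.ctr_eq {A B : List Item} {r τ : F → F} (h : RelRed A B r τ) {ι : F}
    (hι : ι * ι = -1) {a b : Item} (hab : b.red ι = r ι * a.red ι + τ ι) :
    ctr A.length B b ι = r ι * ctr A.length A a ι := by
  rw [ctr, ctr, h.sum_eq hι, hab]; ring

lemma RelRed.ctrNorm_eq {A B : List Item} {r τ : F → F} (h : RelRed A B r τ) {ι : F}
    (hι : ι * ι = -1) (hr : r ι * r (-ι) = 1) {a b : Item}
    (hab : ∀ ι : F, ι * ι = -1 → b.red ι = r ι * a.red ι + τ ι) :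
    ctrNorm A.length B b ι = ctrNorm A.length A a ι := by
  have hι' : -ι * -ι = -1 := by rw [neg_mul_neg, hι]
  rw [ctrNorm, ctrNorm, h.ctr_eq hι (hab ι hι), h.ctr_eq hι' (hab _ hι')]
  linear_combination (ctr A.length A a ι * ctr A.length A a (-ι)) * hr

lemma RelRed.prodCtr_eq {A B : List Item} {r τ : F → F} (h : RelRed A B r τ) {ι : F}
    (hι : ι * ι = -1) (hr : r ι * r (-ι) = 1) :
    prodCtr A.length B ι = r ι ^ numCtr A.length A ι * prodCtr A.length A ι := by
  classical
  have h1 := congrArg Multiset.prod (h.map_eq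
    (f := fun a => if ctrNorm A.length A a ι = 0 then 1 else r ι * ctr A.length A a ι)
    (g := fun b => if ctrNorm A.length B b ι = 0 then 1 else ctr A.length B b ι)
    fun a b hab => by simp only [h.ctrNorm_eq hι hr hab, h.ctr_eq hι (hab ι hι)])
  simp only [Multiset.map_coe, Multiset.prod_coe] at h1
  rw [prodCtr, ← h1, prodCtr, numCtr]
  generalize A.length = n
  have : ∀ T : List Item,
      (T.map fun a => if ctrNorm n A a ι = 0 then 1 else r ι * ctr n A a ι).prod =
      r ι ^ (T.map fun d => if ctrNorm n A d ι = 0 then 0 else 1).sum *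
        (T.map fun d => if ctrNorm n A d ι = 0 then 1 else ctr n A d ι).prod := by
    intro T
    induction T with
    | nil => simp
    | cons d T ih =>
      simp only [List.map_cons, List.prod_cons, List.sum_cons, ih]
      split_ifs
      · simp
      · rw [pow_add, pow_one]; ring
  exact this A

/-- The fingerprint of `A` under the rotation by `w / M`, at the point `x`. -/
def print (n : ℕ) (T : List Item) (M w x ι : F) : F :=
  (T.map fun d => M * x - w * ctr n T d ι).prod

lemma RelRed.print_eq {A B : List Item} {r τ : F → F} (h : RelRed A B r τ) {ι : F}
    (hι : ι * ι = -1) {M w : F} (hw : w = M * r ι) (x : F) :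
    print A.length A M w x ι = print A.length B M M x ι := by
  have h1 := congrArg Multiset.prod (h.map_eq
    (f := fun a => M * x - w * ctr A.length A a ι)
    (g := fun b => M * x - M * ctr A.length B b ι)
    fun a b hab => by simp only [h.ctr_eq hι (hab ι hι), hw]; ring)
  rwa [Multiset.map_coe, Multiset.prod_coe, Multiset.map_coe, Multiset.prod_coe] at h1

/-- Different multisets of `n` elements are separated by `∏ (x - s)` except for `n` values of
`x`. -/
lemma exists_finset_of_ne {T T' : Multiset F} (hne : T ≠ T') {n : ℕ} (hT : T.card = n)
    (hT' : T'.card = n) (R : ℕ) {e : ℕ → F} (he : Set.InjOn e (Finset.range R)) :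
    ∃ S : Finset ℕ, S.card ≤ n ∧ ∀ x < R,
      (T.map fun s => e x - s).prod = (T'.map fun s => e x - s).prod → x ∈ S := by
  classical
  set P : Polynomial F := (T.map fun s => Polynomial.X - Polynomial.C s).prod with hP
  set P' : Polynomial F := (T'.map fun s => Polynomial.X - Polynomial.C s).prod with hP'
  have hsub : P - P' ≠ 0 := by
    intro h0
    apply hne
    rw [← Polynomial.roots_multiset_prod_X_sub_C T, ← Polynomial.roots_multiset_prod_X_sub_C T',
      ← hP, ← hP', sub_eq_zero.1 h0]
  have hdeg : (P - P').natDegree ≤ n := by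
    refine (Polynomial.natDegree_sub_le _ _).trans (max_le ?_ ?_)
    · rw [hP, Polynomial.natDegree_multiset_prod_X_sub_C_eq_card, hT]
    · rw [hP', Polynomial.natDegree_multiset_prod_X_sub_C_eq_card, hT']
  have hev : ∀ (T : Multiset F) (y : F),
      ((T.map fun s => Polynomial.X - Polynomial.C s).prod).eval y
        = (T.map fun s => y - s).prod := by
    intro T y
    rw [Polynomial.eval_multiset_prod, Multiset.map_map]
    simp
  refine ⟨{x ∈ Finset.range R | e x ∈ (P - P').roots.toFinset}, ?_, fun x hx h => ?_⟩
  · refine (Finset.card_le_card_of_injOn e (fun x hx => ?_) (he.mono fun x hx => ?_)).trans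
      ((Multiset.toFinset_card_le _).trans ((Polynomial.card_roots' _).trans hdeg))
    · exact (Finset.mem_filter.1 hx).2
    · exact (Finset.mem_filter.1 hx).1
  · rw [Finset.mem_filter, Finset.mem_range, Multiset.mem_toFinset, Polynomial.mem_roots hsub,
      Polynomial.IsRoot, Polynomial.eval_sub, hP, hP', hev, hev, h, sub_self]
    exact ⟨hx, rfl⟩

/-- The fingerprint up to a factor: it is the product of `y - s`, where `s` runs through the images
of the points and `y` is an affine function of `x`. -/
lemma print_eq_prod {n : ℕ} (hn : (n : F) ≠ 0) {M w c τ : F} (hM : M ≠ 0) (T : List Item) {ι : F}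
    (hτ : M * c - w * sumRed T ι = n * M * τ) (x : F) :
    print n T M w x ι = (M * n) ^ T.length *
      (((T : Multiset Item).map fun d => w / M * d.red ι + τ).map
        fun s => (x + c) / n - s).prod := by
  rw [Multiset.map_map, Multiset.map_coe, Multiset.prod_coe, print]
  have h : ∀ d : Item, M * x - w * ctr n T d ι =
      M * n * ((x + c) / n - (w / M * d.red ι + τ)) := by
    intro d
    rw [ctr]
    field_simp
    linear_combination -hτ
  simp only [h]
  rw [List.prod_map_mul]
  simp [Function.comp_def]

variable {p : ℕ} [CharP F p] {n : ℕ} {U V : ℤ} {A B : List Item}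

/-- The sizes of the coordinates, of the base `V = 2 n U` of all heights, and of the modulus. The
rotation of a congruence has height `V ^ 12` and its translation `V ^ 19`. The numbers left by a
search, even one that fails, have heights at most `V ^ 13` and `V ^ 21`, and they map a point to one
of height `V ^ 38`. A modulus above `V ^ 155` is then large enough for `Red.eq_iff`. -/
structure Heights (U V : ℤ) (p : ℕ) : Prop where
  nonneg : 0 ≤ U
  two_le : 2 ≤ V
  two_mul_le : 2 * U ≤ V
  lt : V ^ 175 < p

lemma Heights.pow_lt (h : Heights U V p) {k : ℕ} (hk : k ≤ 175) : V ^ k < p :=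
  (pow_le_pow_right₀ (by linarith [h.two_le]) hk).trans_lt h.lt

lemma Heights.lt_prime (h : Heights U V p) : U < p := by
  have := h.pow_lt (k := 1) (by norm_num)
  linarith [h.nonneg, h.two_mul_le]

lemma Heights.sq_le (h : Heights U V p) : U ^ 2 ≤ V ^ 2 :=
  pow_le_pow_left₀ h.nonneg (by linarith [h.nonneg, h.two_mul_le]) 2

/-- The points of `A` are mapped to those of `B` by the rotation `z ↦ ρ z`, followed by the
translation by `t`. -/
def Cong (A B : List Item) (ρ t : ℂ) : Prop :=
  CongruentVia (A.map fun d => d.2.toComplex : List ℂ) (B.map fun d => d.2.toComplex : List ℂ) ρ t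

/-- For the heights that occur, a congruence can be tested modulo `p`. -/
lemma red_iff (hA : ∀ d ∈ A, d.Bdd U) (hB : ∀ d ∈ B, d.Bdd U) (hp : Heights U V p)
    {ρ t : ℂ} {r τ : F → F} (hρ : Red (V ^ 13) ρ r)
    (ht : Red (V ^ 21) t τ) {ι : F} (hι : ι * ι = -1) :
    ∀ a ∈ A, ∀ b ∈ B, ρ * a.2.toComplex + t = b.2.toComplex ↔ r ι * a.red ι + τ ι = b.red ι := by
  intro a ha b hb
  have hV := hp.two_le
  have hU2 := hp.sq_le
  have hUp := hp.lt_prime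
  have h1 : Red (V ^ 16) (ρ * a.2.toComplex) (r * a.red) := by
    refine (hρ.mul ((hA a ha).red (F := F) hUp)).mono ?_
    calc 2 * (V : ℤ) ^ 13 * U ^ 2 ≤ V * V ^ 13 * V ^ 2 := by gcongr
      _ = V ^ 16 := by ring
  have h2 : Red (V ^ 38) (ρ * a.2.toComplex + t) (r * a.red + τ) := by
    refine (h1.add ht (hp.pow_lt (by norm_num)) (hp.pow_lt (by norm_num))).mono ?_
    calc 2 * (V : ℤ) ^ 16 * V ^ 21 ≤ V * V ^ 16 * V ^ 21 := by gcongr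
      _ = V ^ 38 := by ring
  have h3 : Red (V ^ 38) b.2.toComplex (b.red : F → F) :=
    ((hB b hb).red hUp).mono (hU2.trans (pow_le_pow_right₀ (by linarith) (by norm_num)))
  refine h2.eq_iff h3 ?_ hι
  calc 8 * ((V : ℤ) ^ 38) ^ 4 = 2 ^ 3 * V ^ 152 := by ring
    _ ≤ V ^ 3 * V ^ 152 := by gcongr
    _ = V ^ 155 := by ring
    _ < p := hp.pow_lt (by norm_num)

/-- A congruence yields one modulo `p`. -/
lemma relRed_of_congruent (hA : ∀ d ∈ A, d.Bdd U) (hB : ∀ d ∈ B, d.Bdd U) (hp : Heights U V p)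
    {ρ t : ℂ} {r τ : F → F} (hρ : Red (V ^ 13) ρ r)
    (ht : Red (V ^ 21) t τ)
    (h : Cong A B ρ t) : RelRed A B r τ := by
  have h2 := h.2
  rw [Multiset.map_coe, List.map_map, ← Multiset.map_coe, ← Multiset.map_coe, ← Multiset.rel_eq,
    Multiset.rel_map] at h2
  exact h2.mono fun a ha b hb hab ι hι =>
    ((red_iff hA hB hp hρ ht hι a ha b hb).1 hab).symm

/-- A congruence modulo `p` by a transformation of small height comes from a congruence. -/
lemma congruent_of_map_eq (hA : ∀ d ∈ A, d.Bdd U) (hB : ∀ d ∈ B, d.Bdd U) (hp : Heights U V p)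
    {ρ t : ℂ} {r τ : F → F} (hρ : Red (V ^ 13) ρ r)
    (ht : Red (V ^ 21) t τ) (hρ1 : ‖ρ‖ = 1) {ι : F} (hι : ι * ι = -1)
    (h : (A : Multiset Item).map (fun d => r ι * d.red ι + τ ι)
      = (B : Multiset Item).map fun d => d.red ι) :
    Cong A B ρ t := by
  refine ⟨hρ1, ?_⟩
  rw [Multiset.map_coe, List.map_map, ← Multiset.map_coe, ← Multiset.map_coe, ← Multiset.rel_eq,
    Multiset.rel_map]
  rw [← Multiset.rel_eq, Multiset.rel_map] at h
  exact h.mono fun a ha b hb hab => (red_iff hA hB hp hρ ht hι a ha b hb).2 hab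

lemma Cong.exists_mem {ρ t : ℂ} (h : Cong A B ρ t) {a : Item} (ha : a ∈ A) :
    ∃ b ∈ B, ρ * a.2.toComplex + t = b.2.toComplex := by
  have h1 : ρ * a.2.toComplex + t ∈ (B.map fun d => d.2.toComplex : Multiset ℂ) := by
    rw [← h.2]
    exact Multiset.mem_map.2 ⟨_, Multiset.mem_coe.2 (List.mem_map.2 ⟨a, ha, rfl⟩), rfl⟩
  obtain ⟨b, hb, e⟩ := List.mem_map.1 (Multiset.mem_coe.1 h1)
  exact ⟨b, hb, e.symm⟩

/-- The translation of a congruence has small height if the rotation has. -/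
lemma Cong.red_translation (hA : ∀ d ∈ A, d.Bdd U) (hB : ∀ d ∈ B, d.Bdd U) (hp : Heights U V p)
    {ρ t : ℂ} {r : F → F} (hρ : Red (V ^ 13) ρ r)
    (h : Cong A B ρ t) (hne : A ≠ []) : ∃ τ : F → F, Red (V ^ 19) t τ := by
  obtain ⟨a, ha⟩ := List.exists_mem_of_ne_nil A hne
  obtain ⟨b, hb, e⟩ := h.exists_mem ha
  have hV := hp.two_le
  have hU2 := hp.sq_le
  have hUp := hp.lt_prime
  have h1 : Red (V ^ 16) (ρ * a.2.toComplex) (r * a.red) := by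
    refine (hρ.mul ((hA a ha).red (F := F) hUp)).mono ?_
    calc 2 * (V : ℤ) ^ 13 * U ^ 2 ≤ V * V ^ 13 * V ^ 2 := by gcongr
      _ = V ^ 16 := by ring
  have h2 := ((hB b hb).red (F := F) hUp).sub h1 (hU2.trans_lt (hp.pow_lt (by norm_num)))
    (hp.pow_lt (by norm_num))
  refine ⟨_, ((eq_sub_of_add_eq' e) ▸ h2).mono ?_⟩
  calc 2 * (U : ℤ) ^ 2 * V ^ 16 ≤ V * V ^ 2 * V ^ 16 := by gcongr
    _ = V ^ 19 := by ring

/-- The rotation of a congruence has small height if not all points are equal. -/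
lemma Cong.red_rotation (hA : ∀ d ∈ A, d.Bdd U) (hB : ∀ d ∈ B, d.Bdd U) (hp : Heights U V p)
    {ρ t : ℂ} (h : Cong A B ρ t) {a a' : Item} (ha : a ∈ A)
    (ha' : a' ∈ A) (hne : a.2.toComplex ≠ a'.2.toComplex) : ∃ r : F → F, Red (V ^ 12) ρ r := by
  obtain ⟨b, hb, e⟩ := h.exists_mem ha
  obtain ⟨b', hb', e'⟩ := h.exists_mem ha'
  have hV := hp.two_le
  have hU0 := hp.nonneg
  have hU := hp.two_mul_le
  have hU2 := hp.sq_le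
  have hUp := hp.lt_prime
  have hU2p : U ^ 2 < p := hU2.trans_lt (hp.pow_lt (by norm_num))
  have hd : ∀ {x y : Item}, x.Bdd U → y.Bdd U →
      Red (2 * U ^ 4) (x.2.toComplex - y.2.toComplex) (x.red - y.red : F → F) := fun hx hy =>
    ((hx.red hUp).sub (hy.red hUp) hU2p hU2p).mono (by ring_nf; rfl)
  have h8 : 2 * (2 * U ^ 4) ^ 2 < p := by
    refine lt_of_le_of_lt ?_ (hp.pow_lt (k := 8) (by norm_num))
    calc 2 * (2 * U ^ 4) ^ 2 ≤ (2 * U) ^ 8 := by ring_nf; gcongr; norm_num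
      _ ≤ V ^ 8 := by gcongr
  have h1 := (hd (hB b hb) (hB b' hb')).mul
    ((hd (hA a ha) (hA a' ha')).inv (p := p) (sub_ne_zero.2 hne) h8)
  have e2 : (b.2.toComplex - b'.2.toComplex) * (a.2.toComplex - a'.2.toComplex)⁻¹ = ρ := by
    rw [← e, ← e', ← div_eq_mul_inv, div_eq_iff (sub_ne_zero.2 hne)]
    ring
  rw [e2] at h1
  refine ⟨_, h1.mono ?_⟩
  calc 2 * (2 * U ^ 4) * (2 * (2 * U ^ 4) ^ 2) ≤ (2 * U) ^ 12 := by ring_nf; gcongr; norm_num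
    _ ≤ V ^ 12 := by gcongr

lemma Red.exists_int {H : ℤ} {ρ : ℂ} {r : F → F} (h : Red H ρ r) (hρ : ‖ρ‖ = 1) :
    ∃ X Y M : ℤ, 0 < M ∧ M ≤ H ∧ |X| ≤ H ∧ |Y| ≤ H ∧ X ^ 2 + Y ^ 2 = M ^ 2 ∧
      ρ = (X + Y * I) / M := by
  obtain ⟨M, X, Y, h0, h1, h2, h3, rfl, -⟩ := h
  refine ⟨X, Y, M, h0, h1, h2, h3, ?_, rfl⟩
  have hM : (M : ℝ) ≠ 0 := by exact_mod_cast h0.ne'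
  have e : ((X + Y * I) / M : ℂ) = ((X / M : ℝ) : ℂ) + ((Y / M : ℝ) : ℂ) * I := by
    push_cast; ring
  rw [e, ← sq_eq_sq₀ (norm_nonneg _) zero_le_one, Complex.sq_norm, Complex.normSq_add_mul_I,
    div_pow, div_pow, ← add_div, one_pow, div_eq_one_iff_eq (by positivity)] at hρ
  exact_mod_cast hρ

lemma norm_rotation {X Y M : ℤ} (hM : 0 < M) (h : X ^ 2 + Y ^ 2 = M ^ 2) :
    ‖((X + Y * I) / M : ℂ)‖ = 1 := by
  have hM' : (M : ℝ) ≠ 0 := by exact_mod_cast hM.ne'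
  have e : ((X + Y * I) / M : ℂ) = ((X / M : ℝ) : ℂ) + ((Y / M : ℝ) : ℂ) * I := by
    push_cast; ring
  rw [e, ← sq_eq_sq₀ (norm_nonneg _) zero_le_one, Complex.sq_norm, Complex.normSq_add_mul_I,
    div_pow, div_pow, ← add_div, one_pow, div_eq_one_iff_eq (by positivity)]
  exact_mod_cast h

/-- If all points of `A` are equal, then every rotation belongs to a congruence. -/
lemma Cong.of_all_eq {ρ t : ℂ} (h : Cong A B ρ t) {z : ℂ} (hz : ∀ a ∈ A, a.2.toComplex = z)
    {ρ' : ℂ} (hρ' : ‖ρ'‖ = 1) : Cong A B ρ' (ρ * z + t - ρ' * z) := by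
  refine ⟨hρ', ?_⟩
  rw [← h.2]
  refine Multiset.map_congr rfl fun w hw => ?_
  obtain ⟨a, ha, rfl⟩ := List.mem_map.1 (Multiset.mem_coe.1 hw)
  rw [hz a ha]; ring

/-- If all centred points have the norm zero modulo `p`, then all points are equal: those whose
`ctr` does not vanish at `ι` have the same reduction at `-ι`, so they are equal, and as the sum of
all `ctr` is zero, there are none. -/
lemma all_eq_of_ctrNorm_eq_zero (hA : ∀ d ∈ A, d.Bdd U) (hp : Heights U V p)
    (hn : A.length = n) (hn0 : 0 < n) (hnV : (n : ℤ) ≤ V) {ι : F} (hι : ι * ι = -1)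
    (h : ∀ a ∈ A, ctrNorm n A a ι = 0) :
    ∃ z, ∀ a ∈ A, a.2.toComplex = z := by
  classical
  have hU0 := hp.nonneg
  have hU := hp.two_mul_le
  have hV := hp.two_le
  have hUp := hp.lt_prime
  have h11 : 8 * (U ^ 2) ^ 4 < p := by
    refine lt_of_le_of_lt ?_ (hp.pow_lt (k := 11) (by norm_num))
    calc 8 * (U ^ 2) ^ 4 = 2 ^ 3 * U ^ 8 := by ring
      _ ≤ V ^ 3 * V ^ 8 := by gcongr; linarith
      _ = V ^ 11 := by ring
  have hι' : -ι * -ι = -1 := by rw [neg_mul_neg, hι]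
  have hnF : ∀ m : ℕ, 0 < m → m ≤ n → (m : F) ≠ 0 := fun m h0 hm => by
    have := hp.pow_lt (k := 1) (by norm_num)
    rw [pow_one] at this
    exact_mod_cast intCast_ne_zero_of_lt (F := F) (p := p) (a := m) (by omega) (by omega)
  have hinj : ∀ a ∈ A, ∀ b ∈ A, ∀ κ : F, κ * κ = -1 → ctr n A a κ = ctr n A b κ →
      a.2.toComplex = b.2.toComplex := by
    intro a ha b hb κ hκ hab
    refine (((hA a ha).red (F := F) hUp).eq_iff ((hA b hb).red hUp) h11 hκ).2 ?_
    rw [ctr, ctr, sub_left_inj] at hab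
    exact mul_left_cancel₀ (hnF n hn0 le_rfl) hab
  have hsum : (A.map fun a => ctr n A a ι).sum = 0 := by
    simp only [ctr, sub_eq_add_neg]
    rw [List.sum_map_add, List.sum_map_mul_left]
    simp [sumRed, hn]
  by_cases hall : ∀ a ∈ A, ctr n A a ι = 0
  · obtain ⟨a, ha⟩ := List.exists_mem_of_length_pos (hn ▸ hn0)
    exact ⟨a.2.toComplex, fun b hb => hinj b hb a ha ι hι (by rw [hall b hb, hall a ha])⟩
  push Not at hall
  obtain ⟨a, ha, hne⟩ := hall
  exfalso
  have hval : ∀ b ∈ A, ctr n A b ι = if ctr n A b ι = 0 then 0 else ctr n A a ι := by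
    intro b hb
    split_ifs with h0
    · exact h0
    · have h1 := (mul_eq_zero.1 (h b hb)).resolve_left h0
      have h2 := (mul_eq_zero.1 (h a ha)).resolve_left hne
      have e := hinj b hb a ha (-ι) hι' (by rw [h1, h2])
      have e2 : b.red ι = a.red ι :=
        (((hA b hb).red (F := F) hUp).eq_iff ((hA a ha).red hUp) h11 hι).1 e
      rw [ctr, ctr, e2]
  rw [List.map_congr_left hval] at hsum
  have hcount : ∀ T : List Item,
      (T.map fun b => if ctr n A b ι = 0 then 0 else ctr n A a ι).sum
        = (T.countP fun b => ctr n A b ι ≠ 0) * ctr n A a ι := by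
    intro T
    induction T with
    | nil => simp
    | cons b T ih =>
      rw [List.map_cons, List.sum_cons, ih, List.countP_cons]
      by_cases hb : ctr n A b ι = 0
      · simp [hb]
      · simp [hb]; ring
  rw [hcount] at hsum
  refine (mul_ne_zero (hnF _ ?_ ?_) hne) hsum
  · exact List.countP_pos_iff.2 ⟨a, ha, by simpa using hne⟩
  · exact List.countP_le_length.trans hn.le

end congruence

/-! ### Quarter turns and candidates -/

/-- The real part of `i ^ j (x + y i)`. -/
def rotRe {R : Type} [Neg R] (j : Fin 4) (x y : R) : R :=
  match j with
  | 0 => x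
  | 1 => -y
  | 2 => -x
  | 3 => y

/-- The imaginary part of `i ^ j (x + y i)`. -/
def rotIm {R : Type} [Neg R] (j : Fin 4) (x y : R) : R :=
  match j with
  | 0 => y
  | 1 => x
  | 2 => -y
  | 3 => -x

lemma rot_eq {R : Type} [CommRing R] {ι : R} (hι : ι * ι = -1) (j : Fin 4) (x y : R) :
    rotRe j x y + rotIm j x y * ι = ι ^ (j : ℕ) * (x + y * ι) := by
  fin_cases j
  · simp [rotRe, rotIm]
  · simp only [rotRe, rotIm]; linear_combination -y * hι
  · simp only [rotRe, rotIm]; linear_combination (-x - y * ι) * hι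
  · simp only [rotRe, rotIm]; linear_combination (-x * ι - y * (ι * ι) + y) * hι

lemma rotRe_cast {R : Type} [Ring R] (j : Fin 4) (x y : ℤ) :
    ((rotRe j x y : ℤ) : R) = rotRe j (x : R) (y : R) := by
  fin_cases j <;> simp [rotRe]

lemma rotIm_cast {R : Type} [Ring R] (j : Fin 4) (x y : ℤ) :
    ((rotIm j x y : ℤ) : R) = rotIm j (x : R) (y : R) := by
  fin_cases j <;> simp [rotIm]

/-- The integers `X`, `Y`, `M` represent the rotation `(X + Y i) / M`; `h` bounds their size. -/
structure IsRot (h X Y M : ℤ) : Prop where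
  pos : 0 < M
  den_le : M ≤ h
  re_le : |X| ≤ h
  im_le : |Y| ≤ h
  norm : X ^ 2 + Y ^ 2 = M ^ 2

lemma IsRot.mono {h h' X Y M : ℤ} (H : IsRot h X Y M) (hh : h ≤ h') : IsRot h' X Y M :=
  ⟨H.pos, H.den_le.trans hh, H.re_le.trans hh, H.im_le.trans hh, H.norm⟩

lemma IsRot.turn {h X Y M : ℤ} (H : IsRot h X Y M) (j : Fin 4) :
    IsRot h (rotRe j X Y) (rotIm j X Y) M := by
  obtain ⟨h1, h2, h3, h4, h5⟩ := H
  refine ⟨h1, h2, ?_, ?_, ?_⟩ <;> fin_cases j <;> simp [rotRe, rotIm, *] <;> linarith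

section candidates

variable {F : Type} [Field F] {p : ℕ} [CharP F p] {n : ℕ} {U V : ℤ} {A B : List Item}

lemma IsRot.red {h X Y M : ℤ} (H : IsRot h X Y M) :
    Red h ((X + Y * I) / M) (fun ι : F => (X + Y * ι) / M) :=
  ⟨M, X, Y, H.pos, H.den_le, H.re_le, H.im_le, rfl, fun _ _ => rfl⟩

lemma IsRot.mul_conj {h X Y M : ℤ} (H : IsRot h X Y M) (hp : h < p) {ι : F} (hι : ι * ι = -1) :
    ((X + Y * ι) / M : F) * ((X + Y * -ι) / M) = 1 := by
  have hM : (M : F) ≠ 0 := intCast_ne_zero_of_lt (p := p) H.pos (H.den_le.trans_lt hp)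
  have hn : (X : F) ^ 2 + Y ^ 2 = M ^ 2 := by exact_mod_cast congrArg (Int.cast : ℤ → F) H.norm
  rw [div_mul_div_comm, div_eq_one_iff_eq (mul_ne_zero hM hM)]
  linear_combination hn - (Y * Y : F) * hι

/-- The condition by which the candidates for the rotation are found. -/
def PowCond (n : ℕ) (A B : List Item) (X Y M : ℤ) (ι : F) : Prop :=
  (X + Y * ι) ^ numCtr n A ι * prodCtr n A ι = (M : F) ^ numCtr n A ι * prodCtr n B ι

/-- The condition by which the translation that belongs to a rotation is found. -/
def TransCond (n : ℕ) (A B : List Item) (X Y M T₁ T₂ S : ℤ) (ι : F) : Prop :=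
  S * (M * sumRed B ι - (X + Y * ι) * sumRed A ι) = n * M * (T₁ + T₂ * ι)

lemma Cong.powCond (hA : ∀ d ∈ A, d.Bdd U) (hB : ∀ d ∈ B, d.Bdd U) (hp : Heights U V p)
    {X Y M : ℤ} (H : IsRot (V ^ 13) X Y M) {t : ℂ} (h : Cong A B ((X + Y * I) / M) t)
    (hne : A ≠ []) {ι : F} (hι : ι * ι = -1) : PowCond A.length A B X Y M ι := by
  obtain ⟨τ, hτ⟩ := h.red_translation hA hB hp (H.red (F := F)) hne
  have hV := hp.two_le
  have hr := relRed_of_congruent hA hB hp (H.red (F := F))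
    (hτ.mono (pow_le_pow_right₀ (by linarith) (by norm_num))) h
  have hM : (M : F) ≠ 0 := intCast_ne_zero_of_lt (p := p) H.pos
    (H.den_le.trans_lt (hp.pow_lt (by norm_num)))
  have := hr.prodCtr_eq hι (H.mul_conj (hp.pow_lt (by norm_num)) hι)
  rw [PowCond, this, div_pow]
  field_simp

/-- A congruence has a rotation that is found by the search for candidates. -/
lemma Cong.exists_candidate (hA : ∀ d ∈ A, d.Bdd U) (hB : ∀ d ∈ B, d.Bdd U) (hp : Heights U V p)
    {ρ t : ℂ} (h : Cong A B ρ t) (hne : A ≠ []) :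
    ∃ X Y M : ℤ, IsRot (V ^ 12) X Y M ∧
      ∀ ι : F, ι * ι = -1 → PowCond A.length A B X Y M ι := by
  have hV := hp.two_le
  have hV1 : 1 ≤ V := by linarith
  have h12 : V ^ 12 ≤ V ^ 13 := pow_le_pow_right₀ hV1 (by norm_num)
  by_cases hall : ∀ a ∈ A, ∀ a' ∈ A, a.2.toComplex = a'.2.toComplex
  · obtain ⟨a, ha⟩ := List.exists_mem_of_ne_nil A hne
    have h1 : (1 : ℤ) ≤ V ^ 12 := one_le_pow₀ hV1
    have H : IsRot (V ^ 12) 1 0 1 :=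
      ⟨one_pos, h1, by simpa using h1, by simp; linarith, by norm_num⟩
    exact ⟨1, 0, 1, H, fun ι hι => (h.of_all_eq (fun b hb => hall b hb a ha)
      (norm_rotation H.pos H.norm)).powCond hA hB hp (H.mono h12) hne hι⟩
  · push Not at hall
    obtain ⟨a, ha, a', ha', hd⟩ := hall
    obtain ⟨r, hr⟩ := h.red_rotation (F := F) hA hB hp ha ha' hd
    obtain ⟨X, Y, M, h1, h2, h3, h4, h5, rfl⟩ := hr.exists_int h.1
    exact ⟨X, Y, M, ⟨h1, h2, h3, h4, h5⟩, fun ι hι =>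
      h.powCond hA hB hp (IsRot.mono ⟨h1, h2, h3, h4, h5⟩ h12) hne hι⟩

/-- If the sets are congruent, then any candidate yields a congruence after a quarter turn. -/
lemma Cong.exists_turn (hA : ∀ d ∈ A, d.Bdd U) (hB : ∀ d ∈ B, d.Bdd U) (hp : Heights U V p)
    {H : ℕ} (hg : GoodPrime A.length H p) (hH : 2 * (V ^ 13) ^ 2 ≤ H) (hnV : (A.length : ℤ) ≤ V)
    {ρ t : ℂ} (h : Cong A B ρ t) (hne : A ≠ []) {X Y M : ℤ} (hc : IsRot (V ^ 13) X Y M) {ι : F}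
    (hι : ι * ι = -1) (hpow : PowCond A.length A B X Y M ι) :
    ∃ (j : Fin 4) (t' : ℂ), Cong A B ((rotRe j X Y + rotIm j X Y * I : ℂ) / M) t' := by
  have hV := hp.two_le
  have hV1 : 1 ≤ V := by linarith
  have h12 : V ^ 12 ≤ V ^ 13 := pow_le_pow_right₀ hV1 (by norm_num)
  have h13 : V ^ 13 < p := hp.pow_lt (by norm_num)
  by_cases hall : ∃ z, ∀ a ∈ A, a.2.toComplex = z
  · obtain ⟨z, hz⟩ := hall
    exact ⟨0, _, h.of_all_eq hz (by simpa [rotRe, rotIm] using norm_rotation hc.pos hc.norm)⟩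
  have hk : 1 ≤ numCtr A.length A ι := by
    classical
    by_contra hk
    refine hall (all_eq_of_ctrNorm_eq_zero hA hp rfl (List.length_pos_of_ne_nil hne) hnV hι ?_)
    intro a ha
    by_contra h0
    have hmem := List.mem_map_of_mem (f := fun d => if ctrNorm A.length A d ι = 0 then 0 else 1) ha
    have := List.single_le_sum (l := A.map fun d => if ctrNorm A.length A d ι = 0 then 0 else 1)
      (fun _ _ => Nat.zero_le _) _ hmem
    rw [if_neg h0] at this
    exact hk (this.trans_eq rfl)
  have hd : ∃ a ∈ A, ∃ a' ∈ A, a.2.toComplex ≠ a'.2.toComplex := by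
    by_contra hd
    push Not at hd
    obtain ⟨a, ha⟩ := List.exists_mem_of_ne_nil A hne
    exact hall ⟨_, fun b hb => hd b hb a ha⟩
  obtain ⟨a, ha, a', ha', hd⟩ := hd
  obtain ⟨r, hr⟩ := h.red_rotation (F := F) hA hB hp ha ha' hd
  obtain ⟨X', Y', M', h1, h2, h3, h4, h5, rfl⟩ := hr.exists_int h.1
  have hc' : IsRot (V ^ 13) X' Y' M' := IsRot.mono ⟨h1, h2, h3, h4, h5⟩ h12
  have hpow' := h.powCond hA hB hp hc' hne hι
  have hM : (M : F) ≠ 0 := intCast_ne_zero_of_lt (p := p) hc.pos (hc.den_le.trans_lt h13)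
  have hM' : (M' : F) ≠ 0 := intCast_ne_zero_of_lt (p := p) hc'.pos (hc'.den_le.trans_lt h13)
  have hQ := prodCtr_ne_zero A.length A ι
  rw [PowCond] at hpow hpow'
  set k := numCtr A.length A ι with hkdef
  have heq : ((X + Y * ι) / M : F) ^ k = ((X' + Y' * ι) / M') ^ k := by
    rw [div_pow, div_pow, div_eq_div_iff (pow_ne_zero _ hM) (pow_ne_zero _ hM')]
    apply mul_right_cancel₀ hQ
    linear_combination (M' : F) ^ k * hpow - (M : F) ^ k * hpow'
  have hVn : (((V ^ 13).toNat : ℕ) : ℤ) = V ^ 13 := Int.toNat_of_nonneg (by positivity)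
  obtain ⟨j, hj⟩ := rotation_eq_of_pow_eq hg
    (by have := hp.pow_lt (k := 2) (by norm_num); zify; nlinarith) hι (h := (V ^ 13).toNat)
    (by zify; rw [hVn]; exact hH) hk (numCtr_le _ _ _) hc.pos hc'.pos (hc.den_le.trans_lt h13)
    (hc'.den_le.trans_lt h13) (by rw [hVn]; exact hc.re_le) (by rw [hVn]; exact hc.im_le)
    (by rw [hVn]; exact hc'.re_le) (by rw [hVn]; exact hc'.im_le) hc.norm hc'.norm heq
  refine ⟨j, t, ?_⟩
  rwa [rotRe_cast, rotIm_cast, rot_eq Complex.I_mul_I, mul_div_assoc, ← hj]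

/-- The translation of a congruence is found, and the fingerprints agree. -/
lemma Cong.accepted (hA : ∀ d ∈ A, d.Bdd U) (hB : ∀ d ∈ B, d.Bdd U) (hp : Heights U V p)
    {X Y M : ℤ} (hc : IsRot (V ^ 13) X Y M) {t : ℂ} (h : Cong A B ((X + Y * I) / M) t)
    (hne : A ≠ []) :
    (∃ T₁ T₂ S : ℤ, 0 < S ∧ S ≤ V ^ 19 ∧ |T₁| ≤ V ^ 19 ∧ |T₂| ≤ V ^ 19 ∧
      ∀ ι : F, ι * ι = -1 → TransCond A.length A B X Y M T₁ T₂ S ι) ∧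
    ∀ ι : F, ι * ι = -1 → ∀ x : F,
      print A.length A (M : F) (X + Y * ι) x ι = print A.length B (M : F) M x ι := by
  obtain ⟨τ, hτ⟩ := h.red_translation hA hB hp (hc.red (F := F)) hne
  have hV := hp.two_le
  have hr := relRed_of_congruent hA hB hp (hc.red (F := F))
    (hτ.mono (pow_le_pow_right₀ (by linarith) (by norm_num))) h
  have hM : (M : F) ≠ 0 := intCast_ne_zero_of_lt (p := p) hc.pos
    (hc.den_le.trans_lt (hp.pow_lt (by norm_num)))
  refine ⟨?_, fun ι hι x => hr.print_eq hι (by field_simp) x⟩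
  obtain ⟨S, T₁, T₂, h0, h1, h2, h3, -, h5⟩ := hτ
  refine ⟨T₁, T₂, S, h0, h1, h2, h3, fun ι hι => ?_⟩
  have hS : (S : F) ≠ 0 := intCast_ne_zero_of_lt (p := p) h0
    (h1.trans_lt (hp.pow_lt (by norm_num)))
  rw [TransCond, hr.sum_eq hι, h5 ι hι]
  field_simp
  ring

/-- A pair of a rotation and a translation that is not a congruence is detected by the
fingerprints, except for `n` values of the evaluation point. -/
lemma exists_finset_of_not_cong (hA : ∀ d ∈ A, d.Bdd U) (hB : ∀ d ∈ B, d.Bdd U)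
    (hp : Heights U V p) {X Y M T₁ T₂ S : ℤ} (hc : IsRot (V ^ 13) X Y M) (hS0 : 0 < S)
    (hS : S ≤ V ^ 21) (hT₁ : |T₁| ≤ V ^ 21) (hT₂ : |T₂| ≤ V ^ 21) (hlen : B.length = A.length)
    (hn0 : 0 < A.length) (hnV : (A.length : ℤ) ≤ V) {ι : F} (hι : ι * ι = -1)
    (ht : TransCond A.length A B X Y M T₁ T₂ S ι)
    (h : ¬ Cong A B ((X + Y * I) / M) ((T₁ + T₂ * I) / S)) {R : ℕ} (hR : R ≤ p) :
    ∃ E : Finset ℕ, E.card ≤ A.length ∧ ∀ x < R,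
      print A.length A (M : F) (X + Y * ι) x ι = print A.length B (M : F) M x ι → x ∈ E := by
  have hM : (M : F) ≠ 0 := intCast_ne_zero_of_lt (p := p) hc.pos
    (hc.den_le.trans_lt (hp.pow_lt (by norm_num)))
  have hSF : (S : F) ≠ 0 := intCast_ne_zero_of_lt (p := p) hS0
    (hS.trans_lt (hp.pow_lt (by norm_num)))
  have hn : (A.length : F) ≠ 0 := by
    have := hp.pow_lt (k := 1) (by norm_num)
    rw [pow_one] at this
    exact_mod_cast intCast_ne_zero_of_lt (F := F) (p := p) (a := A.length) (by omega) (by omega)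
  have hred : Red (V ^ 21) ((T₁ + T₂ * I) / S) (fun ι : F => (T₁ + T₂ * ι) / S) :=
    ⟨S, T₁, T₂, hS0, hS, hT₁, hT₂, rfl, fun _ _ => rfl⟩
  obtain ⟨E, hE, hE'⟩ := exists_finset_of_ne
    (T := (A : Multiset Item).map fun d => (X + Y * ι) / M * d.red ι + (T₁ + T₂ * ι) / S)
    (T' := (B : Multiset Item).map fun d => (M : F) / M * d.red ι + 0)
    (fun he => h (congruent_of_map_eq hA hB hp hc.red hred (norm_rotation hc.pos hc.norm) hι
      (by simpa [div_self hM] using he)))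
    (n := A.length) (by simp) (by simp [hlen]) R
    (e := fun x => ((x : F) + sumRed B ι) / A.length) (by
      intro x hx y hy hxy
      have h1 : (x : F) = y := by
        have := (div_left_inj' hn).1 hxy
        exact add_right_cancel this
      have hx' : x < p := (Finset.mem_range.1 hx).trans_le hR
      have hy' : y < p := (Finset.mem_range.1 hy).trans_le hR
      exact CharP.natCast_injOn_Iio F p hx' hy' h1)
  refine ⟨E, hE, fun x hx hxe => hE' x hx ?_⟩
  rw [print_eq_prod hn hM (τ := (T₁ + T₂ * ι) / S) (c := sumRed B ι),
    print_eq_prod hn hM (τ := 0) (c := sumRed B ι), hlen] at hxe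
  · exact mul_left_cancel₀ (pow_ne_zero _ (mul_ne_zero hM hn)) hxe
  · ring
  · rw [TransCond] at ht
    field_simp
    linear_combination ht

end candidates

/-! ### A library of expressions -/

namespace Ex

section library

variable {V : Type}

instance : Add (Ex V) := ⟨.bin .add⟩
instance : Sub (Ex V) := ⟨.bin .sub⟩
instance : Mul (Ex V) := ⟨.bin .mul⟩
instance : Div (Ex V) := ⟨.bin .div⟩
instance : Mod (Ex V) := ⟨.bin .mod⟩
instance (k : ℕ) : OfNat (Ex V) k := ⟨.lit k⟩
instance : Neg (Ex V) := ⟨fun a => 0 - a⟩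

/-- The power with a fixed exponent. -/
def power (a : Ex V) : ℕ → Ex V
  | 0 => 1
  | k + 1 => power a k * a

/-- `1` if `a = b`, and `0` otherwise. -/
def eq' (a b : Ex V) : Ex V := .bin .eq a b

/-- `1` if `a < b`, and `0` otherwise. -/
def lt' (a b : Ex V) : Ex V := .bin .lt a b

/-- The least `z < N` with `b ≠ 0`, or `N` if there is none: `z` is increased `N` times unless
`b ≠ 0`. -/
def search (z : V) (N b : Ex V) : Ex V := .iter z N N 0 (.var z + eq' b 0)

/-- Whether `b ≠ 0` for some `z < N`. -/
def any (z : V) (N b : Ex V) : Ex V := lt' (search z N b) N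

/-- `re + p im`, where `re` and `im` are the residues modulo `p` of the parts of `(P + Q i) ^ k`. -/
def gaussPow (z p : V) (P Q k : Ex V) : Ex V :=
  .iter z k (.var p) 1
    ((((.var z % .var p) * P - (.var z / .var p) * Q) % .var p) +
      .var p * (((.var z % .var p) * Q + (.var z / .var p) * P) % .var p))

variable [DecidableEq V]

@[simp] lemma eval_var (v : V) (σ : V → ℤ) : (var v).eval σ = σ v := rfl
@[simp] lemma eval_add (a b : Ex V) (σ : V → ℤ) : (a + b).eval σ = a.eval σ + b.eval σ := rfl
@[simp] lemma eval_sub (a b : Ex V) (σ : V → ℤ) : (a - b).eval σ = a.eval σ - b.eval σ := rfl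
@[simp] lemma eval_mul (a b : Ex V) (σ : V → ℤ) : (a * b).eval σ = a.eval σ * b.eval σ := rfl
@[simp] lemma eval_div (a b : Ex V) (σ : V → ℤ) : (a / b).eval σ = a.eval σ / b.eval σ := rfl
@[simp] lemma eval_mod (a b : Ex V) (σ : V → ℤ) : (a % b).eval σ = a.eval σ % b.eval σ := rfl
@[simp] lemma eval_zero (σ : V → ℤ) : (0 : Ex V).eval σ = 0 := rfl
@[simp] lemma eval_one (σ : V → ℤ) : (1 : Ex V).eval σ = 1 := rfl
@[simp] lemma eval_ofNat (k : ℕ) [k.AtLeastTwo] (σ : V → ℤ) :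
    (ofNat(k) : Ex V).eval σ = ofNat(k) := rfl
@[simp] lemma eval_neg (a : Ex V) (σ : V → ℤ) : (-a).eval σ = -a.eval σ := zero_sub (a.eval σ)
@[simp] lemma eval_eq' (a b : Ex V) (σ : V → ℤ) :
    (eq' a b).eval σ = if a.eval σ = b.eval σ then 1 else 0 := rfl
@[simp] lemma eval_lt' (a b : Ex V) (σ : V → ℤ) :
    (lt' a b).eval σ = if a.eval σ < b.eval σ then 1 else 0 := rfl

lemma eval_iter (x : V) (N m a b : Ex V) (σ : V → ℤ) : (iter x N m a b).eval σ =
    (iterStep (fun y => b.eval (Function.update σ x y)) (m.eval σ))^[(N.eval σ).toNat]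
      (a.eval σ) := rfl

@[simp] lemma eval_power (a : Ex V) (k : ℕ) (σ : V → ℤ) : (power a k).eval σ = a.eval σ ^ k := by
  induction k with
  | zero => exact (pow_zero _).symm
  | succ k ih => rw [pow_succ, ← ih]; rfl

@[simp] lemma eval_rotRe (j : Fin 4) (a b : Ex V) (σ : V → ℤ) :
    (rotRe j a b).eval σ = rotRe j (a.eval σ) (b.eval σ) := by
  fin_cases j <;> simp [rotRe]

@[simp] lemma eval_rotIm (j : Fin 4) (a b : Ex V) (σ : V → ℤ) :
    (rotIm j a b).eval σ = rotIm j (a.eval σ) (b.eval σ) := by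
  fin_cases j <;> simp [rotIm]

/-- The value of a search lies between `0` and `N`, satisfies `b ≠ 0` unless it is `N`, and no
smaller number satisfies `b ≠ 0`. -/
lemma search_spec (z : V) (N b : Ex V) (σ : V → ℤ) :
    0 ≤ (search z N b).eval σ ∧ (search z N b).eval σ ≤ max (N.eval σ) 0 ∧
      ((search z N b).eval σ < N.eval σ →
        b.eval (Function.update σ z ((search z N b).eval σ)) ≠ 0) ∧
      ∀ y, 0 ≤ y → y < (search z N b).eval σ → b.eval (Function.update σ z y) = 0 := by
  set f : ℤ → ℤ := iterStep (fun y => y + if b.eval (Function.update σ z y) = 0 then 1 else 0)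
    (N.eval σ) with hf
  have he : (search z N b).eval σ = f^[(N.eval σ).toNat] 0 := by
    simp only [search, eval_iter, hf, eval_add, eval_var, eval_eq', eval_zero,
      Function.update_self]
    rfl
  have key : ∀ i : ℕ, i ≤ (N.eval σ).toNat → 0 ≤ f^[i] 0 ∧ f^[i] 0 ≤ i ∧
      (f^[i] 0 < i → b.eval (Function.update σ z (f^[i] 0)) ≠ 0) ∧
      ∀ y, 0 ≤ y → y < f^[i] 0 → b.eval (Function.update σ z y) = 0 := by
    intro i
    induction i with
    | zero => intro _; simp; intro y h1 h2; omega
    | succ i ih =>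
      intro hi
      obtain ⟨h1, h2, h3, h4⟩ := ih (by omega)
      rw [Function.iterate_succ_apply']
      set s := f^[i] 0
      have hlt : ∀ c : ℤ, 0 ≤ c → c ≤ s + 1 → c % (N.eval σ * N.eval σ + 1) = c := fun c h0 hc =>
        Int.emod_eq_of_lt h0 (by nlinarith [Int.toNat_of_nonneg (a := N.eval σ) (by omega)])
      by_cases hb : b.eval (Function.update σ z s) = 0
      · have hs : s = i := by
          by_contra hne
          exact h3 (by omega) hb
        have hfs : f s = s + 1 := by
          simp only [hf, iterStep, if_pos hb]; exact hlt _ (by omega) le_rfl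
        rw [hfs]
        refine ⟨by omega, by push_cast; omega, fun h => by push_cast at h; omega, fun y h0 hy => ?_⟩
        rcases eq_or_ne y s with rfl | hne
        · exact hb
        · exact h4 y h0 (by omega)
      · have hfs : f s = s := by
          simp only [hf, iterStep, if_neg hb, add_zero]; exact hlt _ h1 (by omega)
        rw [hfs]
        exact ⟨h1, by push_cast; omega, fun _ => hb, h4⟩
  obtain ⟨h1, h2, h3, h4⟩ := key _ le_rfl
  rw [he]
  exact ⟨h1, h2.trans (by omega), fun h => h3 (by omega), h4⟩

lemma search_lt {z : V} {N b : Ex V} {σ : V → ℤ}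
    (h : ∃ y, 0 ≤ y ∧ y < N.eval σ ∧ b.eval (Function.update σ z y) ≠ 0) :
    (search z N b).eval σ < N.eval σ ∧
      b.eval (Function.update σ z ((search z N b).eval σ)) ≠ 0 := by
  obtain ⟨y, h0, hy, hb⟩ := h
  obtain ⟨-, -, h3, h4⟩ := search_spec z N b σ
  have hlt : (search z N b).eval σ < N.eval σ := by
    by_contra hc
    exact hb (h4 y h0 (by omega))
  exact ⟨hlt, h3 hlt⟩

@[simp] lemma eval_any_ne_zero {z : V} {N b : Ex V} {σ : V → ℤ} :
    (any z N b).eval σ ≠ 0 ↔ ∃ y, 0 ≤ y ∧ y < N.eval σ ∧ b.eval (Function.update σ z y) ≠ 0 := by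
  have e : (any z N b).eval σ ≠ 0 ↔ (search z N b).eval σ < N.eval σ := by
    simp only [any, eval_lt']; split_ifs with h <;> simp [h]
  rw [e]
  refine ⟨fun h => ?_, fun h => (search_lt h).1⟩
  obtain ⟨h1, -, h3, -⟩ := search_spec z N b σ
  exact ⟨_, h1, h, h3 h⟩

lemma eval_gaussPow {z p : V} (hzp : p ≠ z) {P Q k : Ex V} {σ : V → ℤ} (hp : 1 < σ p)
    (hP : ∀ y, P.eval (Function.update σ z y) = P.eval σ)
    (hQ : ∀ y, Q.eval (Function.update σ z y) = Q.eval σ) :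
    (gaussPow z p P Q k).eval σ =
      ((⟨P.eval σ, Q.eval σ⟩ : GaussianInt) ^ (k.eval σ).toNat).re % σ p +
        σ p * (((⟨P.eval σ, Q.eval σ⟩ : GaussianInt) ^ (k.eval σ).toNat).im % σ p) := by
  set w : GaussianInt := ⟨P.eval σ, Q.eval σ⟩ with hw
  set q := σ p with hq
  have hq0 : 0 < q := by omega
  simp only [gaussPow, eval_iter, eval_one]
  generalize (k.eval σ).toNat = i
  induction i with
  | zero =>
    simp [Int.emod_eq_of_lt zero_le_one hp]
  | succ i ih =>
    rw [Function.iterate_succ_apply', ih]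
    have a1 := Int.emod_nonneg (w ^ i).re hq0.ne'
    have a2 := Int.emod_lt_of_pos (w ^ i).re hq0
    have e1 : ((w ^ i).re % q + q * ((w ^ i).im % q)) % q = (w ^ i).re % q := by
      rw [Int.add_mul_emod_self_left, Int.emod_emod_of_dvd _ dvd_rfl]
    have e2 : ((w ^ i).re % q + q * ((w ^ i).im % q)) / q = (w ^ i).im % q := by
      rw [Int.add_mul_ediv_left _ _ hq0.ne', Int.ediv_eq_zero_of_lt a1 a2, zero_add]
    simp only [iterStep, eval_add, eval_mul, eval_sub, eval_mod, eval_div, eval_var,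
      Function.update_self, Function.update_of_ne hzp, hP, hQ, ← hq, e1, e2]
    have e3 : ((w ^ i).re % q * P.eval σ - (w ^ i).im % q * Q.eval σ) % q
        = (w ^ (i + 1)).re % q := by
      rw [pow_succ, Zsqrtd.re_mul, hw]
      refine Int.ModEq.eq ?_
      have b1 : (w ^ i).re % q ≡ (w ^ i).re [ZMOD q] := Int.mod_modEq _ _
      have b2 : (w ^ i).im % q ≡ (w ^ i).im [ZMOD q] := Int.mod_modEq _ _
      have := (b1.mul_right (P.eval σ)).sub (b2.mul_right (Q.eval σ))
      rwa [neg_one_mul, neg_mul, ← sub_eq_add_neg]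
    have e4 : ((w ^ i).re % q * Q.eval σ + (w ^ i).im % q * P.eval σ) % q
        = (w ^ (i + 1)).im % q := by
      rw [pow_succ, Zsqrtd.im_mul, hw]
      refine Int.ModEq.eq ?_
      have b1 : (w ^ i).re % q ≡ (w ^ i).re [ZMOD q] := Int.mod_modEq _ _
      have b2 : (w ^ i).im % q ≡ (w ^ i).im [ZMOD q] := Int.mod_modEq _ _
      exact (b1.mul_right (Q.eval σ)).add (b2.mul_right (P.eval σ))
    rw [e3, e4]
    have c1 := Int.emod_nonneg (w ^ (i + 1)).re hq0.ne'
    have c2 := Int.emod_lt_of_pos (w ^ (i + 1)).re hq0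
    have c3 := Int.emod_nonneg (w ^ (i + 1)).im hq0.ne'
    have c4 := Int.emod_lt_of_pos (w ^ (i + 1)).im hq0
    exact Int.emod_eq_of_lt (by positivity) (by nlinarith)

lemma gaussPow_parts {z p : V} (hzp : p ≠ z) {P Q k : Ex V} {σ : V → ℤ} (hp : 1 < σ p)
    (hP : ∀ y, P.eval (Function.update σ z y) = P.eval σ)
    (hQ : ∀ y, Q.eval (Function.update σ z y) = Q.eval σ) :
    (gaussPow z p P Q k).eval σ % σ p =
        ((⟨P.eval σ, Q.eval σ⟩ : GaussianInt) ^ (k.eval σ).toNat).re % σ p ∧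
      (gaussPow z p P Q k).eval σ / σ p =
        ((⟨P.eval σ, Q.eval σ⟩ : GaussianInt) ^ (k.eval σ).toNat).im % σ p := by
  have hp0 : 0 < σ p := by omega
  rw [eval_gaussPow hzp hp hP hQ]
  constructor
  · rw [Int.add_mul_emod_self_left, Int.emod_emod_of_dvd _ dvd_rfl]
  · rw [Int.add_mul_ediv_left _ _ hp0.ne', Int.ediv_eq_zero_of_lt (Int.emod_nonneg _ hp0.ne')
      (Int.emod_lt_of_pos _ hp0), zero_add]

end library

end Ex

/-! ### The variables and the blocks of the program -/

/-- The variables of the program: the parameters; the modulus `p`; the evaluation point `r`, the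
number `m` of its possible values, the last coin and the loop test for the coin flips; the last
datum; the sums of the points and the products of the centred points, with the number `k` of the
factors; the candidate for the rotation and the candidates for the translation, all shifted to make
them nonnegative; the fingerprints; the answer; and bound variables. -/
inductive Var
  | n | u | p | r | m | coin | go
  | lab | xn | xd | yn | yd
  | sax | say | sbx | sby | k | qax | qay | qbx | qby
  | sx | sy | sm | tx (j : Fin 4) | ty (j : Fin 4) | ts (j : Fin 4)
  | fx (j : Fin 4) | fy (j : Fin 4) | gx | gy
  | verdict | out (i : Fin 8)
  | i₁ | i₂ | i₃ | inv | pow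
  deriving DecidableEq, Fintype

namespace Prog

open Ex

/-- A variable as an expression. -/
abbrev v (x : Var) : Ex Var := .var x

/-- The base `2 n U` of all heights. -/
def base : Ex Var := 2 * v .n * v .u

/-- The height for the modulus: see `GoodPrime`. It bounds the products of two rotations of height
`base ^ 13`. -/
def heightP : Ex Var := 2 * power base 26

/-- Whether `p` is a good prime above `base ^ 175`. -/
def goodE : Ex Var :=
  lt' (power base 175) (v .p) *
  eq' (any .i₁ (v .p) (lt' 1 (v .i₁) * eq' (v .p % v .i₁) 0)) 0 *
  eq' (any .i₁ (2 * heightP + 1) (any .i₂ (2 * heightP + 1) (any .i₃ (v .n + 1)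
    (eq' (eq' ((v .i₁ - heightP) * (v .i₂ - heightP) *
        (power (v .i₁ - heightP) 2 - power (v .i₂ - heightP) 2)) 0) 0 *
      lt' 0 (v .i₃) *
      eq' (gaussPow .pow .p (v .i₁ - heightP) (v .i₂ - heightP) (v .i₃) / v .p) 0)))) 0

/-- The bound for the search for `p`: see `primeBound`. -/
def boundE : Ex Var :=
  8 * power
    (power base 175 + 2 * power heightP 2 * power (v .n) 2 * power (2 * heightP + 1) 2 + 1) 2

/-- The first block: it finds the modulus and sets up the products. -/
def start : Var → Ex Var
  | .p => search .p (boundE + 1) goodE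
  | .qax | .qbx | .fx _ | .gx | .m | .go => 1
  | x => v x

/-- The inverse of a variable modulo `p`. -/
def invE (x : Var) : Ex Var := search .inv (v .p) (eq' (v .inv * v x % v .p) 1)

/-- The abscissa of the last point modulo `p`. -/
def ptX : Ex Var := v .xn * invE .xd

/-- The ordinate of the last point modulo `p`. -/
def ptY : Ex Var := v .yn * invE .yd

/-- Whether the last point belongs to `A`. -/
def isA : Ex Var := eq' (v .lab) 1

/-- Whether the last point belongs to `B`. -/
def isB : Ex Var := eq' (v .lab) 2

/-- The first pass: the sums of the points. -/
def sums : Var → Ex Var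
  | .sax => (v .sax + isA * ptX) % v .p
  | .say => (v .say + isA * ptY) % v .p
  | .sbx => (v .sbx + isB * ptX) % v .p
  | .sby => (v .sby + isB * ptY) % v .p
  | x => v x

/-- The abscissa of the last point, centred as a point of `A`. -/
def ctrAX : Ex Var := v .n * ptX - v .sax

/-- The ordinate of the last point, centred as a point of `A`. -/
def ctrAY : Ex Var := v .n * ptY - v .say

/-- The abscissa of the last point, centred as a point of `B`. -/
def ctrBX : Ex Var := v .n * ptX - v .sbx

/-- The ordinate of the last point, centred as a point of `B`. -/
def ctrBY : Ex Var := v .n * ptY - v .sby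

/-- The real part of `x + y i`, multiplied by `a + b i` if the flag `c` is set. -/
def stepX (c a b : Ex Var) (x y : Var) : Ex Var :=
  (c * (v x * a - v y * b) + (1 - c) * v x) % v .p

/-- The imaginary part of `x + y i`, multiplied by `a + b i` if the flag `c` is set. -/
def stepY (c a b : Ex Var) (x y : Var) : Ex Var :=
  (c * (v x * b + v y * a) + (1 - c) * v y) % v .p

/-- Whether the last point belongs to `A` and is centred to a point of nonzero norm. -/
def useA : Ex Var := isA * eq' (eq' ((ctrAX * ctrAX + ctrAY * ctrAY) % v .p) 0) 0

/-- Whether the last point belongs to `B` and is centred to a point of nonzero norm. -/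
def useB : Ex Var := isB * eq' (eq' ((ctrBX * ctrBX + ctrBY * ctrBY) % v .p) 0) 0

/-- The second pass: the products of the centred points. -/
def prods : Var → Ex Var
  | .k => (v .k + useA) % v .p
  | .qax => stepX useA ctrAX ctrAY .qax .qay
  | .qay => stepY useA ctrAX ctrAY .qax .qay
  | .qbx => stepX useB ctrBX ctrBY .qbx .qby
  | .qby => stepY useB ctrBX ctrBY .qbx .qby
  | x => v x

/-- The real part of the candidate for the rotation, times its denominator. The search variable is
natural, hence the shift. -/
def rotX : Ex Var := v .sx - power base 12

/-- The imaginary part of the candidate for the rotation, times its denominator. -/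
def rotY : Ex Var := v .sy - power base 12

/-- `(X + Y i) ^ k`, in the packed form of `Ex.gaussPow`. -/
def rotPow : Ex Var := gaussPow .pow .p rotX rotY (v .k)

/-- `M ^ k`, in the packed form of `Ex.gaussPow`. -/
def denPow : Ex Var := gaussPow .pow .p (v .sm) 0 (v .k)

/-- Whether the candidate is a rotation with `(X + Y i) ^ k Q_A = M ^ k Q_B`. -/
def rotCond : Ex Var :=
  lt' 0 (v .sm) * eq' (power rotX 2 + power rotY 2) (power (v .sm) 2) *
  eq' (((rotPow % v .p) * v .qax - (rotPow / v .p) * v .qay - (denPow % v .p) * v .qbx) % v .p) 0 *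
  eq' (((rotPow % v .p) * v .qay + (rotPow / v .p) * v .qax - (denPow % v .p) * v .qby) % v .p) 0

/-- The range of the candidates for the parts of the rotation. -/
def rotRange : Ex Var := 2 * power base 12 + 1

/-- The range of the candidates for the denominator of the rotation. -/
def denRange : Ex Var := power base 12 + 1

/-- The search for the real part of the rotation: the first number that can be completed to a
rotation. -/
def findX : Var → Ex Var
  | .sx => search .sx rotRange (any .sy rotRange (any .sm denRange rotCond))
  | x => v x

/-- The search for the imaginary part of the rotation, once `.sx` holds the real part. -/
def findY : Var → Ex Var
  | .sy => search .sy rotRange (any .sm denRange rotCond)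
  | x => v x

/-- The search for the denominator of the rotation, once its parts are known. -/
def findM : Var → Ex Var
  | .sm => search .sm denRange rotCond
  | x => v x

/-- The real part of the candidate for the translation, times its denominator. -/
def transX (j : Fin 4) : Ex Var := v (.tx j) - power base 19

/-- The imaginary part of the candidate for the translation, times its denominator. -/
def transY (j : Fin 4) : Ex Var := v (.ty j) - power base 19

/-- The real part of the candidate for the rotation after `j` quarter turns. -/
def turnX (j : Fin 4) : Ex Var := rotRe j rotX rotY

/-- The imaginary part of the candidate for the rotation after `j` quarter turns. -/
def turnY (j : Fin 4) : Ex Var := rotIm j rotX rotY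

/-- Whether the candidate for the translation belongs to the rotation after `j` quarter turns. -/
def transCond (j : Fin 4) : Ex Var :=
  lt' 0 (v (.ts j)) *
  eq' ((v (.ts j) * (v .sm * v .sbx - (turnX j * v .sax - turnY j * v .say)) -
    v .n * v .sm * transX j) % v .p) 0 *
  eq' ((v (.ts j) * (v .sm * v .sby - (turnX j * v .say + turnY j * v .sax)) -
    v .n * v .sm * transY j) % v .p) 0

/-- The range of the candidates for the parts of the translation. -/
def transRange : Ex Var := 2 * power base 19 + 1

/-- The range of the candidates for the denominator of the translation. -/
def transDenRange : Ex Var := power base 19 + 1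

/-- The search for the real part of each translation: the first number that can be completed to a
translation. -/
def findTX : Var → Ex Var
  | .tx j => search (.tx j) transRange
      (any (.ty j) transRange (any (.ts j) transDenRange (transCond j)))
  | x => v x

/-- The search for the imaginary part of each translation, once the real part is known. -/
def findTY : Var → Ex Var
  | .ty j => search (.ty j) transRange (any (.ts j) transDenRange (transCond j))
  | x => v x

/-- The search for the denominator of each translation, once its parts are known. -/
def findTS : Var → Ex Var
  | .ts j => search (.ts j) transDenRange (transCond j)
  | x => v x

/-- The use of a coin for the evaluation point. -/
def useCoin : Var → Ex Var
  | .r => 2 * v .r + v .coin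
  | .m => 2 * v .m
  | .go => lt' (2 * v .m) (4 * power (v .n) 2)
  | x => v x

/-- The real part of `M r - i ^ j (X + Y i) a'` for the centred last point `a'`. -/
def printAX (j : Fin 4) : Ex Var := v .sm * v .r - (turnX j * ctrAX - turnY j * ctrAY)

/-- The imaginary part of `M r - i ^ j (X + Y i) a'` for the centred last point `a'`. -/
def printAY (j : Fin 4) : Ex Var := -(turnX j * ctrAY + turnY j * ctrAX)

/-- The real part of `M r - M b'` for the centred last point `b'`. -/
def printBX : Ex Var := v .sm * v .r - v .sm * ctrBX

/-- The imaginary part of `M r - M b'` for the centred last point `b'`. -/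
def printBY : Ex Var := -(v .sm * ctrBY)

/-- The third pass: the fingerprints. -/
def prints : Var → Ex Var
  | .fx j => stepX isA (printAX j) (printAY j) (.fx j) (.fy j)
  | .fy j => stepY isA (printAX j) (printAY j) (.fx j) (.fy j)
  | .gx => stepX isB printBX printBY .gx .gy
  | .gy => stepY isB printBX printBY .gx .gy
  | x => v x

/-- Whether the rotation after `j` quarter turns is accepted. -/
def accept (j : Fin 4) : Ex Var :=
  rotCond * transCond j * eq' (v (.fx j)) (v .gx) * eq' (v (.fy j)) (v .gy)

/-- The answer that belongs to the rotation after `j` quarter turns. -/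
def answer (j : Fin 4) : Fin 8 → Ex Var :=
  ![turnX j, v .sm, turnY j, v .sm, transX j, v (.ts j), transY j, v (.ts j)]

/-- The last block: the answer for the first rotation that is accepted. -/
def finish : Var → Ex Var
  | .verdict => lt' 0 (accept 0 + accept 1 + accept 2 + accept 3)
  | .out i => accept 0 * answer 0 i + (1 - accept 0) * (accept 1 * answer 1 i +
      (1 - accept 1) * (accept 2 * answer 2 i + (1 - accept 2) * answer 3 i))
  | x => v x

end Prog

open Ex Prog

/-! ### The choice of the modulus -/

lemma eval_base {σ : Var → ℤ} {n U : ℕ} (hn : σ .n = n) (hu : σ .u = U) :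
    base.eval σ = ((2 * n * U : ℕ) : ℤ) := by
  simp [base, hn, hu]

lemma eval_heightP {σ : Var → ℤ} {n U : ℕ} (hn : σ .n = n) (hu : σ .u = U) :
    heightP.eval σ = ((2 * (2 * n * U) ^ 26 : ℕ) : ℤ) := by
  simp [heightP, eval_base hn hu]

lemma eval_boundE {σ : Var → ℤ} {n U : ℕ} (hn : σ .n = n) (hu : σ .u = U) :
    boundE.eval σ = primeBound n (2 * (2 * n * U) ^ 26) ((2 * n * U) ^ 175) := by
  simp [boundE, primeBound, eval_base hn hu, eval_heightP hn hu, hn]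

lemma ite_one_zero_ne_zero {P : Prop} [Decidable P] : (if P then (1 : ℤ) else 0) ≠ 0 ↔ P := by
  split_ifs with h <;> simp [h]

lemma ite_one_zero_eq_zero {P : Prop} [Decidable P] : (if P then (1 : ℤ) else 0) = 0 ↔ ¬ P := by
  split_ifs with h <;> simp [h]

lemma eval_goodE {σ : Var → ℤ} {n U p : ℕ} (hn : σ .n = n) (hu : σ .u = U) (hp : σ .p = p)
    (h2 : 1 ≤ 2 * n * U) :
    goodE.eval σ ≠ 0 ↔ (2 * n * U) ^ 175 < p ∧ GoodPrime n (2 * (2 * n * U) ^ 26) p := by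
  set H := 2 * (2 * n * U) ^ 26 with hH
  have e1 : (lt' (power base 175) (v .p)).eval σ ≠ 0 ↔ (2 * n * U) ^ 175 < p := by
    rw [eval_lt', ite_one_zero_ne_zero, eval_power, eval_base hn hu, eval_var, hp]
    exact_mod_cast Iff.rfl
  rw [goodE, eval_mul, eval_mul, mul_ne_zero_iff, mul_ne_zero_iff, e1, and_assoc]
  refine and_congr_right fun hlt => ?_
  have hp1 : 1 < p := lt_of_le_of_lt (Nat.one_le_pow _ _ h2) hlt
  have e2 : (eq' (any .i₁ (v .p) (lt' 1 (v .i₁) * eq' (v .p % v .i₁) 0)) 0).eval σ ≠ 0 ↔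
      p.Prime := by
    rw [eval_eq', ite_one_zero_ne_zero, eval_zero, ← not_iff_not, ← ne_eq, eval_any_ne_zero]
    constructor
    · rintro ⟨y, h0, hy, hb⟩ hpr
      simp only [eval_mul, eval_lt', eval_eq', eval_mod, eval_var, Function.update_self, eval_one,
        eval_zero, Function.update_of_ne (show Var.p ≠ .i₁ by decide), hp, mul_ne_zero_iff,
        ite_one_zero_ne_zero] at hb hy
      obtain ⟨c, rfl⟩ := Int.eq_ofNat_of_zero_le h0
      have hd : c ∣ p := by exact_mod_cast Int.dvd_of_emod_eq_zero hb.2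
      have := (Nat.dvd_prime hpr).1 hd
      omega
    · intro hnp
      obtain ⟨c, hc, h1, h3⟩ := (Nat.not_prime_iff_exists_dvd_ne (by omega)).1 hnp
      have hc0 : 0 < c := Nat.pos_of_dvd_of_pos hc (by omega)
      have hcp : c < p := lt_of_le_of_ne (Nat.le_of_dvd (by omega) hc) h3
      refine ⟨c, by omega, by simpa [hp] using hcp, ?_⟩
      simp only [eval_mul, eval_lt', eval_eq', eval_mod, eval_var, Function.update_self, eval_one,
        eval_zero, Function.update_of_ne (show Var.p ≠ .i₁ by decide), hp, mul_ne_zero_iff,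
        ite_one_zero_ne_zero]
      exact ⟨by omega, by exact_mod_cast Nat.mod_eq_zero_of_dvd hc⟩
  have e3 : ∀ a b c : ℤ, 0 ≤ c → (
      (eq' (eq' ((v .i₁ - heightP) * (v .i₂ - heightP) *
        (power (v .i₁ - heightP) 2 - power (v .i₂ - heightP) 2)) 0) 0 *
      lt' 0 (v .i₃) *
      eq' (gaussPow .pow .p (v .i₁ - heightP) (v .i₂ - heightP) (v .i₃) / v .p) 0).eval
        (Function.update (Function.update (Function.update σ .i₁ a) .i₂ b) .i₃ c) ≠ 0 ↔
      (a - H) * (b - H) * ((a - H) ^ 2 - (b - H) ^ 2) ≠ 0 ∧ 0 < c ∧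
        (p : ℤ) ∣ ((⟨a - H, b - H⟩ : GaussianInt) ^ c.toNat).im) := by
    intro a b c hc
    set τ := Function.update (Function.update (Function.update σ .i₁ a) .i₂ b) .i₃ c with hτ
    have t1 : τ .i₁ = a := by simp [hτ]
    have t2 : τ .i₂ = b := by simp [hτ]
    have t3 : τ .i₃ = c := by simp [hτ]
    have tp : τ .p = p := by simp [hτ, hp]
    have tn : τ .n = n := by simp [hτ, hn]
    have tu : τ .u = U := by simp [hτ, hu]
    have th : ∀ y, heightP.eval (Function.update τ .pow y) = H := fun y =>
      eval_heightP (by simpa using tn) (by simpa using tu)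
    have th' : heightP.eval τ = H := eval_heightP tn tu
    have g := (gaussPow_parts (z := .pow) (p := .p) (P := v .i₁ - heightP) (Q := v .i₂ - heightP)
      (k := v .i₃) (σ := τ) (by decide) (by rw [tp]; exact_mod_cast hp1)
      (fun y => by rw [eval_sub, eval_sub, th, th']; simp)
      (fun y => by rw [eval_sub, eval_sub, th, th']; simp)).2
    rw [tp] at g
    rw [eval_mul, eval_mul, mul_ne_zero_iff, mul_ne_zero_iff, eval_eq', ite_one_zero_ne_zero,
      eval_eq', eval_zero, ite_one_zero_eq_zero, eval_lt', ite_one_zero_ne_zero, eval_eq',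
      ite_one_zero_ne_zero, eval_div, eval_var Var.p, tp, g, eval_zero, and_assoc]
    simp only [eval_mul, eval_sub, eval_var, eval_power, th', t1, t2, t3]
    exact and_congr_right fun _ => and_congr_right fun _ => Int.dvd_iff_emod_eq_zero.symm
  rw [and_congr e2 (?_ : _ ↔ ∀ P Q : ℤ, |P| ≤ H → |Q| ≤ H → P * Q * (P ^ 2 - Q ^ 2) ≠ 0 → ∀ k : ℕ,
    1 ≤ k → k ≤ n → ¬ (p : ℤ) ∣ ((⟨P, Q⟩ : GaussianInt) ^ k).im)]
  · exact ⟨fun h => ⟨h.1, h.2⟩, fun h => ⟨h.1, h.2⟩⟩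
  rw [eval_eq', ite_one_zero_ne_zero, eval_zero, ← not_iff_not, ← ne_eq, eval_any_ne_zero]
  have r1 : (2 * heightP + 1).eval σ = 2 * H + 1 := by simp [eval_heightP hn hu, hH]
  have r2 : ∀ a, (2 * heightP + 1).eval (Function.update σ .i₁ a) = 2 * H + 1 := fun a => by
    rw [eval_add, eval_mul, eval_heightP (n := n) (U := U) (by simpa using hn) (by simpa using hu)]
    simp [hH]
  have r3 : ∀ a b, (v .n + 1).eval (Function.update (Function.update σ .i₁ a) .i₂ b) = n + 1 :=
    fun a b => by simp [hn]
  simp only [eval_any_ne_zero, r1, r2, r3]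
  constructor
  · rintro ⟨a, ha, ha', b, hb, hb', c, hc, hc', h⟩ hall
    obtain ⟨h1, h2, h3⟩ := (e3 a b c hc).1 h
    exact hall _ _ (abs_le.2 ⟨by omega, by omega⟩) (abs_le.2 ⟨by omega, by omega⟩) h1 c.toNat
      (by omega) (by omega) h3
  · intro h
    push Not at h
    obtain ⟨P, Q, hP, hQ, hne, k, hk, hkn, hd⟩ := h
    rw [abs_le] at hP hQ
    refine ⟨P + H, by omega, by omega, Q + H, by omega, by omega, k, by omega, by omega,
      (e3 _ _ _ (by omega)).2 ?_⟩
    simp only [add_sub_cancel_right, Int.toNat_natCast]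
    exact ⟨hne, by omega, hd⟩

/-- The modulus that is found by the first block. -/
lemma exists_start_p {σ : Var → ℤ} {n U : ℕ} (hn : σ .n = n) (hu : σ .u = U)
    (h2 : 1 ≤ 2 * n * U) : ∃ p : ℕ, blockVal start σ .p = p ∧ (2 * n * U) ^ 175 < p ∧
      GoodPrime n (2 * (2 * n * U) ^ 26) p := by
  have hH : 1 ≤ 2 * (2 * n * U) ^ 26 := by have := Nat.one_le_pow 26 _ h2; omega
  have hg : ∀ q : ℕ, goodE.eval (Function.update σ .p (q : ℤ)) ≠ 0 ↔
      (2 * n * U) ^ 175 < q ∧ GoodPrime n (2 * (2 * n * U) ^ 26) q := fun q =>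
    eval_goodE (by rwa [Function.update_of_ne (by decide)])
      (by rwa [Function.update_of_ne (by decide)]) (Function.update_self _ _ _) h2
  have hb := eval_boundE hn hu
  generalize 2 * (2 * n * U) ^ 26 = H at *
  generalize (2 * n * U) ^ 175 = L at *
  obtain ⟨q, h1, h3, h4⟩ := exists_goodPrime n L hH
  have hs := (search_lt (z := Var.p) (N := boundE + 1) (b := goodE) (σ := σ)
    ⟨q, by omega, by rw [eval_add, hb, eval_one]; omega, (hg q).2 ⟨h3, h1⟩⟩).2
  obtain ⟨p, hp⟩ := Int.eq_ofNat_of_zero_le (search_spec Var.p (boundE + 1) goodE σ).1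
  rw [hp] at hs
  exact ⟨p, hp, (hg p).1 hs⟩

/-! ### The contents of the variables after each pass -/

section passes

/-- The variables after the datum `d` was read. -/
abbrev loadItem (d : Item) (σ : Var → ℤ) : Var → ℤ := load .lab .xn .xd .yn .yd d σ

/-- The effect of a pass on the variables. -/
abbrev passItems (f : Var → Ex Var) (L : List Item) (σ : Var → ℤ) : Var → ℤ :=
  passVal .lab .xn .xd .yn .yd f L σ

/-- The variables that receive a datum. -/
def itemVars : Finset Var := {.lab, .xn, .xd, .yn, .yd}

lemma loadItem_of_notMem (d : Item) (σ : Var → ℤ) {x : Var} (hx : x ∉ itemVars) :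
    loadItem d σ x = σ x := by
  simp only [itemVars, Finset.mem_insert, Finset.mem_singleton, not_or] at hx
  simp [load, hx]

lemma passItems_of_notMem {f : Var → Ex Var} {x : Var} (hf : f x = v x) (hx : x ∉ itemVars)
    (L : List Item) (σ : Var → ℤ) : passItems f L σ x = σ x := by
  induction L generalizing σ with
  | nil =>
    have : x ≠ .lab := by rintro rfl; exact hx (by decide)
    simp [passVal, this]
  | cons d L ih =>
    refine (ih _).trans ?_
    rw [blockVal, hf, eval_var]
    exact loadItem_of_notMem d σ hx

/-- Induction over the data of a pass. -/
lemma passItems_induction {f : Var → Ex Var} {P : List Item → (Var → ℤ) → Prop} {L : List Item}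
    (hstep : ∀ T d σ, d ∈ L → P T σ → P (T ++ [d]) (blockVal f (loadItem d σ)))
    (hend : ∀ T σ, P T σ → P T (Function.update σ .lab 0)) {σ : Var → ℤ} (h : P [] σ) :
    P L (passItems f L σ) := by
  have key : ∀ (T' T : List Item) (σ : Var → ℤ), (∀ d ∈ T', d ∈ L) → P T σ →
      P (T ++ T') (passItems f T' σ) := by
    intro T'
    induction T' with
    | nil => intro T σ _ h; rw [List.append_nil]; exact hend _ _ h
    | cons d T' ih =>
      intro T σ hT h
      have := ih (T ++ [d]) _ (fun e he => hT e (by simp [he])) (hstep T d σ (hT d (by simp)) h)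
      rwa [List.append_assoc] at this
  exact key L [] σ (fun _ => id) h

/-- The block `f` keeps `p` and replaces other variables by residues modulo `p` only. -/
def Reduces (f : Var → Ex Var) : Prop :=
  f .p = v .p ∧ ∀ x, f x = v x ∨ ∃ e, f x = e % v .p

lemma reduces_sums : Reduces sums :=
  ⟨rfl, fun x => by cases x <;> first | exact .inl rfl | exact .inr ⟨_, rfl⟩⟩

lemma reduces_prods : Reduces prods :=
  ⟨rfl, fun x => by cases x <;> first | exact .inl rfl | exact .inr ⟨_, rfl⟩⟩

lemma reduces_prints : Reduces prints :=
  ⟨rfl, fun x => by cases x <;> first | exact .inl rfl | exact .inr ⟨_, rfl⟩⟩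

lemma Reduces.bdd {f : Var → Ex Var} (hf : Reduces f) {K : ℤ} (hK : 2 ≤ K) {p : ℤ} (hp0 : 0 < p)
    (hpK : p ≤ K) {d : Item} (hd : d.Bdd K) {σ : Var → ℤ} (h : Bdd K σ ∧ σ .p = p) :
    Bdd K (blockVal f (loadItem d σ)) ∧ blockVal f (loadItem d σ) .p = p := by
  have hp : loadItem d σ .p = p := (loadItem_of_notMem d σ (by decide)).trans h.2
  refine ⟨fun x => ?_, by rw [blockVal, hf.1, eval_var, hp]⟩
  have hb : Bdd K (loadItem d σ) := load_bdd h.1 hd hK _ _ _ _ _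
  rcases hf.2 x with e | ⟨e, he⟩
  · rw [blockVal, e]; exact hb x
  · rw [blockVal, he, eval_mod, eval_var, hp, abs_of_nonneg (Int.emod_nonneg _ hp0.ne')]
    exact (Int.emod_lt_of_pos _ hp0).le.trans hpK

lemma Reduces.passItems_bdd {f : Var → Ex Var} (hf : Reduces f) {K : ℤ} (hK : 2 ≤ K) {p : ℤ}
    (hp0 : 0 < p) (hpK : p ≤ K) {L : List Item} (hL : ∀ d ∈ L, d.Bdd K) {σ : Var → ℤ}
    (h : Bdd K σ ∧ σ .p = p) : Bdd K (passItems f L σ) ∧ passItems f L σ .p = p :=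
  passItems_induction (P := fun _ σ => Bdd K σ ∧ σ .p = p)
    (fun _ d _ hd h => hf.bdd hK hp0 hpK (hL d hd) h)
    (fun _ σ h => ⟨update_bdd h.1 _ (by simp; omega), by simpa using h.2⟩) h

end passes

section semantics

variable {F : Type} [Field F] {p : ℕ} [CharP F p] {n U : ℕ}

lemma intCast_emod (a : ℤ) : ((a % p : ℤ) : F) = a :=
  (CharP.intCast_eq_intCast F p).2 (Int.mod_modEq a p)

lemma eval_invE {τ : Var → ℤ} (hp : τ .p = p) (hpr : p.Prime) {x : Var} (hx : x ≠ .inv)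
    (h0 : 0 < τ x) (hlt : τ x < p) : ((invE x).eval τ : F) = (τ x : F)⁻¹ := by
  have hp1 : (1 : ℤ) < p := by exact_mod_cast hpr.one_lt
  have hb : ∀ y : ℤ, (eq' (v .inv * v x % v .p) 1).eval (Function.update τ .inv y) ≠ 0 ↔
      y * τ x % p = 1 := by
    intro y
    simp [Function.update_of_ne hx, hp]
  have hcop : IsCoprime (τ x) p := by
    obtain ⟨c, hc⟩ := Int.eq_ofNat_of_zero_le h0.le
    rw [hc] at h0 hlt ⊢
    refine Nat.isCoprime_iff_coprime.2 (Nat.Coprime.symm ((Nat.Prime.coprime_iff_not_dvd hpr).2 ?_))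
    intro hd
    have := Nat.le_of_dvd (by omega) hd
    omega
  obtain ⟨a, b, hab⟩ := hcop
  have hs := (search_lt (z := Var.inv) (N := v .p) (b := eq' (v .inv * v x % v .p) 1) (σ := τ)
    ⟨a % p, Int.emod_nonneg _ (by omega), by
      rw [eval_var, hp]; exact Int.emod_lt_of_pos _ (by omega), (hb _).2 (by
        rw [Int.mul_emod, Int.emod_emod_of_dvd _ dvd_rfl, ← Int.mul_emod,
          eq_sub_of_add_eq hab, Int.sub_mul_emod_self_right,
          Int.emod_eq_of_lt zero_le_one hp1])⟩).2
  have h1 := (hb _).1 hs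
  have h2 : (((search Var.inv (v .p) (eq' (v .inv * v x % v .p) 1)).eval τ : ℤ) : F) * τ x = 1 := by
    rw [← Int.cast_mul, ← intCast_emod (p := p), h1, Int.cast_one]
  exact eq_inv_of_mul_eq_one_left h2

lemma eval_pt {d : Item} {σ : Var → ℤ} (hp : σ .p = p) (hpr : p.Prime) {K : ℤ} (hd : d.Bdd K)
    (hK : K < p) (ι : F) :
    (ptX.eval (loadItem d σ) : F) + ptY.eval (loadItem d σ) * ι = d.red ι := by
  have hp' : loadItem d σ .p = p := (loadItem_of_notMem d σ (by decide)).trans hp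
  have e1 : loadItem d σ .xn = d.2.1.num := by simp [load]
  have e2 : loadItem d σ .xd = d.2.1.den := by simp [load]
  have e3 : loadItem d σ .yn = d.2.2.num := by simp [load]
  have e4 : loadItem d σ .yd = d.2.2.den := by simp [load]
  obtain ⟨-, h2, -, h4⟩ := hd
  have i1 := eval_invE (F := F) hp' hpr (x := .xd) (by decide)
    (by rw [e2]; exact_mod_cast d.2.1.den_pos) (by rw [e2]; omega)
  have i2 := eval_invE (F := F) hp' hpr (x := .yd) (by decide)
    (by rw [e4]; exact_mod_cast d.2.2.den_pos) (by rw [e4]; omega)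
  simp only [ptX, ptY, eval_mul, eval_var, Int.cast_mul, i1, i2, e1, e2, e3, e4, Item.red,
    div_eq_mul_inv, Int.cast_natCast]

/-- The part of the stream with the label `l`. -/
def labelled (l : Label) (L : List Item) : List Item := L.filter fun d => d.1 = l

lemma labelled_append (l : Label) (T : List Item) (d : Item) :
    labelled l (T ++ [d]) = labelled l T ++ if d.1 = l then [d] else [] := by
  unfold labelled
  rw [List.filter_append]
  congr 1
  by_cases h : d.1 = l <;> simp [h]

lemma eval_isA (d : Item) (σ : Var → ℤ) :
    isA.eval (loadItem d σ) = if d.1 = .A then 1 else 0 := by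
  cases h : d.1 <;> simp [isA, load, h, Label.code]

lemma eval_isB (d : Item) (σ : Var → ℤ) :
    isB.eval (loadItem d σ) = if d.1 = .B then 1 else 0 := by
  cases h : d.1 <;> simp [isB, load, h, Label.code]

lemma sumRed_labelled_append (l : Label) (T : List Item) (d : Item) (ι : F) :
    sumRed (labelled l (T ++ [d])) ι =
      sumRed (labelled l T) ι + if d.1 = l then d.red ι else 0 := by
  rw [labelled_append, sumRed, List.map_append, List.sum_append, sumRed]
  split_ifs <;> simp

lemma prod_labelled_append (l : Label) (T : List Item) (d : Item) (g : Item → F) :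
    ((labelled l (T ++ [d])).map g).prod =
      ((labelled l T).map g).prod * if d.1 = l then g d else 1 := by
  rw [labelled_append, List.map_append, List.prod_append]
  split_ifs <;> simp

variable (F p n U) in
/-- The variables contain the parameters, and the sums of the points of `T`. -/
structure HasSums (T : List Item) (σ : Var → ℤ) : Prop where
  val_n : σ .n = n
  val_u : σ .u = U
  val_p : σ .p = p
  sum_a : ∀ ι : F, ι * ι = -1 → (σ .sax : F) + σ .say * ι = sumRed (labelled .A T) ι
  sum_b : ∀ ι : F, ι * ι = -1 → (σ .sbx : F) + σ .sby * ι = sumRed (labelled .B T) ι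

lemma blockVal_self {f : Var → Ex Var} {x : Var} (hf : f x = v x) (σ : Var → ℤ) :
    blockVal f σ x = σ x := by
  rw [blockVal, hf, eval_var]

lemma step_of_notMem {f : Var → Ex Var} {x : Var} (hf : f x = v x) (hx : x ∉ itemVars) (d : Item)
    (σ : Var → ℤ) : blockVal f (loadItem d σ) x = σ x := by
  rw [blockVal_self hf, loadItem_of_notMem d σ hx]

lemma hasSums_passItems {L : List Item} (hpr : p.Prime) {K : ℤ} (hL : ∀ d ∈ L, d.Bdd K)
    (hK : K < p) {σ : Var → ℤ} (h : HasSums F p n U [] σ) :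
    HasSums F p n U L (passItems sums L σ) := by
  refine passItems_induction (P := HasSums F p n U) ?_ ?_ h
  · intro T d σ hd h
    have hp' : loadItem d σ .p = p := (loadItem_of_notMem d σ (by decide)).trans h.val_p
    have hpt := fun ι : F => eval_pt h.val_p hpr (hL d hd) hK ι
    refine ⟨?_, ?_, ?_, fun ι hι => ?_, fun ι hι => ?_⟩
    · exact (step_of_notMem rfl (by decide) d σ).trans h.val_n
    · exact (step_of_notMem rfl (by decide) d σ).trans h.val_u
    · exact (step_of_notMem rfl (by decide) d σ).trans h.val_p
    · rw [sumRed_labelled_append, ← h.sum_a ι hι, ← hpt ι]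
      simp only [blockVal, sums, eval_mod, eval_add, eval_mul, eval_var, hp', intCast_emod,
        eval_isA, loadItem_of_notMem d σ (show Var.sax ∉ itemVars by decide),
        loadItem_of_notMem d σ (show Var.say ∉ itemVars by decide)]
      split_ifs <;> push_cast <;> ring
    · rw [sumRed_labelled_append, ← h.sum_b ι hι, ← hpt ι]
      simp only [blockVal, sums, eval_mod, eval_add, eval_mul, eval_var, hp', intCast_emod,
        eval_isB, loadItem_of_notMem d σ (show Var.sbx ∉ itemVars by decide),
        loadItem_of_notMem d σ (show Var.sby ∉ itemVars by decide)]
      split_ifs <;> push_cast <;> ring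
  · intro T σ h
    exact ⟨by simpa using h.val_n, by simpa using h.val_u, by simpa using h.val_p,
      by simpa using h.sum_a, by simpa using h.sum_b⟩

lemma eval_step (c a b : Ex Var) (x y : Var) {τ : Var → ℤ} (hp : τ .p = p) {ι : F}
    (hι : ι * ι = -1) :
    ((stepX c a b x y).eval τ : F) + (stepY c a b x y).eval τ * ι =
      c.eval τ * ((τ x + τ y * ι) * (a.eval τ + b.eval τ * ι)) +
        (1 - c.eval τ) * (τ x + τ y * ι) := by
  simp only [stepX, stepY, eval_mod, eval_add, eval_mul, eval_sub, eval_one, eval_var, hp,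
    intCast_emod]
  push_cast
  linear_combination (-(c.eval τ * τ y * b.eval τ : F)) * hι

lemma HasSums.ctrA {T : List Item} {σ : Var → ℤ} (h : HasSums F p n U T σ) (hpr : p.Prime) {K : ℤ}
    {d : Item} (hd : d.Bdd K) (hK : K < p) {ι : F} (hι : ι * ι = -1) :
    (ctrAX.eval (loadItem d σ) : F) + ctrAY.eval (loadItem d σ) * ι =
      ctr n (labelled .A T) d ι := by
  rw [ctr, ← h.sum_a ι hι, ← eval_pt h.val_p hpr hd hK ι]
  simp only [ctrAX, ctrAY, eval_mul, eval_sub, eval_var,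
    loadItem_of_notMem d σ (show Var.sax ∉ itemVars by decide),
    loadItem_of_notMem d σ (show Var.say ∉ itemVars by decide),
    loadItem_of_notMem d σ (show Var.n ∉ itemVars by decide), h.val_n]
  push_cast
  ring

lemma HasSums.ctrB {T : List Item} {σ : Var → ℤ} (h : HasSums F p n U T σ) (hpr : p.Prime) {K : ℤ}
    {d : Item} (hd : d.Bdd K) (hK : K < p) {ι : F} (hι : ι * ι = -1) :
    (ctrBX.eval (loadItem d σ) : F) + ctrBY.eval (loadItem d σ) * ι =
      ctr n (labelled .B T) d ι := by
  rw [ctr, ← h.sum_b ι hι, ← eval_pt h.val_p hpr hd hK ι]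
  simp only [ctrBX, ctrBY, eval_mul, eval_sub, eval_var,
    loadItem_of_notMem d σ (show Var.sbx ∉ itemVars by decide),
    loadItem_of_notMem d σ (show Var.sby ∉ itemVars by decide),
    loadItem_of_notMem d σ (show Var.n ∉ itemVars by decide), h.val_n]
  push_cast
  ring

/-- The test whether the norm of `x + y i` vanishes modulo `p`. -/
lemma emod_norm_eq_zero_iff {x y : ℤ} {ι c c' : F} (hι : ι * ι = -1) (h : (x : F) + y * ι = c)
    (h' : (x : F) + y * -ι = c') : (x * x + y * y) % p = 0 ↔ c * c' = 0 := by
  rw [← Int.dvd_iff_emod_eq_zero, ← CharP.intCast_eq_zero_iff F p, ← h, ← h']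
  have : ((x * x + y * y : ℤ) : F) = (x + y * ι) * (x + y * -ι) := by
    push_cast
    linear_combination (y * y : F) * hι
  rw [this]

open Classical in
lemma HasSums.useA {T : List Item} {σ : Var → ℤ} (h : HasSums F p n U T σ) (hpr : p.Prime) {K : ℤ}
    {d : Item} (hd : d.Bdd K) (hK : K < p) {ι : F} (hι : ι * ι = -1) :
    useA.eval (loadItem d σ) =
      if d.1 = .A then if ctrNorm n (labelled .A T) d ι = 0 then 0 else 1 else 0 := by
  have hp' : loadItem d σ .p = p := (loadItem_of_notMem d σ (by decide)).trans h.val_p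
  have e := emod_norm_eq_zero_iff (p := p) hι (h.ctrA hpr hd hK hι)
    (h.ctrA hpr hd hK (ι := -ι) (by rw [neg_mul_neg, hι]))
  simp only [Prog.useA, eval_mul, eval_isA, eval_eq', eval_mod, eval_add, eval_var, hp', eval_zero,
    e, ctrNorm]
  split_ifs <;> simp_all

open Classical in
lemma HasSums.useB {T : List Item} {σ : Var → ℤ} (h : HasSums F p n U T σ) (hpr : p.Prime) {K : ℤ}
    {d : Item} (hd : d.Bdd K) (hK : K < p) {ι : F} (hι : ι * ι = -1) :
    useB.eval (loadItem d σ) =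
      if d.1 = .B then if ctrNorm n (labelled .B T) d ι = 0 then 0 else 1 else 0 := by
  have hp' : loadItem d σ .p = p := (loadItem_of_notMem d σ (by decide)).trans h.val_p
  have e := emod_norm_eq_zero_iff (p := p) hι (h.ctrB hpr hd hK hι)
    (h.ctrB hpr hd hK (ι := -ι) (by rw [neg_mul_neg, hι]))
  simp only [Prog.useB, eval_mul, eval_isB, eval_eq', eval_mod, eval_add, eval_var, hp', eval_zero,
    e, ctrNorm]
  split_ifs <;> simp_all

open Classical in
variable (F p n U) in
/-- The variables contain the parameters, the sums of the points of `L`, and the products of the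
centred points of `T`. -/
structure HasProds (L T : List Item) (σ : Var → ℤ) : Prop extends HasSums F p n U L σ where
  k_nonneg : 0 ≤ σ .k
  k_lt : σ .k < p
  val_k : ∀ ι : F, ι * ι = -1 → (σ .k : F) =
    (((labelled .A T).map fun d => if ctrNorm n (labelled .A L) d ι = 0 then 0 else 1).sum : ℕ)
  prod_a : ∀ ι : F, ι * ι = -1 → (σ .qax : F) + σ .qay * ι = ((labelled .A T).map fun d =>
    if ctrNorm n (labelled .A L) d ι = 0 then 1 else ctr n (labelled .A L) d ι).prod
  prod_b : ∀ ι : F, ι * ι = -1 → (σ .qbx : F) + σ .qby * ι = ((labelled .B T).map fun d =>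
    if ctrNorm n (labelled .B L) d ι = 0 then 1 else ctr n (labelled .B L) d ι).prod

lemma HasSums.congr {F : Type} [Field F] {p n U : ℕ} {T : List Item} {σ τ : Var → ℤ}
    (h : HasSums F p n U T σ)
    (hτ : ∀ x ∈ ({.n, .u, .p, .sax, .say, .sbx, .sby} : Finset Var), τ x = σ x) :
    HasSums F p n U T τ := by
  refine ⟨?_, ?_, ?_, fun ι hι => ?_, fun ι hι => ?_⟩
  · rw [hτ _ (by decide), h.val_n]
  · rw [hτ _ (by decide), h.val_u]
  · rw [hτ _ (by decide), h.val_p]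
  · rw [hτ .sax (by decide), hτ .say (by decide), h.sum_a ι hι]
  · rw [hτ .sbx (by decide), hτ .sby (by decide), h.sum_b ι hι]

lemma HasProds.congr {F : Type} [Field F] {p n U : ℕ} {L T : List Item} {σ τ : Var → ℤ}
    (h : HasProds F p n U L T σ)
    (hτ : ∀ x ∈ ({.n, .u, .p, .sax, .say, .sbx, .sby, .k, .qax, .qay, .qbx, .qby} : Finset Var),
      τ x = σ x) :
    HasProds F p n U L T τ := by
  refine ⟨h.toHasSums.congr fun x hx => hτ x ?_, ?_, ?_, fun ι hι => ?_, fun ι hι => ?_,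
    fun ι hι => ?_⟩
  · fin_cases hx <;> decide
  · rw [hτ .k (by decide)]; exact h.k_nonneg
  · rw [hτ .k (by decide)]; exact h.k_lt
  · rw [hτ .k (by decide), h.val_k ι hι]
  · rw [hτ .qax (by decide), hτ .qay (by decide), h.prod_a ι hι]
  · rw [hτ .qbx (by decide), hτ .qby (by decide), h.prod_b ι hι]

lemma hasProds_passItems {L : List Item} (hpr : p.Prime) {K : ℤ} (hL : ∀ d ∈ L, d.Bdd K)
    (hK : K < p) {σ : Var → ℤ} (h : HasProds F p n U L [] σ) :
    HasProds F p n U L L (passItems prods L σ) := by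
  classical
  have hp0 : (0 : ℤ) < p := by exact_mod_cast hpr.pos
  refine passItems_induction (P := HasProds F p n U L) ?_ ?_ h
  · intro T d σ hd h
    have hp' : loadItem d σ .p = p := (loadItem_of_notMem d σ (by decide)).trans h.val_p
    refine ⟨h.toHasSums.congr fun x hx => step_of_notMem ?_ ?_ d σ, ?_, ?_, fun ι hι => ?_,
      fun ι hι => ?_, fun ι hι => ?_⟩
    · fin_cases hx <;> rfl
    · fin_cases hx <;> decide
    · simp only [blockVal, prods, eval_mod, eval_var, hp']; exact Int.emod_nonneg _ hp0.ne'
    · simp only [blockVal, prods, eval_mod, eval_var, hp']; exact Int.emod_lt_of_pos _ hp0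
    · simp only [blockVal, prods, eval_mod, eval_add, eval_var, hp', intCast_emod,
        h.useA hpr (hL d hd) hK hι, loadItem_of_notMem d σ (show Var.k ∉ itemVars by decide)]
      rw [labelled_append, List.map_append, List.sum_append, Nat.cast_add, ← h.val_k ι hι]
      split_ifs <;> simp_all
    · rw [prod_labelled_append, ← h.prod_a ι hι]
      refine (eval_step _ _ _ _ _ hp' hι).trans ?_
      rw [h.ctrA hpr (hL d hd) hK hι, h.useA hpr (hL d hd) hK hι,
        loadItem_of_notMem d σ (show Var.qax ∉ itemVars by decide),
        loadItem_of_notMem d σ (show Var.qay ∉ itemVars by decide)]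
      split_ifs <;> simp
    · rw [prod_labelled_append, ← h.prod_b ι hι]
      refine (eval_step _ _ _ _ _ hp' hι).trans ?_
      rw [h.ctrB hpr (hL d hd) hK hι, h.useB hpr (hL d hd) hK hι,
        loadItem_of_notMem d σ (show Var.qbx ∉ itemVars by decide),
        loadItem_of_notMem d σ (show Var.qby ∉ itemVars by decide)]
      split_ifs <;> simp
  · intro T σ h
    refine h.congr fun x hx => Function.update_of_ne ?_ _ _
    fin_cases hx <;> decide

lemma HasProds.k_eq {L : List Item} {σ : Var → ℤ} (h : HasProds F p n U L L σ)
    (hlen : (labelled .A L).length = n) (hn : n < p) {ι : F} (hι : ι * ι = -1) :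
    σ .k = numCtr n (labelled .A L) ι := by
  have h1 := h.val_k ι hι
  obtain ⟨c, hc⟩ := Int.eq_ofNat_of_zero_le h.k_nonneg
  have h2 := h.k_lt
  have h3 := (numCtr_le n (labelled .A L) ι).trans_eq hlen
  rw [hc] at h1 h2 ⊢
  rw [Int.cast_natCast] at h1
  have := CharP.natCast_injOn_Iio F p (Set.mem_Iio.2 (by omega : c < p))
    (Set.mem_Iio.2 (h3.trans_lt hn)) h1
  rw [this]

variable (F p n U) in
/-- The variables contain what `HasProds` says, the candidate `(X + Y i) / M` for the rotation, the
evaluation point, and the fingerprints of the points of `T`. -/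
structure HasPrints (X Y M : ℤ) (r : ℕ) (L T : List Item) (σ : Var → ℤ) : Prop extends
    HasProds F p n U L L σ where
  val_x : rotX.eval σ = X
  val_y : rotY.eval σ = Y
  val_m : σ .sm = M
  val_r : σ .r = r
  fx_mem : ∀ j, 0 ≤ σ (.fx j) ∧ σ (.fx j) < p
  fy_mem : ∀ j, 0 ≤ σ (.fy j) ∧ σ (.fy j) < p
  gx_mem : 0 ≤ σ .gx ∧ σ .gx < p
  gy_mem : 0 ≤ σ .gy ∧ σ .gy < p
  fx_fy : ∀ ι : F, ι * ι = -1 → ∀ j, (σ (.fx j) : F) + σ (.fy j) * ι = ((labelled .A T).map fun d =>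
    (M : F) * r - ((rotRe j X Y : ℤ) + (rotIm j X Y : ℤ) * ι) * ctr n (labelled .A L) d ι).prod
  gx_gy : ∀ ι : F, ι * ι = -1 → (σ .gx : F) + σ .gy * ι = ((labelled .B T).map fun d =>
    (M : F) * r - M * ctr n (labelled .B L) d ι).prod

lemma eval_rotX_congr {σ τ : Var → ℤ} (h1 : τ .n = σ .n) (h2 : τ .u = σ .u) (h3 : τ .sx = σ .sx) :
    rotX.eval τ = rotX.eval σ := by
  simp [Prog.rotX, base, h1, h2, h3]

lemma eval_rotY_congr {σ τ : Var → ℤ} (h1 : τ .n = σ .n) (h2 : τ .u = σ .u) (h3 : τ .sy = σ .sy) :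
    rotY.eval τ = rotY.eval σ := by
  simp [Prog.rotY, base, h1, h2, h3]

lemma hasPrints_passItems {X Y M : ℤ} {r : ℕ} {L : List Item} (hpr : p.Prime) {K : ℤ}
    (hL : ∀ d ∈ L, d.Bdd K) (hK : K < p) {σ : Var → ℤ} (h : HasPrints F p n U X Y M r L [] σ) :
    HasPrints F p n U X Y M r L L (passItems prints L σ) := by
  have hp0 : (0 : ℤ) < p := by exact_mod_cast hpr.pos
  refine passItems_induction (P := HasPrints F p n U X Y M r L) ?_ ?_ h
  · intro T d σ hd h
    have hn {x : Var} (hx : x ∉ itemVars) := loadItem_of_notMem d σ hx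
    have hp' : loadItem d σ .p = p := (hn (by decide)).trans h.val_p
    have hX : Prog.rotX.eval (loadItem d σ) = X :=
      (eval_rotX_congr (hn (by decide)) (hn (by decide)) (hn (by decide))).trans h.val_x
    have hY : Prog.rotY.eval (loadItem d σ) = Y :=
      (eval_rotY_congr (hn (by decide)) (hn (by decide)) (hn (by decide))).trans h.val_y
    have hmod (e : Ex Var) : 0 ≤ (e % v .p).eval (loadItem d σ) ∧
        (e % v .p).eval (loadItem d σ) < p := by
      rw [eval_mod, eval_var, hp']
      exact ⟨Int.emod_nonneg _ hp0.ne', Int.emod_lt_of_pos _ hp0⟩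
    have hs {x : Var} (hf : prints x = v x) (hx : x ∉ itemVars) := step_of_notMem hf hx d σ
    refine ⟨h.toHasProds.congr fun x hx => hs ?_ ?_, ?_, ?_, ?_, ?_, fun j => hmod _,
      fun j => hmod _, hmod _, hmod _, fun ι hι j => ?_, fun ι hι => ?_⟩
    · fin_cases hx <;> rfl
    · fin_cases hx <;> decide
    · exact (eval_rotX_congr (hs rfl (by decide)) (hs rfl (by decide)) (hs rfl (by decide))).trans
        h.val_x
    · exact (eval_rotY_congr (hs rfl (by decide)) (hs rfl (by decide)) (hs rfl (by decide))).trans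
        h.val_y
    · exact (hs rfl (by decide)).trans h.val_m
    · exact (hs rfl (by decide)).trans h.val_r
    · rw [prod_labelled_append, ← h.fx_fy ι hι j]
      refine (eval_step _ _ _ _ _ hp' hι).trans ?_
      rw [eval_isA, hn (x := .fx j) (by revert j; decide), hn (x := .fy j) (by revert j; decide),
        ← h.ctrA hpr (hL d hd) hK hι]
      simp only [printAX, printAY, turnX, turnY, eval_sub, eval_mul, eval_neg, eval_add, eval_rotRe,
        eval_rotIm, hX, hY, eval_var, hn (x := .sm) (by decide), hn (x := .r) (by decide),
        h.val_m, h.val_r]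
      split_ifs
      · push_cast
        linear_combination ((σ (.fx j) + σ (.fy j) * ι) *
          ((rotIm j X Y : ℤ) * ctrAY.eval (loadItem d σ)) : F) * hι
      · push_cast; ring
    · rw [prod_labelled_append, ← h.gx_gy ι hι]
      refine (eval_step _ _ _ _ _ hp' hι).trans ?_
      rw [eval_isB, hn (x := .gx) (by decide), hn (x := .gy) (by decide),
        ← h.ctrB hpr (hL d hd) hK hι]
      simp only [printBX, printBY, eval_sub, eval_mul, eval_neg, eval_var,
        hn (x := .sm) (by decide), hn (x := .r) (by decide), h.val_m, h.val_r]
      split_ifs <;> push_cast <;> ring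
  · intro T σ h
    have hn {x : Var} (hx : x ≠ .lab) : Function.update σ .lab 0 x = σ x :=
      Function.update_of_ne hx _ _
    refine ⟨h.toHasProds.congr fun x hx => hn ?_,
      (eval_rotX_congr (hn (by decide)) (hn (by decide)) (hn (by decide))).trans h.val_x,
      (eval_rotY_congr (hn (by decide)) (hn (by decide)) (hn (by decide))).trans h.val_y,
      by simpa using h.val_m, by simpa using h.val_r, by simpa using h.fx_mem,
      by simpa using h.fy_mem,
      by simpa using h.gx_mem, by simpa using h.gy_mem, by simpa using h.fx_fy,
      by simpa using h.gx_gy⟩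
    fin_cases hx <;> decide

end semantics

/-! ### The searches for the rotation and the translation -/

section conditions

variable {F : Type} [Field F] {p : ℕ} [CharP F p] {n U : ℕ} {L : List Item}

lemma emod_eq_zero_iff (x : ℤ) : x % p = 0 ↔ (x : F) = 0 := by
  rw [CharP.intCast_eq_zero_iff F p, Int.dvd_iff_emod_eq_zero]

/-- Two integers vanish modulo `p` if and only if they are the parts of a number that vanishes for
both square roots of `-1`. -/
lemma emod_eq_zero_and_iff (hp2 : 2 < p) {ι₀ : F} (hι₀ : ι₀ * ι₀ = -1) (x y : ℤ) :
    (x % p = 0 ∧ y % p = 0) ↔ ∀ ι : F, ι * ι = -1 → (x : F) + y * ι = 0 := by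
  rw [emod_eq_zero_iff (F := F), emod_eq_zero_iff (F := F)]
  refine ⟨fun h ι _ => by rw [h.1, h.2]; ring, fun h => ?_⟩
  have h2 : (2 : F) ≠ 0 := by
    exact_mod_cast intCast_ne_zero_of_lt (F := F) (p := p) (a := 2) (by norm_num) (by omega)
  have h0 : ι₀ ≠ 0 := by rintro rfl; simp at hι₀
  have a1 := h ι₀ hι₀
  have a2 := h (-ι₀) (by rw [neg_mul_neg, hι₀])
  have hx : (x : F) = 0 := by
    have : (2 : F) * x = 0 := by linear_combination a1 + a2
    exact (mul_eq_zero.1 this).resolve_left h2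
  exact ⟨hx, (mul_eq_zero.1 (by rwa [hx, zero_add] at a1)).resolve_right h0⟩

lemma gaussian_real_pow (M : ℤ) (k : ℕ) : ((⟨M, 0⟩ : GaussianInt) ^ k).im = 0 := by
  induction k with
  | zero => rfl
  | succ k ih => rw [pow_succ, Zsqrtd.im_mul, ih]; simp

lemma HasProds.eval_rotCond {σ : Var → ℤ} (h : HasProds F p n U L L σ) (hp2 : 2 < p)
    (hlen : (labelled .A L).length = n) (hn : n < p) {ι₀ : F} (hι₀ : ι₀ * ι₀ = -1) :
    rotCond.eval σ ≠ 0 ↔ 0 < σ .sm ∧ rotX.eval σ ^ 2 + rotY.eval σ ^ 2 = σ .sm ^ 2 ∧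
      ∀ ι : F, ι * ι = -1 →
        PowCond n (labelled .A L) (labelled .B L) (rotX.eval σ) (rotY.eval σ) (σ .sm) ι := by
  have hp1 : 1 < σ .p := by rw [h.val_p]; omega
  have hu {x : Var} (hx : x ≠ .pow) (y : ℤ) : Function.update σ .pow y x = σ x :=
    Function.update_of_ne hx _ _
  have g1 := gaussPow_parts (z := .pow) (p := .p) (P := rotX) (Q := rotY) (k := v .k) (σ := σ)
    (by decide) hp1
    (fun y => eval_rotX_congr (hu (by decide) y) (hu (by decide) y) (hu (by decide) y))
    (fun y => eval_rotY_congr (hu (by decide) y) (hu (by decide) y) (hu (by decide) y))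
  have g2 := gaussPow_parts (z := .pow) (p := .p) (P := v .sm) (Q := 0) (k := v .k) (σ := σ)
    (by decide) hp1 (fun y => by rw [eval_var, eval_var]; exact hu (by decide) y) (fun y => rfl)
  rw [rotCond, eval_mul, eval_mul, eval_mul, mul_ne_zero_iff, mul_ne_zero_iff, mul_ne_zero_iff,
    eval_eq', eval_eq', eval_eq', eval_lt', ite_one_zero_ne_zero, ite_one_zero_ne_zero,
    ite_one_zero_ne_zero, ite_one_zero_ne_zero, and_assoc, and_assoc, eval_add, eval_power,
    eval_power, eval_power, eval_var, eval_zero, eval_mod, eval_mod, eval_var, h.val_p,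
    emod_eq_zero_and_iff hp2 hι₀]
  refine and_congr_right fun _ => and_congr_right fun _ => forall_congr' fun ι =>
    forall_congr' fun hι => ?_
  simp only [eval_sub, eval_add, eval_mul, eval_mod, eval_div, rotPow, denPow, g1, g2, eval_var]
  rw [h.val_p]
  push_cast
  rw [intCast_emod, intCast_emod, intCast_emod]
  have e1 := gaussian_pow_cast hι (rotX.eval σ) (rotY.eval σ) (σ .k).toNat
  have e2 := gaussian_pow_cast hι (σ .sm) 0 (σ .k).toNat
  rw [gaussian_real_pow] at e2
  rw [Int.cast_zero, zero_mul, add_zero, add_zero] at e2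
  have hk : (σ .k).toNat = numCtr n (labelled .A L) ι := by
    rw [h.k_eq hlen hn hι, Int.toNat_natCast]
  have qa : (σ .qax : F) + σ .qay * ι = prodCtr n (labelled .A L) ι := h.prod_a ι hι
  have qb : (σ .qbx : F) + σ .qby * ι = prodCtr n (labelled .B L) ι := h.prod_b ι hι
  rw [PowCond, ← hk, ← e1, ← e2, ← qa, ← qb, eval_zero]
  refine Iff.trans (Eq.congr ?_ rfl) sub_eq_zero
  linear_combination
    (-((⟨rotX.eval σ, rotY.eval σ⟩ : GaussianInt) ^ (σ .k).toNat).im * σ .qay : F) * hι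

variable (F p n U) in
/-- The variables contain the sums of the points of `L` and the candidate `(X + Y i) / M` for the
rotation. -/
structure HasRot (X Y M : ℤ) (L : List Item) (σ : Var → ℤ) : Prop extends
    HasSums F p n U L σ where
  val_x : rotX.eval σ = X
  val_y : rotY.eval σ = Y
  val_m : σ .sm = M

lemma HasRot.congr {F : Type} [Field F] {p n U : ℕ} {L : List Item} {X Y M : ℤ}
    {σ τ : Var → ℤ} (h : HasRot F p n U X Y M L σ)
    (hτ : ∀ x ∈ ({.n, .u, .p, .sax, .say, .sbx, .sby, .sx, .sy, .sm} : Finset Var), τ x = σ x) :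
    HasRot F p n U X Y M L τ :=
  ⟨h.toHasSums.congr fun x hx => hτ x (by fin_cases hx <;> decide),
    (eval_rotX_congr (hτ _ (by decide)) (hτ _ (by decide)) (hτ _ (by decide))).trans h.val_x,
    (eval_rotY_congr (hτ _ (by decide)) (hτ _ (by decide)) (hτ _ (by decide))).trans h.val_y,
    (hτ _ (by decide)).trans h.val_m⟩

variable (F n) in
/-- `(T₁ + T₂ i) / S` is a candidate for the translation after `j` quarter turns. -/
def IsTrans (X Y M : ℤ) (L : List Item) (j : Fin 4) (T₁ T₂ S : ℤ) : Prop :=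
  0 < S ∧ ∀ ι : F, ι * ι = -1 →
    TransCond n (labelled .A L) (labelled .B L) (rotRe j X Y) (rotIm j X Y) M T₁ T₂ S ι

lemma eval_base_pow {σ : Var → ℤ} (hn : σ .n = n) (hu : σ .u = U) (k : ℕ) :
    (power base k).eval σ = (2 * n * U : ℤ) ^ k := by
  rw [eval_power, eval_base hn hu]; push_cast; rfl

lemma HasRot.eval_transCond {X Y M : ℤ} {σ : Var → ℤ} (h : HasRot F p n U X Y M L σ)
    (hp2 : 2 < p) {ι₀ : F} (hι₀ : ι₀ * ι₀ = -1) (j : Fin 4) :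
    (transCond j).eval σ ≠ 0 ↔ IsTrans F n X Y M L j (σ (.tx j) - (2 * n * U : ℤ) ^ 19)
      (σ (.ty j) - (2 * n * U : ℤ) ^ 19) (σ (.ts j)) := by
  rw [transCond, eval_mul, eval_mul, mul_ne_zero_iff, mul_ne_zero_iff, eval_eq', eval_eq', eval_lt',
    ite_one_zero_ne_zero, ite_one_zero_ne_zero, ite_one_zero_ne_zero, and_assoc, eval_zero,
    eval_mod, eval_mod, eval_var, eval_var, h.val_p, emod_eq_zero_and_iff hp2 hι₀]
  refine and_congr_right fun _ => forall_congr' fun ι => forall_congr' fun hι => ?_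
  rw [TransCond, ← h.sum_a ι hι, ← h.sum_b ι hι]
  refine Iff.trans (Eq.congr ?_ rfl) sub_eq_zero
  simp only [eval_sub, eval_mul, eval_add, eval_var, turnX, turnY, transX, transY, eval_rotRe,
    eval_rotIm, eval_base_pow h.val_n h.val_u, h.val_x, h.val_y, h.val_m, h.val_n]
  push_cast
  linear_combination (σ (.ts j) * (rotIm j X Y : ℤ) * σ .say : F) * hι

/-- The effect of the three searches for the rotation. -/
def afterRot (σ : Var → ℤ) : Var → ℤ := blockVal findM (blockVal findY (blockVal findX σ))

/-- The effect of the three searches for the translations. -/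
def afterTrans (σ : Var → ℤ) : Var → ℤ := blockVal findTS (blockVal findTY (blockVal findTX σ))

lemma blockVal_findX (σ : Var → ℤ) : blockVal findX σ = Function.update σ .sx
    ((search .sx rotRange (any .sy rotRange (any .sm denRange rotCond))).eval σ) := by
  funext x
  cases x <;> rfl

lemma blockVal_findY (σ : Var → ℤ) : blockVal findY σ = Function.update σ .sy
    ((search .sy rotRange (any .sm denRange rotCond)).eval σ) := by
  funext x
  cases x <;> rfl

lemma blockVal_findM (σ : Var → ℤ) : blockVal findM σ = Function.update σ .sm
    ((search .sm denRange rotCond).eval σ) := by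
  funext x
  cases x <;> rfl

lemma afterRot_of_notMem (σ : Var → ℤ) {x : Var} (h1 : x ≠ .sx) (h2 : x ≠ .sy) (h3 : x ≠ .sm) :
    afterRot σ x = σ x := by
  rw [afterRot, blockVal_findM, Function.update_of_ne h3, blockVal_findY, Function.update_of_ne h2,
    blockVal_findX, Function.update_of_ne h1]

lemma afterTrans_of_notMem (σ : Var → ℤ) {x : Var} (hx : ∀ j, x ≠ .tx j ∧ x ≠ .ty j ∧ x ≠ .ts j) :
    afterTrans σ x = σ x := by
  have h (j) := hx j
  cases x with
  | tx j => exact absurd rfl (h j).1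
  | ty j => exact absurd rfl (h j).2.1
  | ts j => exact absurd rfl (h j).2.2
  | _ => rfl

lemma eval_rotRange {σ : Var → ℤ} (hn : σ .n = n) (hu : σ .u = U) :
    rotRange.eval σ = 2 * (2 * n * U : ℤ) ^ 12 + 1 := by
  rw [rotRange, eval_add, eval_mul, eval_base_pow hn hu]; rfl

lemma eval_denRange {σ : Var → ℤ} (hn : σ .n = n) (hu : σ .u = U) :
    denRange.eval σ = (2 * n * U : ℤ) ^ 12 + 1 := by
  rw [denRange, eval_add, eval_base_pow hn hu]; rfl

lemma eval_transRange {σ : Var → ℤ} (hn : σ .n = n) (hu : σ .u = U) :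
    transRange.eval σ = 2 * (2 * n * U : ℤ) ^ 19 + 1 := by
  rw [transRange, eval_add, eval_mul, eval_base_pow hn hu]; rfl

lemma eval_transDenRange {σ : Var → ℤ} (hn : σ .n = n) (hu : σ .u = U) :
    transDenRange.eval σ = (2 * n * U : ℤ) ^ 19 + 1 := by
  rw [transDenRange, eval_add, eval_base_pow hn hu]; rfl

lemma eval_rotX {σ : Var → ℤ} (hn : σ .n = n) (hu : σ .u = U) :
    rotX.eval σ = σ .sx - (2 * n * U : ℤ) ^ 12 := by
  rw [rotX, eval_sub, eval_base_pow hn hu]; rfl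

lemma eval_rotY {σ : Var → ℤ} (hn : σ .n = n) (hu : σ .u = U) :
    rotY.eval σ = σ .sy - (2 * n * U : ℤ) ^ 12 := by
  rw [rotY, eval_sub, eval_base_pow hn hu]; rfl

/-- The candidate is bounded, even if the search fails. -/
lemma afterRot_bdd {σ : Var → ℤ} (hn : σ .n = n) (hu : σ .u = U) :
    |rotX.eval (afterRot σ)| ≤ (2 * n * U : ℤ) ^ 12 + 1 ∧
      |rotY.eval (afterRot σ)| ≤ (2 * n * U : ℤ) ^ 12 + 1 ∧
      afterRot σ .sm ≤ (2 * n * U : ℤ) ^ 12 + 1 := by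
  have hV : 0 ≤ (2 * n * U : ℤ) ^ 12 := by positivity
  have hn' : afterRot σ .n = n :=
    (afterRot_of_notMem σ (by decide) (by decide) (by decide)).trans hn
  have hu' : afterRot σ .u = U :=
    (afterRot_of_notMem σ (by decide) (by decide) (by decide)).trans hu
  have e1 : afterRot σ .sx = blockVal findX σ .sx := rfl
  have e2 : afterRot σ .sy = blockVal findY (blockVal findX σ) .sy := rfl
  have s1 := search_spec .sx rotRange (any .sy rotRange (any .sm denRange rotCond)) σ
  have s2 := search_spec .sy rotRange (any .sm denRange rotCond) (blockVal findX σ)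
  have s3 := search_spec .sm denRange rotCond (blockVal findY (blockVal findX σ))
  rw [eval_rotRange hn hu] at s1
  rw [eval_rotRange (σ := blockVal findX σ) hn hu] at s2
  rw [eval_denRange (σ := blockVal findY (blockVal findX σ)) hn hu] at s3
  rw [eval_rotX hn' hu', eval_rotY hn' hu', e1, e2]
  generalize (2 * n * U : ℤ) ^ 12 = W at *
  refine ⟨abs_le.2 ⟨?_, ?_⟩, abs_le.2 ⟨?_, ?_⟩, s3.2.1.trans (by omega)⟩
  · have := s1.1; change _ ≤ (search _ _ _).eval _ - _; omega
  · have := s1.2.1; change (search _ _ _).eval _ - _ ≤ _; omega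
  · have := s2.1; change _ ≤ (search _ _ _).eval _ - _; omega
  · have := s2.2.1; change (search _ _ _).eval _ - _ ≤ _; omega

lemma HasProds.afterRot {F : Type} [Field F] {p n U : ℕ} {L : List Item} {σ : Var → ℤ}
    (h : HasProds F p n U L L σ) :
    HasProds F p n U L L (afterRot σ) :=
  h.congr fun x hx => afterRot_of_notMem σ (by rintro rfl; revert hx; decide)
    (by rintro rfl; revert hx; decide) (by rintro rfl; revert hx; decide)

/-- The search finds a rotation if there is one. -/
lemma HasProds.exists_rot {σ : Var → ℤ} (h : HasProds F p n U L L σ) (hp2 : 2 < p)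
    (hlen : (labelled .A L).length = n) (hn : n < p) {ι₀ : F} (hι₀ : ι₀ * ι₀ = -1) {X Y M : ℤ}
    (hr : IsRot ((2 * n * U : ℤ) ^ 12) X Y M)
    (hpow : ∀ ι : F, ι * ι = -1 → PowCond n (labelled .A L) (labelled .B L) X Y M ι) :
    rotCond.eval (CongStream.afterRot σ) ≠ 0 := by
  have hu {τ : Var → ℤ} {x y : Var} (hx : x ≠ y) (a : ℤ) : Function.update τ y a x = τ x :=
    Function.update_of_ne hx _ _
  obtain ⟨h1, h2, h3, h4, h5⟩ := hr
  rw [abs_le] at h3 h4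
  have s1 := (search_lt (z := Var.sx) (N := rotRange)
    (b := any .sy rotRange (any .sm denRange rotCond)) (σ := σ)
    ⟨X + (2 * n * U : ℤ) ^ 12, by omega, by rw [eval_rotRange h.val_n h.val_u]; omega, ?_⟩).2
  · rw [← blockVal_findX] at s1
    have s2 := (search_lt (eval_any_ne_zero.1 s1)).2
    rw [← blockVal_findY] at s2
    have s3 := (search_lt (eval_any_ne_zero.1 s2)).2
    rwa [← blockVal_findM] at s3
  · refine eval_any_ne_zero.2 ⟨Y + (2 * n * U : ℤ) ^ 12, by omega, ?_, eval_any_ne_zero.2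
      ⟨M, h1.le, ?_, ?_⟩⟩
    · rw [eval_rotRange ((hu (by decide) _).trans h.val_n) ((hu (by decide) _).trans h.val_u)]
      omega
    · rw [eval_denRange (((hu (by decide) _).trans (hu (by decide) _)).trans h.val_n)
        (((hu (by decide) _).trans (hu (by decide) _)).trans h.val_u)]; omega
    · set τ := Function.update (Function.update (Function.update σ .sx
        (X + (2 * n * U : ℤ) ^ 12)) .sy (Y + (2 * n * U : ℤ) ^ 12)) .sm M with hτ
      have hP : HasProds F p n U L L τ := h.congr fun x hx => by
        rw [hτ, hu, hu, hu] <;> (rintro rfl; revert hx; decide)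
      rw [hP.eval_rotCond hp2 hlen hn hι₀, eval_rotX hP.val_n hP.val_u,
        eval_rotY hP.val_n hP.val_u]
      have t1 : τ .sx = X + (2 * n * U : ℤ) ^ 12 := by rw [hτ]; simp
      have t2 : τ .sy = Y + (2 * n * U : ℤ) ^ 12 := by rw [hτ]; simp
      have t3 : τ .sm = M := by rw [hτ]; simp
      rw [t1, t2, t3, add_sub_cancel_right, add_sub_cancel_right]
      exact ⟨h1, h5, hpow⟩

lemma afterTrans_bdd {σ : Var → ℤ} (hn : σ .n = n) (hu : σ .u = U) (j : Fin 4) :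
    |afterTrans σ (.tx j) - (2 * n * U : ℤ) ^ 19| ≤ (2 * n * U : ℤ) ^ 19 + 1 ∧
      |afterTrans σ (.ty j) - (2 * n * U : ℤ) ^ 19| ≤ (2 * n * U : ℤ) ^ 19 + 1 ∧
      afterTrans σ (.ts j) ≤ (2 * n * U : ℤ) ^ 19 + 1 := by
  have hV : 0 ≤ (2 * n * U : ℤ) ^ 19 := by positivity
  have e1 : afterTrans σ (.tx j) = blockVal findTX σ (.tx j) := rfl
  have e2 : afterTrans σ (.ty j) = blockVal findTY (blockVal findTX σ) (.ty j) := rfl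
  have s1 := search_spec (.tx j) transRange
    (any (.ty j) transRange (any (.ts j) transDenRange (transCond j))) σ
  have s2 := search_spec (.ty j) transRange (any (.ts j) transDenRange (transCond j))
    (blockVal findTX σ)
  have s3 := search_spec (.ts j) transDenRange (transCond j) (blockVal findTY (blockVal findTX σ))
  rw [eval_transRange hn hu] at s1
  rw [eval_transRange (σ := blockVal findTX σ) hn hu] at s2
  rw [eval_transDenRange (σ := blockVal findTY (blockVal findTX σ)) hn hu] at s3
  rw [e1, e2]
  generalize (2 * n * U : ℤ) ^ 19 = W at *
  refine ⟨abs_le.2 ⟨?_, ?_⟩, abs_le.2 ⟨?_, ?_⟩, s3.2.1.trans (by omega)⟩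
  · have := s1.1; change _ ≤ (search _ _ _).eval _ - _; omega
  · have := s1.2.1; change (search _ _ _).eval _ - _ ≤ _; omega
  · have := s2.1; change _ ≤ (search _ _ _).eval _ - _; omega
  · have := s2.2.1; change (search _ _ _).eval _ - _ ≤ _; omega

lemma HasRot.eval_any_ts {X Y M : ℤ} {σ : Var → ℤ} (h : HasRot F p n U X Y M L σ)
    (hp2 : 2 < p) {ι₀ : F} (hι₀ : ι₀ * ι₀ = -1) (j : Fin 4) :
    (any (.ts j) transDenRange (transCond j)).eval σ ≠ 0 ↔
      ∃ S, 0 ≤ S ∧ S < (2 * n * U : ℤ) ^ 19 + 1 ∧ IsTrans F n X Y M L j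
        (σ (.tx j) - (2 * n * U : ℤ) ^ 19) (σ (.ty j) - (2 * n * U : ℤ) ^ 19) S := by
  rw [eval_any_ne_zero, eval_transDenRange h.val_n h.val_u]
  refine exists_congr fun S => and_congr_right fun _ => and_congr_right fun _ => ?_
  have h' : HasRot F p n U X Y M L (Function.update σ (.ts j) S) :=
    h.congr fun x hx => Function.update_of_ne (by rintro rfl; simp at hx) _ _
  rw [h'.eval_transCond hp2 hι₀, Function.update_self, Function.update_of_ne (by simp),
    Function.update_of_ne (by simp)]

lemma HasRot.eval_any_ty {X Y M : ℤ} {σ : Var → ℤ} (h : HasRot F p n U X Y M L σ)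
    (hp2 : 2 < p) {ι₀ : F} (hι₀ : ι₀ * ι₀ = -1) (j : Fin 4) :
    (any (.ty j) transRange (any (.ts j) transDenRange (transCond j))).eval σ ≠ 0 ↔
      ∃ y, 0 ≤ y ∧ y < 2 * (2 * n * U : ℤ) ^ 19 + 1 ∧ ∃ S, 0 ≤ S ∧ S < (2 * n * U : ℤ) ^ 19 + 1 ∧
        IsTrans F n X Y M L j (σ (.tx j) - (2 * n * U : ℤ) ^ 19) (y - (2 * n * U : ℤ) ^ 19) S := by
  rw [eval_any_ne_zero, eval_transRange h.val_n h.val_u]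
  refine exists_congr fun y => and_congr_right fun _ => and_congr_right fun _ => ?_
  have h' : HasRot F p n U X Y M L (Function.update σ (.ty j) y) :=
    h.congr fun x hx => Function.update_of_ne (by rintro rfl; simp at hx) _ _
  rw [h'.eval_any_ts hp2 hι₀, Function.update_self, Function.update_of_ne (by simp)]

/-- The search finds a translation if there is one. -/
lemma HasRot.exists_trans {X Y M : ℤ} {σ : Var → ℤ} (h : HasRot F p n U X Y M L σ)
    (hp2 : 2 < p) {ι₀ : F} (hι₀ : ι₀ * ι₀ = -1) (j : Fin 4) {T₁ T₂ S : ℤ}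
    (hS : S ≤ (2 * n * U : ℤ) ^ 19) (hT₁ : |T₁| ≤ (2 * n * U : ℤ) ^ 19)
    (hT₂ : |T₂| ≤ (2 * n * U : ℤ) ^ 19) (ht : IsTrans F n X Y M L j T₁ T₂ S) :
    IsTrans F n X Y M L j (afterTrans σ (.tx j) - (2 * n * U : ℤ) ^ 19)
      (afterTrans σ (.ty j) - (2 * n * U : ℤ) ^ 19) (afterTrans σ (.ts j)) := by
  rw [abs_le] at hT₁ hT₂
  have hu (a : ℤ) : HasRot F p n U X Y M L (Function.update σ (.tx j) a) :=
    h.congr fun x hx => Function.update_of_ne (by rintro rfl; simp at hx) _ _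
  have s1 := (search_lt (z := Var.tx j) (N := transRange)
    (b := any (.ty j) transRange (any (.ts j) transDenRange (transCond j))) (σ := σ)
    ⟨T₁ + (2 * n * U : ℤ) ^ 19, by omega, by rw [eval_transRange h.val_n h.val_u]; omega, by
      rw [(hu _).eval_any_ty hp2 hι₀, Function.update_self, add_sub_cancel_right]
      refine ⟨T₂ + (2 * n * U : ℤ) ^ 19, by omega, by omega, S, ht.1.le, by omega, ?_⟩
      rwa [add_sub_cancel_right]⟩).2
  rw [(hu _).eval_any_ty hp2 hι₀, Function.update_self] at s1
  have h1 : HasRot F p n U X Y M L (blockVal findTX σ) :=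
    h.congr fun x hx => by fin_cases hx <;> rfl
  have s2 := (search_lt (eval_any_ne_zero.1 ((h1.eval_any_ty hp2 hι₀ j).2 s1))).2
  have hu' (a : ℤ) : HasRot F p n U X Y M L (Function.update (blockVal findTX σ) (.ty j) a) :=
    h1.congr fun x hx => Function.update_of_ne (by rintro rfl; simp at hx) _ _
  rw [(hu' _).eval_any_ts hp2 hι₀, Function.update_self, Function.update_of_ne (by simp)] at s2
  have h2 : HasRot F p n U X Y M L (blockVal findTY (blockVal findTX σ)) :=
    h1.congr fun x hx => by fin_cases hx <;> rfl
  have s3 := (search_lt (eval_any_ne_zero.1 ((h2.eval_any_ts hp2 hι₀ j).2 s2))).2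
  have hu3 (a : ℤ) : HasRot F p n U X Y M L
      (Function.update (blockVal findTY (blockVal findTX σ)) (.ts j) a) :=
    h2.congr fun x hx => Function.update_of_ne (by rintro rfl; simp at hx) _ _
  rw [(hu3 _).eval_transCond hp2 hι₀, Function.update_self, Function.update_of_ne (by simp),
    Function.update_of_ne (by simp)] at s3
  exact s3

/-! ### The answer -/

lemma mul_zero_or_one {a b : ℤ} (ha : a = 0 ∨ a = 1) (hb : b = 0 ∨ b = 1) :
    a * b = 0 ∨ a * b = 1 := by
  rcases ha with rfl | rfl <;> simp [hb]

lemma ite_zero_or_one (P : Prop) [Decidable P] :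
    (if P then (1 : ℤ) else 0) = 0 ∨ (if P then (1 : ℤ) else 0) = 1 := by
  split_ifs <;> simp

lemma eval_accept_zero_or_one (j : Fin 4) (σ : Var → ℤ) :
    (accept j).eval σ = 0 ∨ (accept j).eval σ = 1 := by
  simp only [accept, rotCond, transCond, eval_mul, eval_eq', eval_lt']
  repeat' apply mul_zero_or_one
  all_goals exact ite_zero_or_one _

/-- The last block gives the answer for a rotation that is accepted, if there is one. -/
lemma finish_spec (σ : Var → ℤ) :
    ((∀ j, (accept j).eval σ = 0) ∧ blockVal finish σ .verdict = 0) ∨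
      ∃ j, (accept j).eval σ = 1 ∧ blockVal finish σ .verdict = 1 ∧
        ∀ i, blockVal finish σ (.out i) = (answer j i).eval σ := by
  have hv : blockVal finish σ .verdict = if 0 < (accept 0).eval σ + (accept 1).eval σ +
      (accept 2).eval σ + (accept 3).eval σ then 1 else 0 := rfl
  have ho (i) : blockVal finish σ (.out i) = (accept 0).eval σ * (answer 0 i).eval σ +
      (1 - (accept 0).eval σ) * ((accept 1).eval σ * (answer 1 i).eval σ +
      (1 - (accept 1).eval σ) * ((accept 2).eval σ * (answer 2 i).eval σ +
      (1 - (accept 2).eval σ) * (answer 3 i).eval σ)) := rfl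
  rw [hv]
  simp only [ho]
  rcases eval_accept_zero_or_one 0 σ with h0 | h0
  · rcases eval_accept_zero_or_one 1 σ with h1 | h1
    · rcases eval_accept_zero_or_one 2 σ with h2 | h2
      · rcases eval_accept_zero_or_one 3 σ with h3 | h3
        · refine .inl ⟨fun j => ?_, by simp [h0, h1, h2, h3]⟩
          fin_cases j <;> assumption
        · exact .inr ⟨3, h3, by simp [h0, h1, h2, h3], fun i => by simp [h0, h1, h2]⟩
      · refine .inr ⟨2, h2, ?_, fun i => by simp [h0, h1, h2]⟩
        rcases eval_accept_zero_or_one 3 σ with h3 | h3 <;> simp [h0, h1, h2, h3]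
    · refine .inr ⟨1, h1, ?_, fun i => by simp [h0, h1]⟩
      rcases eval_accept_zero_or_one 2 σ with h2 | h2 <;>
      rcases eval_accept_zero_or_one 3 σ with h3 | h3 <;> simp [h0, h1, h2, h3]
  · refine .inr ⟨0, h0, ?_, fun i => by simp [h0]⟩
    rcases eval_accept_zero_or_one 1 σ with h1 | h1 <;>
    rcases eval_accept_zero_or_one 2 σ with h2 | h2 <;>
    rcases eval_accept_zero_or_one 3 σ with h3 | h3 <;> simp [h0, h1, h2, h3]

end conditions

/-! ### The correctness of the answer -/

section correctness

variable {F : Type} [Field F] {p : ℕ} [CharP F p] {n U : ℕ} {L : List Item}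

lemma eq_iff_sub_emod_eq_zero {a b q : ℤ} (ha : 0 ≤ a ∧ a < q) (hb : 0 ≤ b ∧ b < q) :
    a = b ↔ (a - b) % q = 0 := by
  rw [← Int.emod_eq_emod_iff_emod_sub_eq_zero, Int.emod_eq_of_lt ha.1 ha.2,
    Int.emod_eq_of_lt hb.1 hb.2]

lemma HasPrints.toHasRot {F : Type} [Field F] {p n U : ℕ} {X Y M : ℤ} {r : ℕ} {L T : List Item}
    {τ : Var → ℤ}
    (h : HasPrints F p n U X Y M r L T τ) : HasRot F p n U X Y M L τ :=
  ⟨h.toHasSums, h.val_x, h.val_y, h.val_m⟩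

/-- The meaning of acceptance: the rotation and the translation satisfy their conditions, and the
fingerprints agree. -/
lemma HasPrints.accept_iff {X Y M : ℤ} {r : ℕ} {τ : Var → ℤ}
    (h : HasPrints F p n U X Y M r L L τ) (hp2 : 2 < p) (hlen : (labelled .A L).length = n)
    (hn : n < p) {ι₀ : F} (hι₀ : ι₀ * ι₀ = -1) (j : Fin 4) :
    (accept j).eval τ ≠ 0 ↔ (0 < M ∧ X ^ 2 + Y ^ 2 = M ^ 2 ∧ ∀ ι : F, ι * ι = -1 →
        PowCond n (labelled .A L) (labelled .B L) X Y M ι) ∧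
      IsTrans F n X Y M L j (τ (.tx j) - (2 * n * U : ℤ) ^ 19) (τ (.ty j) - (2 * n * U : ℤ) ^ 19)
        (τ (.ts j)) ∧
      ∀ ι : F, ι * ι = -1 →
        print n (labelled .A L) (M : F) ((rotRe j X Y : ℤ) + (rotIm j X Y : ℤ) * ι) r ι =
          print n (labelled .B L) (M : F) M r ι := by
  rw [accept, eval_mul, eval_mul, eval_mul, mul_ne_zero_iff, mul_ne_zero_iff, mul_ne_zero_iff,
    h.eval_rotCond hp2 hlen hn hι₀, h.toHasRot.eval_transCond hp2 hι₀, eval_eq', eval_eq',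
    ite_one_zero_ne_zero, ite_one_zero_ne_zero, and_assoc, and_assoc, h.val_x, h.val_y, h.val_m]
  refine and_congr_right fun _ => and_congr_right fun _ => ?_
  simp only [eval_var]
  rw [eq_iff_sub_emod_eq_zero (h.fx_mem j) h.gx_mem, eq_iff_sub_emod_eq_zero (h.fy_mem j) h.gy_mem,
    emod_eq_zero_and_iff hp2 hι₀]
  refine forall_congr' fun ι => forall_congr' fun hι => ?_
  rw [print, print, ← h.fx_fy ι hι j, ← h.gx_gy ι hι]
  refine Iff.trans (Eq.congr ?_ rfl) sub_eq_zero
  push_cast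
  ring

lemma toComplex_div (a c b : ℤ) :
    Point.toComplex ((a : ℚ) / b, (c : ℚ) / b) = ((a : ℂ) + c * I) / b := by
  rw [Point.toComplex]
  apply Complex.ext <;> simp [Complex.div_intCast_re, Complex.div_intCast_im]

/-- The answer that is stored in the variables. -/
def Says (σ : Var → ℤ) : Option (Point × Point) → Prop
  | none => σ .verdict = 0
  | some (ρ, t) => σ .verdict = 1 ∧
      IsFrac (σ (.out 0)) (σ (.out 1)) ρ.1 ∧ IsFrac (σ (.out 2)) (σ (.out 3)) ρ.2 ∧
      IsFrac (σ (.out 4)) (σ (.out 5)) t.1 ∧ IsFrac (σ (.out 6)) (σ (.out 7)) t.2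

/-- The state before the coin flips decides for which values of `r` the answer is wrong; there
are at most `n` of them for each of the four quarter turns. -/
lemma exists_exceptional_values (hL : ∀ d ∈ L, d.Bdd U) (hA : (labelled .A L).length = n)
    (hB : (labelled .B L).length = n) (hn0 : 0 < n) (hU : 0 < U)
    (hp : Heights U (2 * n * U : ℤ) p) (hg : GoodPrime n (2 * (2 * n * U) ^ 26) p)
    {ι₀ : F} (hι₀ : ι₀ * ι₀ = -1) {R : ℕ} (hR : R ≤ p) {σ : Var → ℤ}
    (hσ : HasProds F p n U L L σ) :
    ∃ E : Finset ℕ, E.card ≤ 4 * n ∧ ∀ r < R, r ∉ E → ∀ τ,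
      HasPrints F p n U (rotX.eval (afterRot σ)) (rotY.eval (afterRot σ)) (afterRot σ .sm) r L L τ →
      (∀ j, τ (.tx j) = afterTrans (afterRot σ) (.tx j) ∧
        τ (.ty j) = afterTrans (afterRot σ) (.ty j) ∧
        τ (.ts j) = afterTrans (afterRot σ) (.ts j)) →
      ∃ o, Says (blockVal finish τ) o ∧ IsSolution (pointsOf .A L) (pointsOf .B L) o := by
  have hV := hp.two_le
  have hV1 : (1 : ℤ) ≤ 2 * n * U := by linarith
  have hp2 : 2 < p := by
    have := hp.pow_lt (k := 1) (by norm_num); rw [pow_one] at this; omega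
  have hnV : (n : ℤ) ≤ 2 * n * U := by
    have : (1 : ℤ) ≤ U := by omega
    nlinarith
  have hnp : n < p := by
    have := hp.pow_lt (k := 1) (by norm_num); rw [pow_one] at this; omega
  have hσ' : HasProds F p n U L L (afterRot σ) := hσ.afterRot
  obtain ⟨bX, bY, bM⟩ := afterRot_bdd hσ.val_n hσ.val_u
  have hrot : HasRot F p n U (rotX.eval (afterRot σ)) (rotY.eval (afterRot σ)) (afterRot σ .sm) L
    (afterRot σ) := ⟨hσ'.toHasSums, rfl, rfl, rfl⟩
  -- the candidates, as numbers that do not depend on `r`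
  have hcond := hσ'.eval_rotCond hp2 hA hnp hι₀
  have bT := afterTrans_bdd hσ'.val_n hσ'.val_u
  have hfound := @HasProds.exists_rot F _ p _ n U L σ hσ hp2 hA hnp ι₀ hι₀
  have hfound' := @HasRot.exists_trans F _ p _ n U L _ _ _ _ hrot hp2 ι₀ hι₀
  generalize rotX.eval (afterRot σ) = X at *
  generalize rotY.eval (afterRot σ) = Y at *
  generalize afterRot σ .sm = M at *
  have hLA : ∀ d ∈ labelled .A L, d.Bdd U := fun d hd => hL d (List.mem_of_mem_filter hd)
  have hLB : ∀ d ∈ labelled .B L, d.Bdd U := fun d hd => hL d (List.mem_of_mem_filter hd)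
  have hone : ∀ k : ℕ, (2 * n * U : ℤ) ^ k + 1 ≤ (2 * n * U : ℤ) ^ (k + 1) := fun k => by
    have : (1 : ℤ) ≤ (2 * n * U : ℤ) ^ k := one_le_pow₀ hV1
    rw [pow_succ]; nlinarith
  have hisRot : 0 < M → X ^ 2 + Y ^ 2 = M ^ 2 → IsRot ((2 * n * U : ℤ) ^ 13) X Y M := fun h0 h =>
    ⟨h0, bM.trans (hone 12), bX.trans (hone 12), bY.trans (hone 12), h⟩
  have hV20 : (2 * n * U : ℤ) ^ 20 ≤ (2 * n * U : ℤ) ^ 21 := pow_le_pow_right₀ hV1 (by norm_num)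
  -- the exceptional values for one quarter turn
  have hE : ∀ j : Fin 4, ∃ E : Finset ℕ, E.card ≤ n ∧ ∀ r < R, r ∉ E →
      0 < M → X ^ 2 + Y ^ 2 = M ^ 2 →
      IsTrans F n X Y M L j (afterTrans (afterRot σ) (.tx j) - (2 * n * U : ℤ) ^ 19)
        (afterTrans (afterRot σ) (.ty j) - (2 * n * U : ℤ) ^ 19)
        (afterTrans (afterRot σ) (.ts j)) →
      print n (labelled .A L) (M : F) ((rotRe j X Y : ℤ) + (rotIm j X Y : ℤ) * ι₀) r ι₀ =
          print n (labelled .B L) (M : F) M r ι₀ →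
      Cong (labelled .A L) (labelled .B L) (((rotRe j X Y : ℤ) + (rotIm j X Y : ℤ) * I) / M)
        (((afterTrans (afterRot σ) (.tx j) - (2 * n * U : ℤ) ^ 19 : ℤ) +
          (afterTrans (afterRot σ) (.ty j) - (2 * n * U : ℤ) ^ 19 : ℤ) * I) /
          (afterTrans (afterRot σ) (.ts j) : ℤ)) := by
    intro j
    obtain ⟨b1, b2, b3⟩ := bT j
    by_cases hc : 0 < M ∧ X ^ 2 + Y ^ 2 = M ^ 2 ∧
      IsTrans F n X Y M L j (afterTrans (afterRot σ) (.tx j) - (2 * n * U : ℤ) ^ 19)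
        (afterTrans (afterRot σ) (.ty j) - (2 * n * U : ℤ) ^ 19) (afterTrans (afterRot σ) (.ts j)) ∧
      ¬ Cong (labelled .A L) (labelled .B L) (((rotRe j X Y : ℤ) + (rotIm j X Y : ℤ) * I) / M)
        (((afterTrans (afterRot σ) (.tx j) - (2 * n * U : ℤ) ^ 19 : ℤ) +
          (afterTrans (afterRot σ) (.ty j) - (2 * n * U : ℤ) ^ 19 : ℤ) * I) /
          (afterTrans (afterRot σ) (.ts j) : ℤ))
    · obtain ⟨h1, h2, h3, h4⟩ := hc
      obtain ⟨E, hE, hE'⟩ := exists_finset_of_not_cong hLA hLB hp ((hisRot h1 h2).turn j) h3.1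
        ((b3.trans (hone 19)).trans hV20) ((b1.trans (hone 19)).trans hV20)
        ((b2.trans (hone 19)).trans hV20)
        (hB.trans hA.symm) (by omega) (by rw [hA]; exact hnV) hι₀ (by rw [hA]; exact h3.2 ι₀ hι₀)
        h4 hR
      rw [hA] at hE hE'
      exact ⟨E, hE, fun r hr hrE _ _ _ he => absurd (hE' r hr he) hrE⟩
    · refine ⟨∅, by simp, fun r _ _ h1 h2 h3 _ => ?_⟩
      by_contra h4
      exact hc ⟨h1, h2, h3, h4⟩
  choose E hE hE' using hE
  refine ⟨Finset.univ.biUnion E, ?_, fun r hr hrE τ hτ hτT => ?_⟩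
  · refine Finset.card_biUnion_le.trans ((Finset.sum_le_card_nsmul _ _ n fun j _ => hE j).trans ?_)
    simp
  have hacc := hτ.accept_iff hp2 hA hnp hι₀
  rcases finish_spec τ with ⟨hno, hverd⟩ | ⟨j, hj, hverd, hout⟩
  -- a congruence is never rejected
  · refine ⟨none, hverd, ?_⟩
    rintro ⟨ρ, t, hcong⟩
    have hcong : Cong (labelled .A L) (labelled .B L) ρ t := hcong
    have hne : labelled .A L ≠ [] := by
      intro h0; rw [h0] at hA; simp at hA; omega
    obtain ⟨X', Y', M', hr', hpow'⟩ := hcong.exists_candidate (F := F) hLA hLB hp hne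
    rw [hA] at hpow'
    obtain ⟨h1, h2, h3⟩ := hcond.1 (hfound hr' hpow')
    have hr := hisRot h1 h2
    obtain ⟨j, t', hj⟩ := hcong.exists_turn hLA hLB hp (by rw [hA]; exact hg)
      (by push_cast; apply le_of_eq; ring) (by rw [hA]; exact hnV) hne hr hι₀
      (by rw [hA]; exact h3 ι₀ hι₀)
    obtain ⟨⟨T₁, T₂, S, k1, k2, k3, k4, k5⟩, k6⟩ := hj.accepted (F := F) hLA hLB hp (hr.turn j) hne
    rw [hA] at k5 k6
    have hT := hfound' j k2 k3 k4 ⟨k1, k5⟩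
    refine (hacc j).2 ⟨⟨h1, h2, h3⟩, ?_, fun ι hι => k6 ι hι _⟩ (hno j)
    rw [(hτT j).1, (hτT j).2.1, (hτT j).2.2]
    exact hT
  -- an accepted pair is a congruence, as `r` is not exceptional
  · obtain ⟨⟨h1, h2, -⟩, h3, h4⟩ := (hacc j).1 (by rw [hj]; exact one_ne_zero)
    rw [(hτT j).1, (hτT j).2.1, (hτT j).2.2] at h3
    have hc := hE' j r hr (fun h => hrE (Finset.mem_biUnion.2 ⟨j, Finset.mem_univ _, h⟩)) h1 h2 h3
      (h4 ι₀ hι₀)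
    have o0 : blockVal finish τ (.out 0) = rotRe j X Y := by
      rw [hout]; exact (eval_rotRe j _ _ τ).trans (by rw [hτ.val_x, hτ.val_y])
    have o2 : blockVal finish τ (.out 2) = rotIm j X Y := by
      rw [hout]; exact (eval_rotIm j _ _ τ).trans (by rw [hτ.val_x, hτ.val_y])
    have o1 : blockVal finish τ (.out 1) = M := by rw [hout]; exact hτ.val_m
    have o3 : blockVal finish τ (.out 3) = M := by rw [hout]; exact hτ.val_m
    have o4 : blockVal finish τ (.out 4) =
        afterTrans (afterRot σ) (.tx j) - (2 * n * U : ℤ) ^ 19 := by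
      rw [hout, ← (hτT j).1, ← eval_base_pow hτ.val_n hτ.val_u]; rfl
    have o6 : blockVal finish τ (.out 6) =
        afterTrans (afterRot σ) (.ty j) - (2 * n * U : ℤ) ^ 19 := by
      rw [hout, ← (hτT j).2.1, ← eval_base_pow hτ.val_n hτ.val_u]; rfl
    have o5 : blockVal finish τ (.out 5) = afterTrans (afterRot σ) (.ts j) := by
      rw [hout]; exact (hτT j).2.2
    have o7 : blockVal finish τ (.out 7) = afterTrans (afterRot σ) (.ts j) := by
      rw [hout]; exact (hτT j).2.2
    rw [← toComplex_div, ← toComplex_div] at hc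
    exact ⟨some (_, _), ⟨hverd, by rw [o0, o1]; exact ⟨h1.ne', rfl⟩,
      by rw [o2, o3]; exact ⟨h1.ne', rfl⟩, by rw [o4, o5]; exact ⟨h3.1.ne', rfl⟩,
      by rw [o6, o7]; exact ⟨h3.1.ne', rfl⟩⟩, hc⟩

end correctness

/-! ### The algorithm and its runs -/

/-- The number whose binary digits are the first `b` coins. -/
def coinVal (ω : ℕ → Bool) : ℕ → ℕ
  | 0 => 0
  | b + 1 => 2 * coinVal ω b + if ω b then 1 else 0

lemma coinVal_lt (ω : ℕ → Bool) (b : ℕ) : coinVal ω b < 2 ^ b := by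
  induction b with
  | zero => simp [coinVal]
  | succ b ih => rw [coinVal, pow_succ]; split_ifs <;> omega

/-- The loop that flips the coins. -/
noncomputable def flips (D : ℕ) : Cmd (Reg Var D) :=
  .loop (.inl .go) (.seq (.instr (.flip (.inl .coin))) (block D useCoin))

/-- The state of the loop `flips` after `i` coins; `a` is the state before the loop. -/
structure AfterFlips (K : ℤ) (n : ℕ) (a : Config Var) (i : ℕ) (a' : Config Var) : Prop where
  bdd : Bdd K a'.reg
  tape : a'.tape = a.tape
  coins : a'.coins = fun k => a.coins (k + i)
  val_r : a'.reg .r = coinVal a.coins i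
  val_m : a'.reg .m = 2 ^ i
  val_go : a'.reg .go = if 2 ^ i < 4 * n ^ 2 then 1 else 0
  frame : ∀ x, x ≠ .r → x ≠ .m → x ≠ .go → x ≠ .coin → a'.reg x = a.reg x

lemma AfterFlips.step {K : ℤ} (hK : 2 ≤ K) {n i : ℕ} {a a' : Config Var}
    (h : AfterFlips K n a i a') (hn : a.reg .n = n) (hi : (2 : ℤ) ^ (i + 1) ≤ K) :
    Bdd K ((Instr.flip Var.coin).step a').reg ∧
      AfterFlips K n a (i + 1) { (Instr.flip Var.coin).step a' with
        reg := blockVal useCoin ((Instr.flip Var.coin).step a').reg } := by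
  have hc : a'.coins 0 = a.coins i := by rw [h.coins]; simp
  have hb : Bdd K ((Instr.flip Var.coin).step a').reg :=
    update_bdd h.bdd _ (by split_ifs <;> simp <;> omega)
  have er : blockVal useCoin ((Instr.flip Var.coin).step a').reg .r = coinVal a.coins (i + 1) := by
    simp [blockVal, useCoin, Instr.step, h.val_r, hc, coinVal]
  have em : blockVal useCoin ((Instr.flip Var.coin).step a').reg .m = 2 ^ (i + 1) := by
    simp [blockVal, useCoin, Instr.step, h.val_m, pow_succ']
  have eg : blockVal useCoin ((Instr.flip Var.coin).step a').reg .go =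
      if 2 ^ (i + 1) < 4 * n ^ 2 then 1 else 0 := by
    have : a'.reg .n = n :=
      (h.frame .n (by decide) (by decide) (by decide) (by decide)).trans hn
    simp only [blockVal, useCoin, Instr.step, eval_lt', eval_mul, eval_var, eval_power,
      eval_ofNat, Function.update_of_ne (show Var.m ≠ .coin by decide),
      Function.update_of_ne (show Var.n ≠ .coin by decide), h.val_m, this, ← pow_succ']
    norm_cast
  have hother : ∀ x, x ≠ .r → x ≠ .m → x ≠ .go →
      blockVal useCoin ((Instr.flip Var.coin).step a').reg x =
        ((Instr.flip Var.coin).step a').reg x := by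
    intro x h1 h2 h3
    cases x <;> first | rfl | contradiction
  refine ⟨hb, fun x => ?_, h.tape, ?_, er, em, eg, fun x h1 h2 h3 h4 => ?_⟩
  · by_cases h1 : x = .r
    · have := coinVal_lt a.coins (i + 1)
      rw [h1]
      simp only [er]
      rw [abs_of_nonneg (by positivity)]
      have : (coinVal a.coins (i + 1) : ℤ) < 2 ^ (i + 1) := by exact_mod_cast this
      omega
    by_cases h2 : x = .m
    · rw [h2]; simp only [em]; rwa [abs_of_nonneg (by positivity)]
    by_cases h3 : x = .go
    · rw [h3]; simp only [eg]; split_ifs <;> simp <;> omega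
    simp only [hother x h1 h2 h3]
    exact hb x
  · funext k
    simp only [Instr.step, h.coins]
    congr 1
    omega
  · simp only [hother x h1 h2 h3]
    exact (Function.update_of_ne h4 _ _).trans (h.frame x h1 h2 h3 h4)

/-- The loop flips coins until there are at least `4 n²` possible values of `r`. -/
lemma does_flips {D : ℕ} {M K : ℤ} (hK : 2 ≤ K) (hM : K ^ blockWt useCoin ≤ M) (hM1 : 1 ≤ M)
    (hD : depthBlock useCoin ≤ D) {n b : ℕ} (hb : 4 * n ^ 2 ≤ 2 ^ b)
    (hlt : ∀ i < b, 2 ^ i < 4 * n ^ 2) (hbK : (2 : ℤ) ^ b ≤ K) {a : Config Var}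
    (hn : a.reg .n = n) (ha : AfterFlips K n a 0 a) :
    ∃ a', Does M (flips D) a a' ∧ AfterFlips K n a b a' := by
  have key : ∀ j i, i + j = b → ∀ a', AfterFlips K n a i a' →
      ∃ a'', Does M (flips D) a' a'' ∧ AfterFlips K n a b a'' := by
    intro j
    induction j with
    | zero =>
      rintro i rfl a' h
      exact ⟨a', Does.loop_done (by rw [h.val_go, if_neg (by simpa using hb)]), h⟩
    | succ j ih =>
      intro i hi a' h
      have hgo : a'.reg .go ≠ 0 := by rw [h.val_go, if_pos (hlt i (by omega))]; exact one_ne_zero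
      obtain ⟨hb1, h1⟩ := h.step hK hn
        ((pow_le_pow_right₀ (by norm_num) (by omega : i + 1 ≤ b)).trans hbK)
      obtain ⟨a'', d, h2⟩ := ih (i + 1) (by omega) _ h1
      exact ⟨a'', Does.loop_step hgo ((does_flip hM1 _ _).seq (does_block hK hb1 hM hD)) d, h2⟩
  exact key b 0 (by omega) a ha

/-- The number of temporary registers of the program. -/
noncomputable def depth : ℕ :=
  depthBlock start + depthBlock sums + depthBlock prods + depthBlock findX + depthBlock findY +
    depthBlock findM + depthBlock findTX + depthBlock findTY + depthBlock findTS +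
    depthBlock useCoin + depthBlock prints + depthBlock finish

/-- A common bound for the exponents `blockWt` of all blocks. -/
noncomputable def weight : ℕ :=
  1 + blockWt start + blockWt sums + blockWt prods + blockWt findX + blockWt findY +
    blockWt findM + blockWt findTX + blockWt findTY + blockWt findTS +
    blockWt useCoin + blockWt prints + blockWt finish

/-- `pass` for the variables of the program. -/
noncomputable abbrev passCmd (f : Var → Ex Var) : Cmd (Reg Var depth) :=
  pass depth .lab .xn .xd .yn .yd f

/-- The program: the modulus is chosen; two passes collect the sums and the products; the candidates
for the rotation and for the translations are found; the coins are flipped; and the third pass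
collects the fingerprints, which decide the answer. -/
noncomputable def program : Cmd (Reg Var depth) :=
  .seq (block depth start) <| .seq (passCmd sums) <| .seq (passCmd prods) <|
  .seq (block depth findX) <| .seq (block depth findY) <| .seq (block depth findM) <|
  .seq (block depth findTX) <| .seq (block depth findTY) <| .seq (block depth findTS) <|
  .seq (flips depth) <| .seq (passCmd prints) (block depth finish)

/-- The program as a streaming algorithm for congruence identification. -/
noncomputable def algorithm : Algorithm where
  ι := Reg Var depth
  body := program
  regN := .inl .n
  regU := .inl .u
  verdict := .inl .verdict
  out := fun i => .inl (.out i)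

/-- The `i`-th block, when all values so far are at most `V ^ W ^ i`. -/
lemma does_block_pow {V : ℤ} (hV : 2 ≤ V) {W k i i' : ℕ} (hi : i + 1 = i') (hik : i' ≤ k)
    {f : Var → Ex Var} (hf : blockWt f ≤ W) (hW : 1 ≤ W) (hD : depthBlock f ≤ depth)
    (t : List (Option Item)) (c : ℕ → Bool) {σ : Var → ℤ} (h : Bdd (V ^ W ^ i) σ) :
    Does (V ^ W ^ k) (block depth f) ⟨σ, t, c⟩ ⟨blockVal f σ, t, c⟩ ∧
      Bdd (V ^ W ^ i') (blockVal f σ) := by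
  subst hi
  have hK : 2 ≤ V ^ W ^ i := two_le_pow hV (Nat.one_le_pow _ _ hW)
  have hV1 : 1 ≤ V := by omega
  have h1 : (V ^ W ^ i) ^ blockWt f ≤ V ^ W ^ (i + 1) := by
    rw [← pow_mul, pow_succ]
    exact pow_le_pow_right₀ hV1 (Nat.mul_le_mul_left _ hf)
  have h2 : V ^ W ^ (i + 1) ≤ V ^ W ^ k :=
    pow_le_pow_right₀ hV1 (Nat.pow_le_pow_right hW (by omega))
  exact ⟨does_block hK (a := ⟨σ, t, c⟩) h (h1.trans h2) hD,
    fun x => (Bdd.blockVal hK h f x).trans h1⟩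

/-- A pass does not increase the bound for the variables, as its values are residues. -/
lemma does_pass_pow {V : ℤ} (hV : 2 ≤ V) {W k i : ℕ} (hik : i < k) {f : Var → Ex Var}
    (hf : blockWt f ≤ W) (hW : 1 ≤ W) (hD : depthBlock f ≤ depth) (hred : Reduces f) {p : ℤ}
    (hp0 : 0 < p) {L : List Item} {U : ℤ} (hU : U ≤ V ^ W ^ i) (hL : ∀ d ∈ L, d.Bdd U)
    (t : List (Option Item)) (c : ℕ → Bool) {σ : Var → ℤ}
    (ha : Bdd (V ^ W ^ i) σ) (hap : σ .p = p) :
    Does (V ^ W ^ k) (passCmd f) ⟨σ, L.map some ++ none :: t, c⟩ ⟨passItems f L σ, t, c⟩ ∧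
      Bdd (V ^ W ^ i) (passItems f L σ) := by
  have hK : 2 ≤ V ^ W ^ i := two_le_pow hV (Nat.one_le_pow _ _ hW)
  have hV1 : 1 ≤ V := by omega
  have h1 : (V ^ W ^ i) ^ blockWt f ≤ V ^ W ^ k := by
    rw [← pow_mul]
    refine pow_le_pow_right₀ hV1 ((Nat.mul_le_mul_left _ hf).trans ?_)
    rw [← pow_succ]
    exact Nat.pow_le_pow_right hW (by omega)
  have h2 : V ^ W ^ i ≤ V ^ W ^ k := pow_le_pow_right₀ hV1 (Nat.pow_le_pow_right hW hik.le)
  have hpK : p ≤ V ^ W ^ i := by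
    have := ha .p
    rw [hap] at this
    exact (le_abs_self p).trans this
  have hL' : ∀ d ∈ L, d.Bdd (V ^ W ^ i) := fun d hd => by
    obtain ⟨k1, k2, k3, k4⟩ := hL d hd
    exact ⟨k1.trans hU, k2.trans hU, k3.trans hU, k4.trans hU⟩
  exact ⟨does_pass .lab .xn .xd .yn .yd hK h1 h2 hD (fun σ => Bdd (V ^ W ^ i) σ ∧ σ .p = p)
    (fun _ h => h.1) hL' (fun d hd σ h => hred.bdd hK hp0 hpK (hL' d hd) h)
      (a := ⟨σ, L.map some ++ none :: t, c⟩) ⟨ha, hap⟩ rfl,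
    (hred.passItems_bdd hK hp0 hpK hL' ⟨ha, hap⟩).1⟩

lemma item_bdd_of_boundedQ {U : ℕ} {d : Item} (h1 : d.2.1 ∈ boundedQ U) (h2 : d.2.2 ∈ boundedQ U)
    (hU : 1 ≤ U) : d.Bdd U := by
  have key : ∀ x ∈ boundedQ U, |x.num| ≤ U ∧ (x.den : ℤ) ≤ U := by
    have pos : ∀ a ∈ Finset.Icc 1 U, ∀ c ∈ Finset.Icc 1 U,
        |((a : ℚ) / c).num| ≤ U ∧ ((((a : ℚ) / c).den : ℕ) : ℤ) ≤ U := by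
      intro a ha c hc
      rw [Finset.mem_Icc] at ha hc
      have e : ((a : ℚ) / c) = ((a : ℤ) : ℚ) / ((c : ℤ) : ℚ) := by push_cast; rfl
      rw [e, ← Rat.divInt_eq_div]
      have d1 := Int.le_of_dvd (by omega) (abs_dvd _ _ |>.2
        (Rat.num_dvd (a : ℤ) (b := (c : ℤ)) (by omega)))
      have d2 := Int.le_of_dvd (by omega) (Rat.den_dvd (a : ℤ) (c : ℤ))
      have ha' : (a : ℤ) ≤ U := by exact_mod_cast ha.2
      have hc' : (c : ℤ) ≤ U := by exact_mod_cast hc.2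
      exact ⟨d1.trans ha', d2.trans hc'⟩
    rintro x (rfl | ⟨a, ha, c, hc, rfl | rfl⟩)
    · simp; omega
    · exact pos a ha c hc
    · have := pos a ha c hc
      rwa [Rat.num_neg_eq_neg_num, abs_neg, Rat.den_neg_eq_den]
  exact ⟨(key _ h1).1, (key _ h1).2, (key _ h2).1, (key _ h2).2⟩

lemma passes_three (L : List Item) : passes 3 L =
    L.map some ++ none :: (L.map some ++ none :: (L.map some ++ none :: [])) := by
  simp [passes, List.replicate]

lemma init_inr (k n U : ℕ) (L : List Item) (ω : ℕ → Bool) (x : Fin (depth + 1)) :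
    (algorithm.init k n U L ω).reg (.inr x) = 0 := by
  have h1 : (Sum.inr x : Reg Var depth) ≠ algorithm.regN := Sum.inr_ne_inl
  have h2 : (Sum.inr x : Reg Var depth) ≠ algorithm.regU := Sum.inr_ne_inl
  exact (Function.update_of_ne h2 (U : ℤ)
    (Function.update (fun _ => (0 : ℤ)) algorithm.regN n)).trans
    (Function.update_of_ne h1 (n : ℤ) (fun _ => (0 : ℤ)))

/-- The run of the program on an instance: the answer is wrong only if the coins form one of `4 n`
numbers of `b` digits, where `2 ^ b ≥ 4 n²`. -/
lemma exists_run {n U : ℕ} (hn : 2 ≤ n) (hU : 1 ≤ U) {L : List Item} (hL : IsInstance n U L) :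
    ∃ (b : ℕ) (E : Finset ℕ), E.card ≤ 4 * n ∧ 4 * n ^ 2 ≤ 2 ^ b ∧ ∀ ω, ∃ s m,
      algorithm.Run 3 n U L ω s m ∧
      m ≤ memBound (Reg Var depth) ((2 * n * U : ℤ) ^ weight ^ 8) ∧
      (coinVal ω b ∉ E → ∃ o, algorithm.Answers s o ∧
        IsSolution (pointsOf .A L) (pointsOf .B L) o) := by
  obtain ⟨hA, hB, hLQ⟩ := hL
  have hLb : ∀ d ∈ L, d.Bdd U := fun d hd => item_bdd_of_boundedQ (hLQ d hd).1 (hLQ d hd).2 hU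
  set V : ℤ := 2 * n * U with hVdef
  have hnU : 1 ≤ 2 * n * U := by nlinarith
  have hV : 2 ≤ V := by
    have : 2 ≤ 2 * n * U := by nlinarith
    rw [hVdef]; exact_mod_cast this
  have hV1 : 1 ≤ V := by omega
  have hnV : 2 * (n : ℤ) ≤ V := by
    rw [hVdef]; exact_mod_cast Nat.le_mul_of_pos_right (2 * n) hU
  have hUV : 2 * (U : ℤ) ≤ V := by
    have : 2 * U ≤ 2 * n * U := by nlinarith
    rw [hVdef]; exact_mod_cast this
  -- the variables at the start
  set σ₀ : Var → ℤ := Function.update (Function.update (fun _ => 0) .n (n : ℤ)) .u (U : ℤ) with hσ₀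
  have h0n : σ₀ .n = n := by simp [hσ₀]
  have h0u : σ₀ .u = U := by simp [hσ₀]
  have h0 : ∀ x, x ≠ .n → x ≠ .u → σ₀ x = 0 := fun x h1 h2 => by simp [hσ₀, h1, h2]
  have b0 : Bdd V σ₀ := by
    refine update_bdd (update_bdd (fun _ => by simp; omega) _ ?_) _ ?_ <;>
      rw [abs_of_nonneg (by positivity)] <;> omega
  obtain ⟨p, h1p, hlt, hg⟩ := exists_start_p h0n h0u hnU
  have hheights : Heights U V p := ⟨by positivity, hV, hUV, by
    rw [hVdef]; exact_mod_cast hlt⟩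
  clear hlt
  have hp0 : (0 : ℤ) < p := by exact_mod_cast hg.prime.pos
  -- a field of characteristic `p` with a square root of `-1`
  have : Fact p.Prime := ⟨hg.prime⟩
  let F := AlgebraicClosure (ZMod p)
  have : CharP F p := inferInstance
  obtain ⟨ι₀, hι₀⟩ := IsAlgClosed.exists_pow_nat_eq (-1 : F) (n := 2) (by norm_num)
  rw [sq] at hι₀
  -- the variables before the coin flips
  set σ₁ := blockVal start σ₀ with hσ₁
  have s1 : HasSums F p n U [] σ₁ := by
    have e (x) (hx : start x = v x) (h1 : x ≠ .n) (h2 : x ≠ .u) : σ₁ x = 0 :=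
      (blockVal_self hx σ₀).trans (h0 x h1 h2)
    refine ⟨h0n, h0u, h1p, fun ι _ => ?_, fun ι _ => ?_⟩
    · rw [e .sax rfl (by decide) (by decide), e .say rfl (by decide) (by decide)]
      simp [labelled, sumRed]
    · rw [e .sbx rfl (by decide) (by decide), e .sby rfl (by decide) (by decide)]
      simp [labelled, sumRed]
  set σ₂ := passItems sums L σ₁ with hσ₂
  have s2 : HasSums F p n U L σ₂ := hasSums_passItems hg.prime hLb hheights.lt_prime s1
  have f2 {x : Var} (h1 : sums x = v x) (h2 : x ∉ itemVars) : σ₂ x = σ₁ x :=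
    passItems_of_notMem h1 h2 L σ₁
  have q2 : HasProds F p n U L [] σ₂ := by
    have e1 : σ₂ .k = 0 := (f2 rfl (by decide)).trans (h0 .k (by decide) (by decide))
    have e2 : σ₂ .qax = 1 := f2 rfl (by decide)
    have e3 : σ₂ .qay = 0 := (f2 rfl (by decide)).trans (h0 .qay (by decide) (by decide))
    have e4 : σ₂ .qbx = 1 := f2 rfl (by decide)
    have e5 : σ₂ .qby = 0 := (f2 rfl (by decide)).trans (h0 .qby (by decide) (by decide))
    exact ⟨s2, by rw [e1], by rwa [e1], fun ι _ => by simp [e1, labelled],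
      fun ι _ => by simp [e2, e3, labelled], fun ι _ => by simp [e4, e5, labelled]⟩
  set σ₃ := passItems prods L σ₂ with hσ₃
  have q3 : HasProds F p n U L L σ₃ := hasProds_passItems hg.prime hLb hheights.lt_prime q2
  have f3 {x : Var} (h1 : prods x = v x) (h2 : x ∉ itemVars) : σ₃ x = σ₂ x :=
    passItems_of_notMem h1 h2 L σ₂
  set σ₅ := afterTrans (afterRot σ₃) with hσ₅
  have f5 (x : Var) (h1 : x ≠ .sx) (h2 : x ≠ .sy) (h3 : x ≠ .sm)
      (h4 : ∀ j, x ≠ .tx j ∧ x ≠ .ty j ∧ x ≠ .ts j) : σ₅ x = σ₃ x :=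
    (afterTrans_of_notMem _ h4).trans (afterRot_of_notMem _ h1 h2 h3)
  have g5 (x : Var) (h1 : sums x = v x) (h2 : prods x = v x) (h3 : x ∉ itemVars) (h1 : x ≠ .sx)
      (h2 : x ≠ .sy) (h3 : x ≠ .sm) (h4 : ∀ j, x ≠ .tx j ∧ x ≠ .ty j ∧ x ≠ .ts j) :
      σ₅ x = σ₁ x := by
    rw [f5 x h1 h2 h3 h4, f3, f2] <;> assumption
  -- the number of coins
  set b := Nat.clog 2 (4 * n ^ 2) with hb
  have hb1 : 4 * n ^ 2 ≤ 2 ^ b := Nat.le_pow_clog (by norm_num) _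
  have hb2 : ∀ i < b, 2 ^ i < 4 * n ^ 2 := fun i hi => (Nat.lt_clog_iff_pow_lt (by norm_num)).1 hi
  have hn4 : 1 < 4 * n ^ 2 := by nlinarith
  have hbp : 2 ^ b ≤ p := by
    have hb0 : b ≠ 0 := by
      intro h
      rw [h] at hb1
      nlinarith
    have h1 := hb2 (b - 1) (by omega)
    have h2 : 2 ^ b = 2 * 2 ^ (b - 1) := by rw [← pow_succ', Nat.sub_add_cancel (by omega)]
    have h3 := hheights.pow_lt (k := 3) (by norm_num)
    have h4 : 8 * (n : ℤ) ^ 2 ≤ V ^ 3 := by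
      have : (2 * (n : ℤ)) ^ 2 ≤ V ^ 2 := pow_le_pow_left₀ (by positivity) hnV 2
      have : V ^ 2 * 2 ≤ V ^ 2 * V := by gcongr
      rw [pow_succ V 2]; linarith
    have h5 : 8 * n ^ 2 < p := by exact_mod_cast h4.trans_lt h3
    omega
  obtain ⟨E, hE, hE'⟩ := exists_exceptional_values hLb hA hB (by omega) (by omega) hheights hg hι₀
    hbp q3
  refine ⟨b, E, hE, hb1, fun ω => ?_⟩
  -- the run
  have w1 : 1 ≤ weight := by unfold weight; omega
  have w0 (i : ℕ) : weight ^ i ≠ 0 := pow_ne_zero _ (Nat.one_le_iff_ne_zero.1 w1)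
  set M := V ^ weight ^ 8 with hM
  have hVM : V ≤ M := le_self_pow₀ hV1 (w0 _)
  set T : List (Option Item) := L.map some ++ none :: [] with hT
  have hUK (i : ℕ) : (U : ℤ) ≤ V ^ weight ^ i :=
    (by omega : (U : ℤ) ≤ V).trans (le_self_pow₀ hV1 (w0 _))
  obtain ⟨d1, b1⟩ := does_block_pow hV (k := 8) (i := 0) (i' := 1) (W := weight) rfl (by norm_num)
    (f := start) (by unfold weight; omega) w1 (by unfold depth; omega) (passes 3 L) ω
    (by simpa using b0)
  rw [passes_three, ← hσ₁] at d1
  rw [← hσ₁] at b1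
  obtain ⟨d2, b2⟩ := does_pass_pow hV (k := 8) (i := 1) (W := weight) (by norm_num) (f := sums)
    (by unfold weight; omega) w1 (by unfold depth; omega) reduces_sums hp0 (hUK 1) hLb
    (L.map some ++ none :: T) ω b1 h1p
  rw [← hσ₂] at d2 b2
  obtain ⟨d3, b3⟩ := does_pass_pow hV (k := 8) (i := 1) (W := weight) (by norm_num) (f := prods)
    (by unfold weight; omega) w1 (by unfold depth; omega) reduces_prods hp0 (hUK 1) hLb
    T ω b2 s2.val_p
  rw [← hσ₃] at d3 b3
  obtain ⟨d4, b4⟩ := does_block_pow hV (k := 8) (W := weight) (i' := 2) rfl (by norm_num)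
    (f := findX)
    (by unfold weight; omega) w1 (by unfold depth; omega) T ω b3
  obtain ⟨d5, b5⟩ := does_block_pow hV (k := 8) (W := weight) (i' := 3) rfl (by norm_num)
    (f := findY)
    (by unfold weight; omega) w1 (by unfold depth; omega) T ω b4
  obtain ⟨d6, b6⟩ := does_block_pow hV (k := 8) (W := weight) (i' := 4) rfl (by norm_num)
    (f := findM)
    (by unfold weight; omega) w1 (by unfold depth; omega) T ω b5
  obtain ⟨d7, b7⟩ := does_block_pow hV (k := 8) (W := weight) (i' := 5) rfl (by norm_num)
    (f := findTX)
    (by unfold weight; omega) w1 (by unfold depth; omega) T ω b6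
  obtain ⟨d8, b8⟩ := does_block_pow hV (k := 8) (W := weight) (i' := 6) rfl (by norm_num)
    (f := findTY)
    (by unfold weight; omega) w1 (by unfold depth; omega) T ω b7
  obtain ⟨d9, b9⟩ := does_block_pow hV (k := 8) (W := weight) (i' := 7) rfl (by norm_num)
    (f := findTS)
    (by unfold weight; omega) w1 (by unfold depth; omega) T ω b8
  have b9 : Bdd (V ^ weight ^ 7) σ₅ := b9
  have hK7 : 2 ≤ V ^ weight ^ 7 := two_le_pow hV (Nat.one_le_pow _ _ w1)
  have h5p : σ₅ .p = p :=
    (g5 .p rfl rfl (by decide) (by decide) (by decide) (by decide) (by decide)).trans h1p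
  have hpK : (p : ℤ) ≤ V ^ weight ^ 7 := by
    have := b9 .p
    rw [h5p] at this
    exact (le_abs_self _).trans this
  obtain ⟨a', d10, k⟩ := does_flips (D := depth) (M := M) hK7 (by
      rw [← pow_mul, hM, pow_succ weight 7]
      exact pow_le_pow_right₀ hV1 (Nat.mul_le_mul_left _ (by unfold weight; omega)))
    (hV1.trans hVM) (by unfold depth; omega) hb1 hb2
    ((by exact_mod_cast hbp : (2 : ℤ) ^ b ≤ p).trans hpK) (a := ⟨σ₅, T, ω⟩)
    (by
      exact (g5 .n rfl rfl (by decide) (by decide) (by decide) (by decide) (by decide)).trans h0n)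
    ⟨b9, rfl, rfl,
      (g5 .r rfl rfl (by decide) (by decide) (by decide) (by decide) (by decide)).trans
        (h0 .r (by decide) (by decide)),
      g5 .m rfl rfl (by decide) (by decide) (by decide) (by decide) (by decide),
      (g5 .go rfl rfl (by decide) (by decide) (by decide) (by decide) (by decide)).trans (by
        rw [pow_zero, if_pos hn4]; rfl),
      fun _ _ _ _ _ => rfl⟩
  obtain ⟨σ₆, t₆, c₆⟩ := a'
  obtain ⟨b10, ht₆, -, hr, -, -, f6⟩ := k
  simp only at b10 ht₆ hr f6
  subst ht₆
  have h6p : σ₆ .p = p := (f6 .p (by decide) (by decide) (by decide) (by decide)).trans h5p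
  obtain ⟨d11, b11⟩ := does_pass_pow hV (k := 8) (i := 7) (W := weight) (by norm_num) (f := prints)
    (by unfold weight; omega) w1 (by unfold depth; omega) reduces_prints hp0 (hUK 7) hLb
    [] c₆ b10 h6p
  obtain ⟨d12, -⟩ := does_block_pow hV (k := 8) (i' := 8) (W := weight) rfl (by norm_num)
    (f := finish) (by unfold weight; omega) w1 (by unfold depth; omega) [] c₆ b11
  have hinit : Represents M (algorithm.init 3 n U L ω)
      ⟨σ₀, L.map some ++ none :: (L.map some ++ none :: T), ω⟩ := by
    have hreg : ∀ x, (algorithm.init 3 n U L ω).reg (.inl x) = σ₀ x :=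
      update_inl (update_inl (fun _ => rfl) _ _) _ _
    refine ⟨fun r => ?_, hreg, passes_three L, rfl⟩
    rcases r with x | x
    · rw [hreg]; exact (b0 x).trans hVM
    · have : (algorithm.init 3 n U L ω).reg (.inr x) = 0 :=
        init_inr 3 n U L ω x
      rw [this, abs_zero]; omega
  obtain ⟨s, ⟨m, hm, hx⟩, hs⟩ := (d1.seq (d2.seq (d3.seq (d4.seq (d5.seq (d6.seq (d7.seq
    (d8.seq (d9.seq (d10.seq (d11.seq d12))))))))))) _ hinit
  refine ⟨s, m, hx, hm, fun hbad => ?_⟩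
  -- the answer
  have h65 (x : Var) (h1 : x ≠ .r) (h2 : x ≠ .m) (h3 : x ≠ .go) (h4 : x ≠ .coin) : σ₆ x = σ₅ x :=
    f6 x h1 h2 h3 h4
  have h6 : HasPrints F p n U (rotX.eval (afterRot σ₃)) (rotY.eval (afterRot σ₃))
      (afterRot σ₃ .sm) (coinVal ω b) L [] σ₆ := by
    have h6R (x : Var) (h1 : x ≠ .r) (h2 : x ≠ .m) (h3 : x ≠ .go) (h4 : x ≠ .coin)
        (h5 : ∀ j, x ≠ .tx j ∧ x ≠ .ty j ∧ x ≠ .ts j) : σ₆ x = afterRot σ₃ x :=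
      (h65 x h1 h2 h3 h4).trans (afterTrans_of_notMem _ h5)
    have fx (j : Fin 4) : σ₆ (.fx j) = 1 :=
      (h65 (.fx j) (by simp) (by simp) (by simp) (by simp)).trans
      (g5 (.fx j) rfl rfl (by simp [itemVars]) (by simp) (by simp) (by simp) (by simp))
    have fy (j : Fin 4) : σ₆ (.fy j) = 0 :=
      ((h65 (.fy j) (by simp) (by simp) (by simp) (by simp)).trans
      (g5 (.fy j) rfl rfl (by simp [itemVars]) (by simp) (by simp) (by simp) (by simp))).trans
      (h0 (.fy j) (by simp) (by simp))
    have gx : σ₆ .gx = 1 := (h65 .gx (by simp) (by simp) (by simp) (by simp)).trans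
      (g5 .gx rfl rfl (by simp [itemVars]) (by simp) (by simp) (by simp) (by simp))
    have gy : σ₆ .gy = 0 := ((h65 .gy (by simp) (by simp) (by simp) (by simp)).trans
      (g5 .gy rfl rfl (by simp [itemVars]) (by simp) (by simp) (by simp) (by simp))).trans
      (h0 .gy (by simp) (by simp))
    have hp1 : (1 : ℤ) < p := by exact_mod_cast hg.prime.one_lt
    refine ⟨q3.afterRot.congr fun x hx => ?_,
      eval_rotX_congr (h6R _ (by decide) (by decide) (by decide) (by decide) (by decide))
        (h6R _ (by decide) (by decide) (by decide) (by decide) (by decide))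
        (h6R _ (by decide) (by decide) (by decide) (by decide) (by decide)),
      eval_rotY_congr (h6R _ (by decide) (by decide) (by decide) (by decide) (by decide))
        (h6R _ (by decide) (by decide) (by decide) (by decide) (by decide))
        (h6R _ (by decide) (by decide) (by decide) (by decide) (by decide)),
      h6R _ (by decide) (by decide) (by decide) (by decide) (by decide), hr,
      fun j => by rw [fx]; omega, fun j => by rw [fy]; omega, by rw [gx]; omega, by rw [gy]; omega,
      fun ι _ j => by simp [fx, fy, labelled], fun ι _ => by simp [gx, gy, labelled]⟩
    fin_cases hx <;> exact h6R _ (by decide) (by decide) (by decide) (by decide) (by decide)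
  have h7 := hasPrints_passItems hg.prime hLb hheights.lt_prime h6
  have f7 (x : Var) (hx : prints x = v x) (hx' : x ∉ itemVars) : passItems prints L σ₆ x = σ₆ x :=
    passItems_of_notMem hx hx' L σ₆
  obtain ⟨o, ho, hsol⟩ := hE' (coinVal ω b) (coinVal_lt ω b) hbad _ h7 fun j =>
    ⟨(f7 (.tx j) rfl (by simp [itemVars])).trans
        (h65 (.tx j) (by simp) (by simp) (by simp) (by simp)),
      (f7 (.ty j) rfl (by simp [itemVars])).trans
        (h65 (.ty j) (by simp) (by simp) (by simp) (by simp)),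
      (f7 (.ts j) rfl (by simp [itemVars])).trans
        (h65 (.ts j) (by simp) (by simp) (by simp) (by simp))⟩
  refine ⟨o, ?_, hsol⟩
  have hvar : ∀ x, s.reg (.inl x) = blockVal finish (passItems prints L σ₆) x := hs.var
  cases o with
  | none => exact (hvar .verdict).trans ho
  | some o =>
    obtain ⟨h1, h2, h3, h4, h5⟩ := ho
    refine ⟨(hvar .verdict).trans h1, ?_, ?_, ?_, ?_⟩
    · rw [← hvar, ← hvar] at h2; exact h2
    · rw [← hvar, ← hvar] at h3; exact h3
    · rw [← hvar, ← hvar] at h4; exact h4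
    · rw [← hvar, ← hvar] at h5; exact h5

open MeasureTheory

/-! ### The probability of an error and the memory -/

lemma coinVal_inj {ω ω' : ℕ → Bool} {b : ℕ} (h : coinVal ω b = coinVal ω' b) {i : ℕ} (hi : i < b) :
    ω i = ω' i := by
  induction b with
  | zero => omega
  | succ b ih =>
    simp only [coinVal] at h
    have hb : ω b = ω' b := by
      cases h1 : ω b <;> cases h2 : ω' b <;> simp [h1, h2] at h ⊢ <;> omega
    rw [hb] at h
    rcases Nat.lt_succ_iff_lt_or_eq.1 hi with hi | rfl
    · exact ih (by omega) hi
    · exact hb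

instance : IsProbabilityMeasure coinLaw := by unfold coinLaw; infer_instance

/-- A number is found with probability at most `2 ^ (-b)`. -/
lemma coinLaw_coinVal_eq_le (b e : ℕ) : coinLaw {ω | coinVal ω b = e} ≤ ((2 : ENNReal) ^ b)⁻¹ := by
  by_cases h : ∃ ω₀, coinVal ω₀ b = e
  · obtain ⟨ω₀, h0⟩ := h
    have hsub : {ω | coinVal ω b = e} ⊆ Set.pi (Finset.range b : Set ℕ) fun i => {ω₀ i} :=
      fun ω hω i hi => coinVal_inj ((show coinVal ω b = e from hω).trans h0.symm)
        (Finset.mem_range.1 hi)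
    refine (measure_mono hsub).trans ?_
    rw [coinLaw, Measure.infinitePi_pi _ fun i _ => measurableSet_singleton _]
    simp only [PMF.toMeasure_apply_singleton _ _ (measurableSet_singleton _),
      PMF.uniformOfFintype_apply, Fintype.card_bool, Finset.prod_const, Finset.card_range]
    rw [ENNReal.inv_pow]
    norm_cast
  · rw [not_exists] at h
    simp [h]

lemma coinLaw_coinVal_mem_le (b : ℕ) (E : Finset ℕ) :
    coinLaw {ω | coinVal ω b ∈ E} ≤ E.card * ((2 : ENNReal) ^ b)⁻¹ := by
  have : {ω | coinVal ω b ∈ E} = ⋃ e ∈ E, {ω | coinVal ω b = e} := by ext; simp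
  rw [this]
  refine (measure_biUnion_finset_le E _).trans ?_
  rw [← nsmul_eq_mul]
  exact Finset.sum_le_card_nsmul _ _ _ fun e _ => coinLaw_coinVal_eq_le b e

/-- If the coins lead to an error only if they form one of `4 n` numbers of `b` digits, where
`2 ^ b ≥ 4 n²`, then the probability of success is at least `1 - 1 / n`. -/
lemma le_coinLaw {n b : ℕ} (hn : 2 ≤ n) {E : Finset ℕ} (hE : E.card ≤ 4 * n)
    (hb : 4 * n ^ 2 ≤ 2 ^ b) {S : Set (ℕ → Bool)} (hS : ∀ ω, coinVal ω b ∉ E → ω ∈ S) :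
    ENNReal.ofReal (1 - 1 / (n : ℝ)) ≤ coinLaw S := by
  have h1 : (E.card : ENNReal) * (2 ^ b)⁻¹ ≤ ENNReal.ofReal (1 / n) := by
    have h2 : (E.card : ENNReal) * (2 ^ b)⁻¹ = ENNReal.ofReal (E.card / 2 ^ b) := by
      rw [ENNReal.ofReal_div_of_pos (by positivity), ENNReal.ofReal_pow (by norm_num)]
      simp [div_eq_mul_inv]
    rw [h2]
    refine ENNReal.ofReal_le_ofReal ?_
    have hE' : (E.card : ℝ) ≤ 4 * n := by exact_mod_cast hE
    have hb' : 4 * (n : ℝ) ^ 2 ≤ 2 ^ b := by exact_mod_cast hb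
    have hn' : (0 : ℝ) < n := by positivity
    rw [div_le_div_iff₀ (by positivity) hn']
    nlinarith
  have h3 : (1 : ENNReal) ≤ coinLaw S + ENNReal.ofReal (1 / n) := by
    rw [← measure_univ (μ := coinLaw)]
    refine (measure_mono (t := S ∪ {ω | coinVal ω b ∈ E}) fun ω _ => ?_).trans
      ((measure_union_le _ _).trans ?_)
    · by_cases h : coinVal ω b ∈ E
      · exact .inr h
      · exact .inl (hS ω h)
    · gcongr
      exact (coinLaw_coinVal_mem_le b E).trans h1
  rw [ENNReal.ofReal_sub _ (by positivity), ENNReal.ofReal_one]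
  exact tsub_le_iff_right.2 h3

lemma size_le_logb {k : ℕ} (hk : 1 ≤ k) : (Nat.size k : ℝ) ≤ Real.logb 2 k + 1 := by
  have h1 : Nat.size k ≠ 0 := fun h => by rw [Nat.size_eq_zero] at h; omega
  have h2 : 2 ^ (Nat.size k - 1) ≤ k := Nat.lt_size.1 (by omega)
  have h3 : ((Nat.size k - 1 : ℕ) : ℝ) ≤ Real.logb 2 k := by
    rw [Real.le_logb_iff_rpow_le (by norm_num) (by positivity), Real.rpow_natCast]
    exact_mod_cast h2
  rw [Nat.cast_sub (by omega)] at h3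
  push_cast at h3
  linarith

/-- Registers that are polynomially bounded in `n U` need `O(log n + log U)` bits. -/
lemma memBound_le (ι : Type) [Fintype ι] (e : ℕ) {n U : ℕ} (hn : 2 ≤ n) (hU : 1 ≤ U) :
    (memBound ι ((2 * n * U : ℤ) ^ e) : ℝ) ≤ Fintype.card ι * (2 * e + 2) *
      (Real.logb 2 n * (Real.logb 2 n + Real.logb 2 U)) := by
  have ln : 1 ≤ Real.logb 2 n := by
    rw [Real.le_logb_iff_rpow_le (by norm_num) (by positivity), Real.rpow_one]
    exact_mod_cast hn
  have lU : 0 ≤ Real.logb 2 U := Real.logb_nonneg (by norm_num) (by exact_mod_cast hU)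
  have hV : 1 ≤ (2 * n * U) ^ e := Nat.one_le_pow _ _ (by positivity)
  have h1 : ((2 * n * U : ℤ) ^ e).natAbs = (2 * n * U) ^ e := by
    rw [Int.natAbs_pow]; rfl
  have h2 : Real.logb 2 ((2 * n * U) ^ e : ℕ) = e * (1 + Real.logb 2 n + Real.logb 2 U) := by
    have hn0 : (n : ℝ) ≠ 0 := by positivity
    have hU0 : (U : ℝ) ≠ 0 := by positivity
    push_cast
    rw [Real.logb_pow, Real.logb_mul (by positivity) hU0, Real.logb_mul (by norm_num) hn0,
      Real.logb_self_eq_one (by norm_num)]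
  have h3 := size_le_logb hV
  rw [h2] at h3
  unfold memBound bits
  rw [h1]
  push_cast
  rw [mul_assoc (Fintype.card ι : ℝ)]
  refine mul_le_mul_of_nonneg_left ?_ (Nat.cast_nonneg _)
  generalize Real.logb 2 n = x at *
  generalize Real.logb 2 U = y at *
  have h4 : x + y ≤ x * (x + y) := le_mul_of_one_le_left (by linarith) ln
  have h5 : (e : ℝ) * (1 + x + y) ≤ e * (2 * (x * (x + y))) := by gcongr; linarith
  linarith

end CongStream

theorem theorem1 :
    ∃ (P : CongStream.Algorithm) (C : ℝ), ∀ n U : ℕ, 2 ≤ n → 1 ≤ U →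
      ∀ L : List CongStream.Item, CongStream.IsInstance n U L →
        (∀ ω : ℕ → Bool, ∃ (s : CongStream.Config P.ι) (m : ℕ), P.Run 3 n U L ω s m ∧
          (m : ℝ) ≤ C * (Real.logb 2 n * (Real.logb 2 n + Real.logb 2 U))) ∧
        ENNReal.ofReal (1 - 1 / (n : ℝ)) ≤
          CongStream.coinLaw {ω | P.Succeeds 3 n U L ω} := by
  refine ⟨CongStream.algorithm, Fintype.card (CongStream.Reg CongStream.Var CongStream.depth) *
    (2 * (CongStream.weight ^ 8 : ℕ) + 2), fun n U hn hU L hL => ?_⟩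
  obtain ⟨b, E, hE, hb, h⟩ := CongStream.exists_run hn hU hL
  refine ⟨fun ω => ?_, CongStream.le_coinLaw hn hE hb fun ω hω => ?_⟩
  · obtain ⟨s, m, hrun, hm, -⟩ := h ω
    exact ⟨s, m, hrun, (Nat.cast_le.2 hm).trans (CongStream.memBound_le _ _ hn hU)⟩
  · obtain ⟨s, m, hrun, -, ho⟩ := h ω
    obtain ⟨o, ho⟩ := ho hω
    exact ⟨s, m, o, hrun, ho⟩
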